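/- Let $n\ge 2$ and let $\Gamma$ be a connected simple graph with vertex set $[n]=\{1,\dots,n\}$. \emph{Splines.} Let $S_n$ act on $\mathbb C[t_1,\dots,t_n]$ by $t_i\mapsto t_{w(i)}$. Let $\mathcal M_\Gamma$ be the ring of all $\rho\colon S_n\to\mathbb C[t_1,\dots,t_n]$ such that $\rho(w)-\rho(w(i,j))\in\langle t_{w(i)}-t_{w(j)}\rangle$ for all $w\in S_n$ and all edges $(i,j)$ of $\Gamma$ (with pointwise operations), graded by polynomial degree, with the dot action $(w\cdot\rho)(v)=w\,\rho(w^{-1}v)$ of $S_n$. Let $\bar t_i,\bar x_i\in\mathcal M_\Gamma$ be $\bar t_i(w)=t_i$ and $\bar x_i(w)=t_{w(i)}$. The quotients $\mathcal M_\Gamma/\langle\bar t_1,\dots,\bar t_n\rangle$ and $\mathcal M_\Gamma/\langle\bar x_1,\dots,\bar x_n\rangle$ are graded $S_n$-representations; let $L_{\Gamma,1}$ and $R_{\Gamma,1}$ be the Frobenius characters of their degree-one pieces, where the Frobenius character of a representation with character $\chi$ is $\frac1{n!}\sum_{w\in S_n}\chi(w)\,p_{\mathrm{cyc}(w)}$,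 with $p_\mu$ the power sum symmetric function and $\mathrm{cyc}(w)$ the cycle type of $w$. Let $h_\mu$ and $s_\mu$ denote the complete homogeneous and the Schur symmetric functions. \emph{Graph data.} A graph is $2$-connected if it is connected and stays connected after the removal of any one vertex (so a single edge is $2$-connected); a block of $\Gamma$ is a maximal $2$-connected subgraph; a cut vertex is a vertex $j$ such that $\Gamma-j$ is disconnected, and then $c(j)+1$ denotes the number of connected components of $\Gamma-j$. The block-cut tree has as vertices the cut vertices and the blocks of $\Gamma$, a cut vertex being joined to each block that contains it. Let $\mathrm{LB}_\Gamma$ be the set of blocks that are leaves (vertices of degree one) of the block-cut tree, and $\mathrm{IB}_\Gamma$ the set of all other blocks (so $\mathrm{LB}_\Gamma=\emptyset$ and $\mathrm{IB}_\Gamma=\{\Gamma\}$ if $\Gamma$ is $2$-connected). Let $\mathrm{IC}_\Gamma$ be the set of edges of $\Gamma$ whose two end points form the vertex set of a block in $\mathrm{IB}_\Gamma$ (the internal cut edges). For $e\in\mathrm{IC}_\Gamma$ let $G_e$ be any connected component of $([n],E(\Gamma)\setminus\{e\})$, and let $\lambda_e$ be the partition of $n$ with parts $n-|G_e|$ and $|G_e|$.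 \emph{Claim.} Every $e\in\mathrm{IC}_\Gamma$ is a cut edge of $\Gamma$, the integer $n-1-\sum_{j}c(j)$, summed over the cut vertices $j$ of $\Gamma$, is non-negative, and $$L_{\Gamma,1}=\sum_{e\in\mathrm{IC}_\Gamma}h_{\lambda_e}+\bigl(|\mathrm{LB}_\Gamma|+|\{B\in\mathrm{IB}_\Gamma: |B|>2\}|-1\bigr)h_{n-1,1}+\Bigl(n-1-\sum_{j}c(j)\Bigr)h_n,$$ $$R_{\Gamma,1}=\sum_{e\in\mathrm{IC}_\Gamma}\bigl(h_{\lambda_e}-s_n\bigr)+\bigl(|\mathrm{LB}_\Gamma|+|\{B\in\mathrm{IB}_\Gamma: |B|>2\}|\bigr)s_{n-1,1}.$$ Moreover $L_{\Gamma,1}$ is $h$-positive, i.e. a linear combination of the $h_\mu$ ($\mu$ a partition of $n$) with non-negative integer coefficients. -/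

import Mathlib

open Equiv MvPolynomial

noncomputable section

namespace CayleySpline

/-! ### Splines on the Cayley graph of the symmetric group attached to a graph on `Fin n` -/

section Splines

variable {n : ℕ}

/-- The ring of splines: families `ρ : S_n → ℂ[t]` such that
`ρ(w) - ρ(w (i j))` lies in the ideal `⟨t_{w(i)} - t_{w(j)}⟩` for every edge `(i, j)`. -/
def splines (Γ : SimpleGraph (Fin n)) :
    Subalgebra ℂ (Perm (Fin n) → MvPolynomial (Fin n) ℂ) where
  carrier := {ρ | ∀ (w : Perm (Fin n)) (i j : Fin n), Γ.Adj i j →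
    ρ w - ρ (w * swap i j) ∈
      Ideal.span ({X (w i) - X (w j)} : Set (MvPolynomial (Fin n) ℂ))}
  mul_mem' := by
    intro a b ha hb w i j h
    have e : (a * b) w - (a * b) (w * swap i j) =
        a w * (b w - b (w * swap i j)) + b (w * swap i j) * (a w - a (w * swap i j)) := by
      simp only [Pi.mul_apply]; ring
    rw [e]
    exact Ideal.add_mem _ (Ideal.mul_mem_left _ _ (hb w i j h))
      (Ideal.mul_mem_left _ _ (ha w i j h))
  add_mem' := by
    intro a b ha hb w i j h
    have e : (a + b) w - (a + b) (w * swap i j) =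
        (a w - a (w * swap i j)) + (b w - b (w * swap i j)) := by
      simp only [Pi.add_apply]; ring
    rw [e]
    exact Ideal.add_mem _ (ha w i j h) (hb w i j h)
  algebraMap_mem' := by
    intro c w i j _
    simp

/-- The constant spline `w ↦ t_i`. -/
def tSpline (Γ : SimpleGraph (Fin n)) (i : Fin n) : splines Γ :=
  ⟨fun _ => X i, fun w i j _ => by simp⟩

/-- The spline `w ↦ t_{w(i)}`. -/
def xSpline (Γ : SimpleGraph (Fin n)) (i : Fin n) : splines Γ :=
  ⟨fun w => X (w i), fun w a b _ => by
    simp only [Perm.mul_apply, swap_apply_def]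
    split_ifs with h1 h2
    · subst h1
      exact Ideal.mem_span_singleton_self _
    · subst h2
      exact Ideal.mem_span_singleton'.2 ⟨-1, by ring⟩
    · simp⟩

theorem dot_mem (Γ : SimpleGraph (Fin n)) (w : Perm (Fin n))
    {ρ : Perm (Fin n) → MvPolynomial (Fin n) ℂ} (hρ : ρ ∈ splines Γ) :
    (fun v => rename w (ρ (w⁻¹ * v))) ∈ splines Γ := by
  intro v i j h
  have := Ideal.mem_map_of_mem (rename w : MvPolynomial (Fin n) ℂ →ₐ[ℂ] _) (hρ (w⁻¹ * v) i j h)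
  rw [Ideal.map_span] at this
  simpa [mul_assoc] using this

/-- The dot action `(w · ρ)(v) = w (ρ(w⁻¹ v))` of `S_n` on splines, where `S_n` acts on
polynomials by `t_i ↦ t_{w(i)}`. -/
def dotAction (Γ : SimpleGraph (Fin n)) : Representation ℂ (Perm (Fin n)) (splines Γ) where
  toFun w :=
    { toFun := fun ρ => ⟨fun v => rename w (ρ.1 (w⁻¹ * v)), dot_mem Γ w ρ.2⟩
      map_add' := fun a b => by ext1; funext v; simp
      map_smul' := fun c a => by ext1; funext v; simp }
  map_one' := by
    ext1 a; ext1; funext v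
    simp
  map_mul' w u := by
    ext1 a; ext1; funext v
    simp [rename_rename, mul_assoc, Perm.coe_mul]

/-- The homogeneous splines of degree `d`. -/
def homogeneousSplines (Γ : SimpleGraph (Fin n)) (d : ℕ) : Submodule ℂ (splines Γ) where
  carrier := {ρ | ∀ w, (ρ.1 w).IsHomogeneous d}
  add_mem' ha hb w := (ha w).add (hb w)
  zero_mem' _ := isHomogeneous_zero _ _ _
  smul_mem' c a ha w := by
    have := (isHomogeneous_C (Fin n) c).mul (ha w)
    rw [zero_add, ← smul_eq_C_mul] at this
    exact this

/-- The ideal `⟨t̄_1, …, t̄_n⟩` of the ring of splines. -/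
def leftIdeal (Γ : SimpleGraph (Fin n)) : Ideal (splines Γ) :=
  Ideal.span (Set.range (tSpline Γ))

/-- The ideal `⟨x̄_1, …, x̄_n⟩` of the ring of splines. -/
def rightIdeal (Γ : SimpleGraph (Fin n)) : Ideal (splines Γ) :=
  Ideal.span (Set.range (xSpline Γ))

theorem dotAction_mul (Γ : SimpleGraph (Fin n)) (w : Perm (Fin n)) (a b : splines Γ) :
    dotAction Γ w (a * b) = dotAction Γ w a * dotAction Γ w b := by
  ext1; funext v; simp [dotAction]

theorem span_stable (Γ : SimpleGraph (Fin n)) (w : Perm (Fin n)) (s : Set (splines Γ))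
    (hs : ∀ a ∈ s, dotAction Γ w a ∈ s) :
    (Ideal.span s).restrictScalars ℂ ≤
      ((Ideal.span s).restrictScalars ℂ).comap (dotAction Γ w) := by
  intro a ha
  change dotAction Γ w a ∈ Ideal.span s
  change a ∈ Ideal.span s at ha
  induction ha using Submodule.span_induction with
  | mem x hx => exact Ideal.subset_span (hs x hx)
  | zero => simp
  | add x y _ _ hx hy => rw [map_add]; exact Ideal.add_mem _ hx hy
  | smul r x _ hx =>
    rw [smul_eq_mul, dotAction_mul]; exact Ideal.mul_mem_left _ _ hx

theorem leftIdeal_stable (Γ : SimpleGraph (Fin n)) (w : Perm (Fin n)) :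
    (leftIdeal Γ).restrictScalars ℂ ≤
      ((leftIdeal Γ).restrictScalars ℂ).comap (dotAction Γ w) := by
  refine span_stable Γ w _ ?_
  rintro _ ⟨i, rfl⟩
  refine ⟨w i, ?_⟩
  ext1; funext v; simp [dotAction, tSpline]

theorem rightIdeal_stable (Γ : SimpleGraph (Fin n)) (w : Perm (Fin n)) :
    (rightIdeal Γ).restrictScalars ℂ ≤
      ((rightIdeal Γ).restrictScalars ℂ).comap (dotAction Γ w) := by
  refine span_stable Γ w _ ?_
  rintro _ ⟨i, rfl⟩
  refine ⟨i, ?_⟩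
  ext1; funext v; simp [dotAction, xSpline]

theorem homogeneous_stable (Γ : SimpleGraph (Fin n)) (d : ℕ) (w : Perm (Fin n)) :
    homogeneousSplines Γ d ≤ (homogeneousSplines Γ d).comap (dotAction Γ w) :=
  fun _ ha v => (ha (w⁻¹ * v)).rename_isHomogeneous

theorem map_stable (Γ : SimpleGraph (Fin n)) (d : ℕ) (I : Submodule ℂ (splines Γ))
    (hI : ∀ w, I ≤ I.comap (dotAction Γ w)) (w : Perm (Fin n)) :
    (homogeneousSplines Γ d).map I.mkQ ≤
      ((homogeneousSplines Γ d).map I.mkQ).comap ((dotAction Γ).quotient I hI w) := by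
  rintro _ ⟨a, ha, rfl⟩
  exact ⟨dotAction Γ w a, homogeneous_stable Γ d w ha, rfl⟩

/-- The degree `d` piece of the left quotient `splines Γ ⧸ ⟨t̄_1, …, t̄_n⟩`. -/
abbrev LeftPiece (Γ : SimpleGraph (Fin n)) (d : ℕ) :
    Submodule ℂ (splines Γ ⧸ (leftIdeal Γ).restrictScalars ℂ) :=
  (homogeneousSplines Γ d).map ((leftIdeal Γ).restrictScalars ℂ).mkQ

/-- The degree `d` piece of the right quotient `splines Γ ⧸ ⟨x̄_1, …, x̄_n⟩`. -/
abbrev RightPiece (Γ : SimpleGraph (Fin n)) (d : ℕ) :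
    Submodule ℂ (splines Γ ⧸ (rightIdeal Γ).restrictScalars ℂ) :=
  (homogeneousSplines Γ d).map ((rightIdeal Γ).restrictScalars ℂ).mkQ

/-- The representation of `S_n` on the degree `d` piece of the left quotient. -/
def leftRep (Γ : SimpleGraph (Fin n)) (d : ℕ) :
    Representation ℂ (Perm (Fin n)) (LeftPiece Γ d) :=
  ((dotAction Γ).quotient _ (leftIdeal_stable Γ)).subrepresentation _
    (map_stable Γ d _ (leftIdeal_stable Γ))

/-- The representation of `S_n` on the degree `d` piece of the right quotient. -/
def rightRep (Γ : SimpleGraph (Fin n)) (d : ℕ) :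
    Representation ℂ (Perm (Fin n)) (RightPiece Γ d) :=
  ((dotAction Γ).quotient _ (rightIdeal_stable Γ)).subrepresentation _
    (map_stable Γ d _ (rightIdeal_stable Γ))

/-- The graded pieces are finite dimensional, so traces on them are meaningful. -/
instance finite_homogeneousSplines (Γ : SimpleGraph (Fin n)) (d : ℕ) :
    Module.Finite ℂ (homogeneousSplines Γ d) := by
  have : Module.Finite ℂ (homogeneousSubmodule (Fin n) ℂ d) :=
    Module.Finite.iff_fg.2 (homogeneousSubmodule_fg (Fin n) ℂ d)
  let f : homogeneousSplines Γ d →ₗ[ℂ] (Perm (Fin n) → homogeneousSubmodule (Fin n) ℂ d) :=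
    { toFun := fun a w => ⟨a.1.1 w, a.2 w⟩
      map_add' := fun _ _ => rfl
      map_smul' := fun _ _ => rfl }
  refine Module.Finite.of_injective f fun a b h => ?_
  ext1; ext1; funext w
  exact congrArg Subtype.val (congrFun h w)

end Splines

/-! ### Symmetric functions

Symmetric functions are regarded as elements of the ring of formal power series in the
variables `x_0, x_1, x_2, …` with complex coefficients. -/

/-- The complete homogeneous symmetric function `h_k`: the sum of all monomials of degree `k`. -/
def completeHomogeneous (k : ℕ) : MvPowerSeries ℕ ℂ :=
  fun m => if m.degree = k then 1 else 0

/-- The complete homogeneous symmetric function `h_μ = ∏ h_{μ_i}`. -/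
def hSym {n : ℕ} (μ : n.Partition) : MvPowerSeries ℕ ℂ :=
  (μ.parts.map completeHomogeneous).prod

open Classical in
/-- The power sum `p_k = ∑ x_i ^ k` (for `k ≥ 1`). -/
def powerSum (k : ℕ) : MvPowerSeries ℕ ℂ :=
  fun m => if ∃ i, m = Finsupp.single i k then 1 else 0

/-- The Young diagram whose row lengths are the parts of `μ`. -/
def diagram {n : ℕ} (μ : n.Partition) : YoungDiagram :=
  YoungDiagram.ofRowLens (μ.parts.sort (· ≥ ·)) (Multiset.pairwise_sort _ _).sortedGE

/-- The Schur function `s_μ`: the coefficient of `x^m` is the number of semistandard Young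
tableaux of shape `μ` in which each `i` occurs exactly `m i` times. -/
def schur {n : ℕ} (μ : n.Partition) : MvPowerSeries ℕ ℂ :=
  fun m => (Nat.card {T : SemistandardYoungTableau (diagram μ) //
    ∀ i : ℕ, ((diagram μ).cells.filter fun c => T c.1 c.2 = i).card = m i} : ℂ)

/-- The Frobenius characteristic `(1 / n!) ∑_w χ(w) p_{cyc(w)}` of a representation of `S_n`,
where `cyc(w)` is the cycle type of `w`, fixed points included. -/
def frobenius {n : ℕ} {V : Type*} [AddCommGroup V] [Module ℂ V]
    (ρ : Representation ℂ (Perm (Fin n)) V) : MvPowerSeries ℕ ℂ :=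
  ((n.factorial : ℂ)⁻¹) • ∑ w : Perm (Fin n),
    ρ.character w • (w.partition.parts.map powerSum).prod

/-- The degree `d` piece of the Frobenius character of the left quotient. -/
def leftChar {n : ℕ} (Γ : SimpleGraph (Fin n)) (d : ℕ) : MvPowerSeries ℕ ℂ :=
  frobenius (leftRep Γ d)

/-- The degree `d` piece of the Frobenius character of the right quotient. -/
def rightChar {n : ℕ} (Γ : SimpleGraph (Fin n)) (d : ℕ) : MvPowerSeries ℕ ℂ :=
  frobenius (rightRep Γ d)

/-- The partition `(n - a, a)` of `n`, reordered and with a zero part dropped if necessary. -/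
def twoPart (n a : ℕ) (ha : a ≤ n) : n.Partition :=
  Nat.Partition.ofSums n {n - a, a} (by simp; omega)

/-! ### Cut vertices, blocks and the block-cut tree -/

section Graph

variable {V : Type*}

/-- `G` is `k`-connected if removing fewer than `k` vertices never disconnects it. -/
def IsVertexConnected (G : SimpleGraph V) (k : ℕ) : Prop :=
  ∀ A : Set V, A.encard < k → (G.induce Aᶜ).Preconnected

/-- `v` is a cut vertex if `G - v` is disconnected. -/
def IsCutVertex (G : SimpleGraph V) (v : V) : Prop :=
  ¬ (G.induce {v}ᶜ).Preconnected

/-- A block is a maximal 2-connected subgraph. -/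
def IsBlock {G : SimpleGraph V} (B : G.Subgraph) : Prop :=
  Maximal (fun H : G.Subgraph => IsVertexConnected H.coe 2) B

/-- The block-cut tree: its vertices are the cut vertices and the blocks of `G`, and a cut vertex
is joined to the blocks that contain it. -/
def blockCutTree (G : SimpleGraph V) :
    SimpleGraph ({v : V // IsCutVertex G v} ⊕ {B : G.Subgraph // IsBlock B}) where
  Adj
    | .inl v, .inr B => v.1 ∈ B.1.verts
    | .inr B, .inl v => v.1 ∈ B.1.verts
    | _, _ => False
  symm := ⟨by rintro (v | B) (v' | B') hh <;> exact hh⟩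
  loopless := ⟨by rintro (v | B) hh <;> exact hh⟩

/-- The leaf blocks: blocks that are leaves (vertices of degree one) of the block-cut tree. -/
def leafBlocks (G : SimpleGraph V) : Set G.Subgraph :=
  {B | ∃ hB : IsBlock B, ((blockCutTree G).neighborSet (.inr ⟨B, hB⟩)).encard = 1}

/-- The internal blocks: blocks that are not leaves of the block-cut tree. -/
def internalBlocks (G : SimpleGraph V) : Set G.Subgraph :=
  {B | IsBlock B ∧ B ∉ leafBlocks G}

open Classical in
/-- The internal cut edges: edges whose two end points form the vertex set of an internal block. -/
def internalCutEdges [Fintype V] (G : SimpleGraph V) : Finset (Sym2 V) :=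
  {e | e ∈ G.edgeSet ∧ ∃ B ∈ internalBlocks G, B.verts = (e : Set V)}

open Classical in
/-- The cut vertices of `G`. -/
def cutVertices [Fintype V] (G : SimpleGraph V) : Finset V :=
  {v | IsCutVertex G v}

/-- One less than the number of connected components of `G - v`. -/
def cutNumber (G : SimpleGraph V) (v : V) : ℕ :=
  Nat.card (G.induce {v}ᶜ).ConnectedComponent - 1

/-- `|LB| + #{B ∈ IB : |B| > 2}`, the number of blocks that are leaf blocks or are internal
with more than two vertices. -/
def blockCount (G : SimpleGraph V) : ℕ :=
  (leafBlocks G).ncard + {B ∈ internalBlocks G | 2 < B.verts.ncard}.ncard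

end Graph

/-- The partition `(n - |C|, |C|)` of `n` given by a connected component `C` of a graph
on `Fin n`. -/
def componentPartition {n : ℕ} {G : SimpleGraph (Fin n)} (C : G.ConnectedComponent) :
    n.Partition :=
  twoPart n C.supp.ncard (by simpa using Set.ncard_le_card C.supp)

end CayleySpline

end

/-! A degree-one spline is `ρ(w) = ∑ p, b p w • X (w p)`. Along an edge `x y` the spline condition
says that `b p` is unchanged by right multiplication with `swap x y` for every `p ≠ x, y`, and that
`∑ p, b p` takes the same value at `w` and `w * swap x y`. As Γ is connected, edge transpositions
generate S_n, so this sum is constant. In these coordinates (`IsTuple`, `toTuple_bijective`) the dot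
action is left translation.

The blocks decouple. Up to a constant, `b p` is minus the sum of the `b q` with `q ≠ p`, and each
such `q` lies in the direction of exactly one block at `p`. Grouping the `q` by that block, and
averaging over the group generated by the edges away from `p`, writes `b` as constants plus one
family for each block, varying only along the edges of that block (`sum_blockPart`,
`isBlockTuple_blockPart`). The splitting is unique up to constants, because along an edge only the
term of its own block can change (`eq_const_of_sum_eq_const`).

A single block B is solved explicitly. With at least three vertices, `b p w` is a constant plus the
sum of `c (w z)` over the `z` attached to B through `p`, for one function `c`. With two vertices `i,
j`, `b i w` is an arbitrary function of the set `w (branch B i)`, and `b j` is a constant minus `b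
i`. So, modulo constants, B contributes the functions on `a`-element subsets, where `a = a_B` is `1`
or the size of a branch.

Hence the trace of `u` on linear splines is `n + ∑ B, fixCount a_B u - #blocks` (`trace_translate`).
The left ideal removes the permutation representation on the `t̄_i`, the right ideal removes `n`
trivial ones. Burnside's lemma turns `fixCount a` into `h_a h_{n-a}` (`sum_fixCount_smul`), so L is
`n h_n + ∑ B, h_{a_B} h_{n-a_B} - #blocks h_n - h_{n-1,1}` and R is `∑ B, (h_{a_B} h_{n-a_B} -
h_n)`. Leaf blocks and blocks with more than two vertices give `h_{n-1,1}`, internal cut edges give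
`h_{λ_e}`, and counting incidences of vertices and blocks gives `#blocks = 1 + ∑ c(j)`. For
h-positivity, `#blocks ≤ n - 1`, and some block always supplies an `h_{n-1,1}` to cancel the
negative one. -/

noncomputable section

namespace CayleySpline

/-! ### Blocks of a connected graph, described by non-separation by a vertex -/

section Blocks

variable {V : Type*} {G : SimpleGraph V}

/-- `x` and `y` are joined by a walk that avoids `p`. -/
def Avoids (G : SimpleGraph V) (p x y : V) : Prop :=
  ∃ w : G.Walk x y, p ∉ w.support

theorem Avoids.symm {p x y : V} (h : Avoids G p x y) : Avoids G p y x := by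
  obtain ⟨w, hw⟩ := h
  exact ⟨w.reverse, by simpa using hw⟩

theorem Avoids.trans {p x y z : V} (h : Avoids G p x y) (h' : Avoids G p y z) :
    Avoids G p x z := by
  obtain ⟨w, hw⟩ := h
  obtain ⟨w', hw'⟩ := h'
  exact ⟨w.append w', by simp [SimpleGraph.Walk.mem_support_append_iff, hw, hw']⟩

theorem Avoids.refl {p x : V} (h : p ≠ x) : Avoids G p x x :=
  ⟨.nil, by simpa using h⟩

theorem Avoids.ne_left {p x y : V} (h : Avoids G p x y) : p ≠ x := by
  obtain ⟨w, hw⟩ := h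
  rintro rfl
  exact hw w.start_mem_support

theorem Avoids.ne_right {p x y : V} (h : Avoids G p x y) : p ≠ y := h.symm.ne_left

theorem Avoids.of_adj {p x y : V} (h : G.Adj x y) (hx : p ≠ x) (hy : p ≠ y) :
    Avoids G p x y :=
  ⟨h.toWalk, by simp [hx, hy]⟩

theorem Avoids.of_hom {V' : Type*} {G' : SimpleGraph V'} (f : G' →g G) {p : V} {a b : V'}
    (h : G'.Reachable a b) (hp : ∀ z, f z ≠ p) : Avoids G p (f a) (f b) := by
  obtain ⟨w⟩ := h
  refine ⟨w.map f, ?_⟩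
  rw [SimpleGraph.Walk.support_map]
  intro h
  obtain ⟨z, -, hz⟩ := List.mem_map.1 h
  exact hp z hz

theorem avoids_iff_reachable {p x y : V} (hx : x ∈ ({p}ᶜ : Set V)) (hy : y ∈ ({p}ᶜ : Set V)) :
    Avoids G p x y ↔ (G.induce {p}ᶜ).Reachable ⟨x, hx⟩ ⟨y, hy⟩ := by
  constructor
  · rintro ⟨w, hw⟩
    exact ⟨w.induce {p}ᶜ (fun z hz => by rintro rfl; exact hw hz)⟩
  · exact fun h => Avoids.of_hom (SimpleGraph.Embedding.induce _).toHom h fun z => z.2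

/-- No single vertex different from `x` and `y` separates `x` from `y`. -/
def Insep (G : SimpleGraph V) (x y : V) : Prop :=
  ∀ p, p ≠ x → p ≠ y → Avoids G p x y

theorem Insep.refl (x : V) : Insep G x x := fun _ h _ => Avoids.refl h

theorem Insep.of_adj {x y : V} (h : G.Adj x y) : Insep G x y :=
  fun _ hx hy => Avoids.of_adj h hx hy

/-- The vertex set of the block containing the edge `i j`. -/
def blockVerts (G : SimpleGraph V) (i j : V) : Set V :=
  {v | Insep G v i ∧ Insep G v j}

theorem left_mem_blockVerts {i j : V} (h : G.Adj i j) : i ∈ blockVerts G i j :=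
  ⟨Insep.refl i, Insep.of_adj h⟩

theorem right_mem_blockVerts {i j : V} (h : G.Adj i j) : j ∈ blockVerts G i j :=
  ⟨Insep.of_adj h.symm, Insep.refl j⟩

/-- Any `p` differs from one end of the edge, and both vertices reach that end while avoiding `p`.
The edge is essential: being inseparable is not transitive in general. -/
theorem insep_of_mem_blockVerts {i j x y : V} (hij : i ≠ j) (hx : x ∈ blockVerts G i j)
    (hy : y ∈ blockVerts G i j) : Insep G x y := by
  intro p hpx hpy
  by_cases hpi : p = i
  · subst hpi
    exact (hx.2 p hpx hij).trans (hy.2 p hpy hij).symm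
  · exact (hx.1 p hpx hpi).trans (hy.1 p hpy hpi).symm

/-- A path visits `p` at most once, so one of its two halves at `v` misses `p`. -/
theorem avoids_of_mem_isPath {x y p v : V} {w : G.Walk x y} (hw : w.IsPath)
    (hv : v ∈ w.support) (hp : p ≠ v) : Avoids G p x v ∨ Avoids G p v y := by
  classical
  by_contra! h
  have h1 : p ∈ (w.takeUntil v hv).support := by
    by_contra hc; exact h.1 ⟨_, hc⟩
  have h2 : p ∈ (w.dropUntil v hv).support := by
    by_contra hc; exact h.2 ⟨_, hc⟩
  rw [← SimpleGraph.Walk.take_spec w hv] at hw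
  rw [SimpleGraph.Walk.mem_support_iff] at h2
  rcases h2 with rfl | h2
  · exact hp rfl
  · have := hw.support_nodup
    rw [SimpleGraph.Walk.support_append, List.nodup_append] at this
    exact this.2.2 p h1 p h2 rfl

theorem mem_blockVerts_of_isPath {i j x y v : V} {w : G.Walk x y} (hw : w.IsPath)
    (hx : x ∈ blockVerts G i j) (hy : y ∈ blockVerts G i j) (hv : v ∈ w.support) :
    v ∈ blockVerts G i j := by
  constructor
  · intro p hpv hpi
    rcases avoids_of_mem_isPath hw hv hpv with h | h
    · exact h.symm.trans (hx.1 p h.ne_left hpi)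
    · exact h.trans (hy.1 p h.ne_right hpi)
  · intro p hpv hpi
    rcases avoids_of_mem_isPath hw hv hpv with h | h
    · exact h.symm.trans (hx.2 p h.ne_left hpi)
    · exact h.trans (hy.2 p h.ne_right hpi)

/-- The block containing the edge `i j`. -/
def edgeBlock (G : SimpleGraph V) (i j : V) : G.Subgraph :=
  (⊤ : G.Subgraph).induce (blockVerts G i j)

theorem edgeBlock_adj {i j x y : V} : (edgeBlock G i j).Adj x y ↔
    x ∈ blockVerts G i j ∧ y ∈ blockVerts G i j ∧ G.Adj x y := by
  simp [edgeBlock]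

theorem reachable_coe_induce {S : Set V} {A : Set ((⊤ : G.Subgraph).induce S).verts} {x y : V}
    (w : G.Walk x y) (hS : ∀ v ∈ w.support, v ∈ S)
    (hA : ∀ v ∈ w.support, ∀ h : v ∈ S, (⟨v, h⟩ : ((⊤ : G.Subgraph).induce S).verts) ∈ Aᶜ)
    (hx : x ∈ S) (hy : y ∈ S) :
    ((((⊤ : G.Subgraph).induce S).coe).induce Aᶜ).Reachable
      ⟨⟨x, hx⟩, hA x w.start_mem_support hx⟩ ⟨⟨y, hy⟩, hA y w.end_mem_support hy⟩ := by
  induction w with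
  | nil => rfl
  | @cons a b c hab w ih =>
    have hb : b ∈ S := hS b (by simp)
    have h1 := ih (fun v hv => hS v (by simp [hv])) (fun v hv => hA v (by simp [hv])) hb hy
    refine SimpleGraph.Reachable.trans (SimpleGraph.Adj.reachable ?_) h1
    simpa [hb] using ⟨hx, hab⟩

theorem isVertexConnected_edgeBlock (hG : G.Connected) {i j : V} (hij : G.Adj i j) :
    IsVertexConnected (edgeBlock G i j).coe 2 := by
  classical
  intro A hA
  have hA1 : A.Subsingleton := by
    rw [← Set.encard_le_one_iff_subsingleton]
    exact Order.le_of_lt_add_one (by simpa [one_add_one_eq_two] using hA)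
  rintro ⟨⟨x, hx⟩, hxA⟩ ⟨⟨y, hy⟩, hyA⟩
  have hx' : x ∈ blockVerts G i j := hx
  have hy' : y ∈ blockVerts G i j := hy
  have key : ∃ w : G.Walk x y, w.IsPath ∧ ∀ v ∈ w.support, ∀ h : v ∈ blockVerts G i j,
      (⟨v, h⟩ : (edgeBlock G i j).verts) ∈ Aᶜ := by
    rcases hA1.eq_empty_or_singleton with rfl | ⟨⟨p, hp⟩, rfl⟩
    · obtain ⟨w, hw⟩ := (hG.preconnected x y).exists_isPath
      exact ⟨w, hw, by simp⟩
    · obtain ⟨w, hw⟩ := insep_of_mem_blockVerts hij.ne hx' hy' p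
        (by rintro rfl; exact hxA rfl) (by rintro rfl; exact hyA rfl)
      refine ⟨w.bypass, w.bypass_isPath, fun v hv h => ?_⟩
      have := w.support_bypass_subset_support hv
      rintro heq
      have heq' : v = p := congrArg Subtype.val heq
      exact hw (heq' ▸ this)
  obtain ⟨w, hw, hwA⟩ := key
  exact reachable_coe_induce w (fun v hv => mem_blockVerts_of_isPath hw hx' hy' hv) hwA hx' hy'

theorem insep_of_isVertexConnected {H : G.Subgraph} (hH : IsVertexConnected H.coe 2) {x y : V}
    (hx : x ∈ H.verts) (hy : y ∈ H.verts) : Insep G x y := by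
  intro p hpx hpy
  have hA : ({z : H.verts | z.1 = p} : Set H.verts).encard < (2 : ℕ) := by
    have : ({z : H.verts | z.1 = p} : Set H.verts).encard ≤ 1 := by
      rw [Set.encard_le_one_iff_subsingleton]
      rintro ⟨a, _⟩ ha ⟨b, _⟩ hb
      exact Subtype.ext (Eq.trans ha (Eq.symm hb))
    exact lt_of_le_of_lt this (by norm_num)
  exact Avoids.of_hom (H.hom.comp (SimpleGraph.Embedding.induce _).toHom)
    (hH _ hA ⟨⟨x, hx⟩, hpx.symm⟩ ⟨⟨y, hy⟩, hpy.symm⟩) fun z => z.2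

theorem le_edgeBlock {H : G.Subgraph} (hH : IsVertexConnected H.coe 2) {i j : V}
    (hi : i ∈ H.verts) (hj : j ∈ H.verts) : H ≤ edgeBlock G i j := by
  have hv : ∀ v ∈ H.verts, v ∈ blockVerts G i j := fun v hv =>
    ⟨insep_of_isVertexConnected hH hv hi, insep_of_isVertexConnected hH hv hj⟩
  refine ⟨hv, fun x y hxy => ?_⟩
  rw [edgeBlock_adj]
  exact ⟨hv _ (H.edge_vert hxy), hv _ (H.edge_vert hxy.symm), hxy.adj_sub⟩

theorem isBlock_edgeBlock (hG : G.Connected) {i j : V} (hij : G.Adj i j) :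
    IsBlock (edgeBlock G i j) :=
  ⟨isVertexConnected_edgeBlock hG hij, fun _ hH hle =>
    le_edgeBlock hH (hle.1 (left_mem_blockVerts hij)) (hle.1 (right_mem_blockVerts hij))⟩

theorem IsBlock.eq_edgeBlock (hG : G.Connected) {B : G.Subgraph} (hB : IsBlock B) {i j : V}
    (hij : G.Adj i j) (hi : i ∈ B.verts) (hj : j ∈ B.verts) : B = edgeBlock G i j :=
  le_antisymm (le_edgeBlock hB.1 hi hj)
    (hB.2 (isVertexConnected_edgeBlock hG hij) (le_edgeBlock hB.1 hi hj))

/-- The empty subgraph and single vertices also satisfy `IsVertexConnected _ 2`. They are not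
maximal here, since each sits inside the block of some edge. -/
theorem IsBlock.exists_adj (hG : G.Connected) [Nontrivial V] {B : G.Subgraph} (hB : IsBlock B) :
    ∃ i j, G.Adj i j ∧ i ∈ B.verts ∧ j ∈ B.verts := by
  by_contra! hcon
  have hadj : ∀ x y, ¬ B.Adj x y := fun x y h =>
    hcon x y h.adj_sub (B.edge_vert h) (B.edge_vert h.symm)
  have hsub : B.verts.Subsingleton := by
    intro x hx y hy
    by_contra hne
    obtain ⟨w⟩ := hB.1 ∅ (by simp) ⟨⟨x, hx⟩, by simp⟩ ⟨⟨y, hy⟩, by simp⟩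
    cases w with
    | nil => exact hne rfl
    | cons h _ => exact hadj _ _ h
  have : ∃ i j, G.Adj i j ∧ B.verts ⊆ {i} := by
    rcases hsub.eq_empty_or_singleton with h | ⟨v, h⟩
    · obtain ⟨i⟩ := hG.nonempty
      obtain ⟨j, hj⟩ := hG.preconnected.exists_adj_of_nontrivial i
      exact ⟨i, j, hj, by simp [h]⟩
    · obtain ⟨j, hj⟩ := hG.preconnected.exists_adj_of_nontrivial v
      exact ⟨v, j, hj, by simp [h]⟩
  obtain ⟨i, j, hij, hsubs⟩ := this
  have hle : B ≤ edgeBlock G i j := by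
    refine ⟨fun v hv => ?_, fun x y h => absurd h (hadj x y)⟩
    rw [hsubs hv]
    exact left_mem_blockVerts hij
  have := hB.2 (isVertexConnected_edgeBlock hG hij) hle
  exact hcon i j hij (this.1 (left_mem_blockVerts hij)) (this.1 (right_mem_blockVerts hij))

theorem IsBlock.adj_iff (hG : G.Connected) [Nontrivial V] {B : G.Subgraph} (hB : IsBlock B)
    {x y : V} : B.Adj x y ↔ x ∈ B.verts ∧ y ∈ B.verts ∧ G.Adj x y := by
  obtain ⟨i, j, hij, hi, hj⟩ := hB.exists_adj hG
  rw [hB.eq_edgeBlock hG hij hi hj, edgeBlock_adj]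
  rfl

theorem IsBlock.insep {B : G.Subgraph} (hB : IsBlock B) {x y : V}
    (hx : x ∈ B.verts) (hy : y ∈ B.verts) : Insep G x y :=
  insep_of_isVertexConnected hB.1 hx hy

theorem IsBlock.mem_of_isPath (hG : G.Connected) [Nontrivial V] {B : G.Subgraph} (hB : IsBlock B)
    {x y v : V} {w : G.Walk x y} (hw : w.IsPath) (hx : x ∈ B.verts) (hy : y ∈ B.verts)
    (hv : v ∈ w.support) : v ∈ B.verts := by
  obtain ⟨i, j, hij, hi, hj⟩ := hB.exists_adj hG
  have h := hB.eq_edgeBlock hG hij hi hj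
  rw [h] at hx hy ⊢
  exact mem_blockVerts_of_isPath hw hx hy hv

theorem IsBlock.eq_of_adj (hG : G.Connected) {B B' : G.Subgraph} (hB : IsBlock B)
    (hB' : IsBlock B') {x y : V} (h : B.Adj x y) (h' : B'.Adj x y) : B = B' := by
  rw [hB.eq_edgeBlock hG h.adj_sub (B.edge_vert h) (B.edge_vert h.symm),
    hB'.eq_edgeBlock hG h.adj_sub (B'.edge_vert h') (B'.edge_vert h'.symm)]

/-- The dictionary between blocks at `p` and components of `G - p`, both seen as equivalence
relations on the neighbours of `p`. -/
theorem edgeBlock_eq_iff (hG : G.Connected) {p y z : V} (hy : G.Adj p y) (hz : G.Adj p z) :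
    edgeBlock G p y = edgeBlock G p z ↔ Avoids G p y z := by
  constructor
  · intro h
    have h1 : z ∈ (edgeBlock G p y).verts := h ▸ right_mem_blockVerts hz
    exact (isBlock_edgeBlock hG hy).insep (right_mem_blockVerts hy) h1 p hy.ne hz.ne
  · intro h
    refine (isBlock_edgeBlock hG hy).eq_edgeBlock hG hz (left_mem_blockVerts hy) ?_
    refine ⟨Insep.of_adj hz.symm, fun q hqz hqy => ?_⟩
    by_cases hqp : q = p
    · subst hqp; exact h.symm
    · exact (Avoids.of_adj hz.symm hqz hqp).trans (Avoids.of_adj hy hqp hqy)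

end Blocks

/-! ### Vertices that are not cut vertices -/

section CutVertices

variable {V : Type*} {G : SimpleGraph V} [Fintype V]

theorem mem_cutVertices {j : V} : j ∈ cutVertices G ↔ IsCutVertex G j := by
  simp [cutVertices]

/-- If `G - j` is preconnected it has at most one component, and the truncated subtraction in
`cutNumber` gives `0`. -/
theorem sum_cutNumber_cutVertices :
    ∑ j ∈ cutVertices G, cutNumber G j = ∑ j, cutNumber G j := by
  classical
  refine Finset.sum_subset (Finset.subset_univ _) fun j _ hj => ?_
  have h : (G.induce {j}ᶜ).Preconnected := by
    rwa [mem_cutVertices, IsCutVertex, not_not] at hj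
  have := h.subsingleton_connectedComponent
  rw [cutNumber]
  have := Finite.card_le_one_iff_subsingleton.2 this
  omega

end CutVertices

/-! ### Projection of the graph onto a block, and counting blocks -/

section Projection

variable {V : Type*} {G : SimpleGraph V} {B : G.Subgraph}

theorem exists_reachable_block (hG : G.Connected) (hne : B.verts.Nonempty) (v : V) :
    ∃ p ∈ B.verts, (G \ B.spanningCoe).Reachable v p := by
  obtain ⟨b, hb⟩ := hne
  obtain ⟨w⟩ := hG.preconnected v b
  induction w with
  | nil => exact ⟨_, hb, .refl _⟩
  | @cons a c d hac w ih =>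
    by_cases ha : a ∈ B.verts
    · exact ⟨a, ha, .refl _⟩
    · obtain ⟨p, hp, hr⟩ := ih hb
      refine ⟨p, hp, SimpleGraph.Reachable.trans (SimpleGraph.Adj.reachable ?_) hr⟩
      exact ⟨hac, fun h => ha (B.edge_vert h)⟩

open Classical in
/-- The vertex of `B` through which `v` is attached to `B`. -/
def blockProj (B : G.Subgraph) (v : V) : V :=
  if h : ∃ p ∈ B.verts, (G \ B.spanningCoe).Reachable v p then h.choose else v

variable [Nontrivial V]

theorem IsBlock.nonempty_verts (hG : G.Connected) (hB : IsBlock B) : B.verts.Nonempty := by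
  obtain ⟨i, _, _, hi, _⟩ := hB.exists_adj hG
  exact ⟨i, hi⟩

theorem blockProj_spec (hG : G.Connected) (hB : IsBlock B) (v : V) :
    blockProj B v ∈ B.verts ∧ (G \ B.spanningCoe).Reachable v (blockProj B v) := by
  have h := exists_reachable_block hG (hB.nonempty_verts hG) v
  rw [blockProj, dif_pos h]
  exact h.choose_spec

theorem blockProj_mem (hG : G.Connected) (hB : IsBlock B) (v : V) :
    blockProj B v ∈ B.verts := (blockProj_spec hG hB v).1

/-- A path between vertices of B stays in B, so its first edge would be an edge of B. Hence every
component of G without the edges of B meets B in exactly one vertex, which makes `blockProj` well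
defined. -/
theorem eq_of_reachable_block (hG : G.Connected) (hB : IsBlock B) {p q : V} (hp : p ∈ B.verts)
    (hq : q ∈ B.verts) (h : (G \ B.spanningCoe).Reachable p q) : p = q := by
  obtain ⟨w, hw⟩ := h.exists_isPath
  cases w with
  | nil => rfl
  | @cons _ c _ hpc w =>
    exfalso
    have hle : G \ B.spanningCoe ≤ G := sdiff_le
    have hc : c ∈ B.verts := by
      refine hB.mem_of_isPath hG (w := (SimpleGraph.Walk.cons hpc w).mapLe hle)
        (hw.mapLe hle) hp hq ?_
      simp
    exact hpc.2 ((hB.adj_iff hG).2 ⟨hp, hc, hpc.1⟩)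

theorem blockProj_eq_iff (hG : G.Connected) (hB : IsBlock B) {x y : V} :
    blockProj B x = blockProj B y ↔ (G \ B.spanningCoe).Reachable x y := by
  constructor
  · intro h
    exact (blockProj_spec hG hB x).2.trans (h ▸ (blockProj_spec hG hB y).2.symm)
  · intro h
    exact eq_of_reachable_block hG hB (blockProj_mem hG hB x) (blockProj_mem hG hB y)
      ((blockProj_spec hG hB x).2.symm.trans (h.trans (blockProj_spec hG hB y).2))

theorem blockProj_eq_self (hG : G.Connected) (hB : IsBlock B) {v : V} (hv : v ∈ B.verts) :
    blockProj B v = v :=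
  (eq_of_reachable_block hG hB hv (blockProj_mem hG hB v) (blockProj_spec hG hB v).2).symm

theorem blockProj_eq_of_adj (hG : G.Connected) (hB : IsBlock B) {x y : V} (h : G.Adj x y)
    (h' : ¬ B.Adj x y) : blockProj B x = blockProj B y :=
  (blockProj_eq_iff hG hB).2 (SimpleGraph.Adj.reachable ⟨h, h'⟩)

theorem avoids_blockProj (hG : G.Connected) (hB : IsBlock B) {q x : V}
    (hx : blockProj B x ≠ blockProj B q) : Avoids G q x (blockProj B x) := by
  obtain ⟨w⟩ := (blockProj_spec hG hB x).2
  have hle : G \ B.spanningCoe ≤ G := sdiff_le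
  refine ⟨w.mapLe hle, fun h => ?_⟩
  rw [SimpleGraph.Walk.support_mapLe_eq_support] at h
  classical
  exact hx ((blockProj_eq_iff hG hB).2 ⟨w.takeUntil q h⟩)

/-- Go from `x` to its projection, then inside B around `p`, then out to `y`: only the branch at `p`
is cut off by removing `p`. -/
theorem avoids_of_blockProj_ne (hG : G.Connected) (hB : IsBlock B) {p x y : V} (hp : p ∈ B.verts)
    (hx : blockProj B x ≠ p) (hy : blockProj B y ≠ p) : Avoids G p x y := by
  have hp' := blockProj_eq_self hG hB hp
  exact ((avoids_blockProj hG hB (by rwa [hp'])).trans (hB.insep (blockProj_mem hG hB x)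
    (blockProj_mem hG hB y) p hx.symm hy.symm)).trans
    (avoids_blockProj hG hB (by rwa [hp'])).symm

/-- The projection changes only along edges of B, so the branch at `p` can be left only through `p`
itself. -/
theorem blockProj_eq_of_avoids (hG : G.Connected) (hB : IsBlock B) {p x y : V}
    (h : Avoids G p x y) (hx : blockProj B x = p) : blockProj B y = p := by
  obtain ⟨w, hw⟩ := h
  induction w with
  | nil => exact hx
  | @cons a c d hac w ih =>
    simp only [SimpleGraph.Walk.support_cons, List.mem_cons, not_or] at hw
    refine ih ?_ hw.2
    rw [← blockProj_eq_of_adj hG hB hac, hx]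
    intro hB'
    rw [blockProj_eq_self hG hB (B.edge_vert hB')] at hx
    exact hw.1 hx.symm

theorem IsBlock.exists_adj_of_mem (hG : G.Connected) (hB : IsBlock B) {p : V}
    (hp : p ∈ B.verts) : ∃ y ∈ B.verts, G.Adj p y := by
  obtain ⟨i, j, hij, hi, hj⟩ := hB.exists_adj hG
  obtain ⟨q, hq, hpq⟩ : ∃ q ∈ B.verts, p ≠ q := by
    by_cases h : p = i
    · exact ⟨j, hj, h ▸ hij.ne⟩
    · exact ⟨i, hi, h⟩
  obtain ⟨w, hw⟩ := (hG.preconnected p q).exists_isPath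
  cases w with
  | nil => exact absurd rfl hpq
  | @cons _ c _ hpc w => exact ⟨c, hB.mem_of_isPath hG hw hp hq (by simp), hpc⟩

theorem isCutVertex_iff (hG : G.Connected) (hB : IsBlock B) {p : V} (hp : p ∈ B.verts) :
    IsCutVertex G p ↔ ∃ x, x ≠ p ∧ blockProj B x = p := by
  constructor
  · intro h
    by_contra! hcon
    exact h fun x y => (avoids_iff_reachable x.2 y.2).1
      (avoids_of_blockProj_ne hG hB hp (hcon _ x.2) (hcon _ y.2))
  · rintro ⟨x, hxp, hx⟩ h
    obtain ⟨y, hy, hpy⟩ := hB.exists_adj_of_mem hG hp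
    have h1 := (avoids_iff_reachable (p := p) hxp hpy.ne').2 (h ⟨x, hxp⟩ ⟨y, hpy.ne'⟩)
    have h2 := blockProj_eq_of_avoids hG hB h1 hx
    rw [blockProj_eq_self hG hB hy] at h2
    exact hpy.ne' h2

theorem card_eq_of_ker_eq {α β γ : Type*} {f : α → β} {g : α → γ} (hf : f.Surjective)
    (hg : g.Surjective) (h : ∀ x y, f x = f y ↔ g x = g y) : Nat.card β = Nat.card γ := by
  have hk : Setoid.ker f = Setoid.ker g := Setoid.ext h
  rw [← Nat.card_congr (Setoid.quotientKerEquivOfSurjective f hf),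
    ← Nat.card_congr (Setoid.quotientKerEquivOfSurjective g hg), hk]

/-- Both sides are quotients of the set of neighbours of `p`, by the same relation according to
`edgeBlock_eq_iff`. -/
theorem card_components_eq_card_blocks (hG : G.Connected) (p : V) :
    Nat.card (G.induce {p}ᶜ).ConnectedComponent =
      Nat.card {B : G.Subgraph // IsBlock B ∧ p ∈ B.verts} := by
  refine card_eq_of_ker_eq (α := {y // G.Adj p y})
    (f := fun y => (G.induce {p}ᶜ).connectedComponentMk ⟨y.1, y.2.ne'⟩)
    (g := fun y => ⟨edgeBlock G p y.1, isBlock_edgeBlock hG y.2, left_mem_blockVerts y.2⟩)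
    ?_ ?_ ?_
  · intro c
    induction c using SimpleGraph.ConnectedComponent.ind with | _ x =>
    obtain ⟨x, hx⟩ := x
    obtain ⟨w, hw⟩ := (hG.preconnected p x).exists_isPath
    cases w with
    | nil => exact absurd rfl hx
    | @cons _ c _ hpc w =>
      refine ⟨⟨c, hpc⟩, SimpleGraph.ConnectedComponent.sound ?_⟩
      rw [SimpleGraph.Walk.cons_isPath_iff] at hw
      exact (avoids_iff_reachable hpc.ne' hx).1 ⟨w, hw.2⟩
  · rintro ⟨B, hB, hp⟩
    obtain ⟨y, hy, hpy⟩ := hB.exists_adj_of_mem hG hp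
    exact ⟨⟨y, hpy⟩, Subtype.ext (hB.eq_edgeBlock hG hpy hp hy).symm⟩
  · rintro ⟨y, hy⟩ ⟨z, hz⟩
    rw [SimpleGraph.ConnectedComponent.eq, Subtype.mk.injEq, edgeBlock_eq_iff hG hy hz]
    exact (avoids_iff_reachable hy.ne' hz.ne').symm

/-- Every vertex `j ≠ r` lies in exactly one block in which `r` is not attached through `j`. -/
theorem existsUnique_parentBlock (hG : G.Connected) {r j : V} (hj : j ≠ r) :
    ∃! B : {B : G.Subgraph // IsBlock B}, j ∈ B.1.verts ∧ blockProj B.1 r ≠ j := by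
  obtain ⟨w, hw⟩ := (hG.preconnected j r).exists_isPath
  cases w with
  | nil => exact absurd rfl hj
  | @cons _ y _ hjy w =>
    rw [SimpleGraph.Walk.cons_isPath_iff] at hw
    have hav : Avoids G j y r := ⟨w, hw.2⟩
    refine ⟨⟨edgeBlock G j y, isBlock_edgeBlock hG hjy⟩,
      ⟨left_mem_blockVerts hjy, fun h => ?_⟩, ?_⟩
    · have := blockProj_eq_of_avoids hG (isBlock_edgeBlock hG hjy) hav.symm h
      rw [blockProj_eq_self hG (isBlock_edgeBlock hG hjy) (right_mem_blockVerts hjy)] at this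
      exact hjy.ne' this
    · rintro ⟨B, hB⟩ ⟨hjB, hr⟩
      obtain ⟨z, hz, hjz⟩ := hB.exists_adj_of_mem hG hjB
      refine Subtype.ext ?_
      change B = edgeBlock G j y
      rw [hB.eq_edgeBlock hG hjz hjB hz, edgeBlock_eq_iff hG hjz hjy]
      refine (avoids_of_blockProj_ne hG hB hjB ?_ hr).trans hav.symm
      rw [blockProj_eq_self hG hB hz]
      exact hjz.ne'

variable [Fintype V]

instance : Finite {B : G.Subgraph // IsBlock B} := by
  have : Finite G.Subgraph := inferInstance
  infer_instance

theorem cutNumber_add_one (hG : G.Connected) (p : V) :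
    cutNumber G p + 1 = Nat.card {B : G.Subgraph // IsBlock B ∧ p ∈ B.verts} := by
  rw [← card_components_eq_card_blocks hG, cutNumber]
  have : Nonempty (G.induce {p}ᶜ).ConnectedComponent := by
    obtain ⟨q, hq⟩ := exists_ne p
    exact ⟨(G.induce {p}ᶜ).connectedComponentMk ⟨q, hq⟩⟩
  have := Nat.card_pos (α := (G.induce {p}ᶜ).ConnectedComponent)
  omega

/-- Count pairs `j ∈ B` twice. By vertices this is `∑ (c(j) + 1)`. By blocks, relative to a root
`r`, each block has one vertex nearest to `r`, and each `j ≠ r` has one further incidence, with its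
parent block; this makes `#blocks + (n - 1)`. -/
theorem sum_cutNumber_add_one (hG : G.Connected) :
    ∑ j ∈ cutVertices G, cutNumber G j + 1 = Nat.card {B : G.Subgraph // IsBlock B} := by
  classical
  rw [sum_cutNumber_cutVertices]
  obtain ⟨r⟩ := hG.nonempty
  have := Fintype.ofFinite {B : G.Subgraph // IsBlock B}
  have h1 : ∑ j, (cutNumber G j + 1) =
      ∑ j, Finset.card {B : {B : G.Subgraph // IsBlock B} | j ∈ B.1.verts} := by
    refine Finset.sum_congr rfl fun j _ => ?_
    rw [cutNumber_add_one hG, ← Fintype.card_subtype, ← Nat.card_eq_fintype_card]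
    exact Nat.card_congr (Equiv.subtypeSubtypeEquivSubtypeInter _ _).symm
  have h2 : ∀ j, Finset.card {B : {B : G.Subgraph // IsBlock B} | j ∈ B.1.verts} =
      Finset.card {B : {B : G.Subgraph // IsBlock B} | blockProj B.1 r = j} +
        if j ≠ r then 1 else 0 := by
    intro j
    have hs : ({B : {B : G.Subgraph // IsBlock B} | j ∈ B.1.verts} : Finset _) =
      ({B : {B : G.Subgraph // IsBlock B} | blockProj B.1 r = j} : Finset _) ∪
      ({B : {B : G.Subgraph // IsBlock B} | j ∈ B.1.verts ∧ blockProj B.1 r ≠ j} : Finset _) := by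
      ext B
      simp only [Finset.mem_filter, Finset.mem_univ, true_and, Finset.mem_union]
      constructor
      · intro h
        by_cases h' : blockProj B.1 r = j
        · exact .inl h'
        · exact .inr ⟨h, h'⟩
      · rintro (h | h)
        · exact h ▸ blockProj_mem hG B.2 r
        · exact h.1
    rw [hs, Finset.card_union_of_disjoint]
    · congr 1
      split_ifs with hj
      · obtain ⟨B, hB, hu⟩ := existsUnique_parentBlock hG hj
        rw [Finset.card_eq_one]
        refine ⟨B, ?_⟩
        ext B'
        simp only [Finset.mem_filter, Finset.mem_univ, true_and, Finset.mem_singleton]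
        exact ⟨hu B', fun h => h ▸ hB⟩
      · rw [Finset.card_eq_zero, Finset.filter_eq_empty_iff]
        rintro B - ⟨h, h'⟩
        push Not at hj
        subst hj
        exact h' (blockProj_eq_self hG B.2 h)
    · rw [Finset.disjoint_filter]
      intro B _ h h'
      exact h'.2 h
  have h3 : ∑ j, Finset.card {B : {B : G.Subgraph // IsBlock B} | blockProj B.1 r = j} =
      Nat.card {B : G.Subgraph // IsBlock B} := by
    rw [Nat.card_eq_fintype_card, ← Finset.card_univ]
    exact (Finset.card_eq_sum_card_fiberwise (fun B _ => Finset.mem_univ _)).symm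
  have h4 : (∑ j : V, if j ≠ r then 1 else 0) + 1 = Fintype.card V := by
    rw [← Finset.card_filter, Finset.filter_ne', Finset.card_erase_add_one (Finset.mem_univ r),
      Finset.card_univ]
  have h5 := h1
  rw [Finset.sum_congr rfl fun j _ => h2 j, Finset.sum_add_distrib, Finset.sum_add_distrib, h3]
    at h5
  simp only [Finset.sum_const, Finset.card_univ, smul_eq_mul, mul_one] at h5
  omega

/-- Sending a non-root vertex to its parent block is surjective: a block contains a neighbour of its
vertex nearest to the root. -/
theorem card_blocks_lt (hG : G.Connected) :
    Nat.card {B : G.Subgraph // IsBlock B} + 1 ≤ Fintype.card V := by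
  classical
  obtain ⟨r⟩ := hG.nonempty
  let f : {j : V // j ≠ r} → {B : G.Subgraph // IsBlock B} :=
    fun j => (existsUnique_parentBlock hG j.2).choose
  have hf : f.Surjective := by
    rintro ⟨B, hB⟩
    obtain ⟨y, hy, hadj⟩ := hB.exists_adj_of_mem hG (blockProj_mem hG hB r)
    have hyr : y ≠ r := by
      rintro rfl
      exact hadj.ne (blockProj_eq_self hG hB hy)
    exact ⟨⟨y, hyr⟩, ((existsUnique_parentBlock hG hyr).choose_spec.2 _ ⟨hy, hadj.ne⟩).symm⟩
  have h1 := Nat.card_le_card_of_surjective f hf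
  rw [Nat.card_eq_fintype_card (α := {j : V // j ≠ r}), Fintype.card_subtype_compl,
    Fintype.card_subtype_eq] at h1
  have := Fintype.card_pos_iff.2 ⟨r⟩
  omega

end Projection

/-! ### Invariance of functions on the symmetric group under transpositions -/

section RightStab

variable {α : Type*}

/-- The permutations under whose right translation `f` is invariant. -/
def rightStab (f : Perm α → ℂ) : Subgroup (Perm α) where
  carrier := {σ | ∀ w, f (w * σ) = f w}
  mul_mem' {a b} ha hb w := by rw [← mul_assoc, hb, ha]
  one_mem' w := by rw [mul_one]
  inv_mem' {a} ha w := by rw [← ha (w * a⁻¹), inv_mul_cancel_right]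

theorem mem_rightStab_sum {ι : Type*} {s : Finset ι} {f : ι → Perm α → ℂ} {σ : Perm α}
    (h : ∀ i ∈ s, σ ∈ rightStab (f i)) : σ ∈ rightStab (fun w => ∑ i ∈ s, f i w) :=
  fun w => Finset.sum_congr rfl fun i hi => h i hi w

variable [DecidableEq α]

/-- A group generated by transpositions contains every permutation that preserves its orbits. This
reduces invariance statements to single swaps. -/
theorem mem_of_forall_swap_mem [Finite α] {H : Subgroup (Perm α)} {σ : Perm α}
    (h : ∀ x, swap x (σ x) ∈ H) : σ ∈ H := by
  have hS : ∀ f ∈ {τ : Perm α | τ ∈ H ∧ τ.IsSwap}, f.IsSwap := fun f hf => hf.2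
  have hle : Subgroup.closure {τ : Perm α | τ ∈ H ∧ τ.IsSwap} ≤ H := by
    rw [Subgroup.closure_le]
    exact fun τ hτ => hτ.1
  refine hle ((mem_closure_isSwap hS).2 ⟨Set.toFinite _, fun x => ?_⟩)
  by_cases hx : x = σ x
  · rw [← hx]
    exact MulAction.mem_orbit_self x
  · exact ⟨⟨swap x (σ x), Subgroup.subset_closure ⟨h x, _, _, hx, rfl⟩⟩, swap_apply_left _ _⟩

theorem swap_mem_of_reachable {G : SimpleGraph α} {H : Subgroup (Perm α)}
    (h : ∀ x y, G.Adj x y → swap x y ∈ H) {x y : α} (hxy : G.Reachable x y) : swap x y ∈ H := by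
  obtain ⟨w⟩ := hxy
  induction w with
  | nil => rw [swap_self]; exact H.one_mem
  | cons hab _ ih => exact SubmonoidClass.swap_mem_trans H (h _ _ hab) ih

theorem swap_mem_of_avoids {G : SimpleGraph α} {H : Subgroup (Perm α)} {p : α}
    (h : ∀ x y, G.Adj x y → p ≠ x → p ≠ y → swap x y ∈ H) {x y : α} (hxy : Avoids G p x y) :
    swap x y ∈ H := by
  obtain ⟨w, hw⟩ := hxy
  induction w with
  | nil => rw [swap_self]; exact H.one_mem
  | @cons a b c hab w ih =>
    simp only [SimpleGraph.Walk.support_cons, List.mem_cons, not_or] at hw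
    refine SubmonoidClass.swap_mem_trans H (h _ _ hab hw.1 ?_) (ih hw.2)
    rintro rfl
    exact hw.2 w.start_mem_support

theorem eq_const_of_connected [Finite α] {G : SimpleGraph α} (hG : G.Connected) {f : Perm α → ℂ}
    (h : ∀ x y, G.Adj x y → swap x y ∈ rightStab f) (w : Perm α) : f w = f 1 := by
  have : w ∈ rightStab f :=
    mem_of_forall_swap_mem fun x => swap_mem_of_reachable h (hG.preconnected x (w x))
  simpa using this 1

end RightStab

/-! ### Splitting a coefficient family into block contributions -/

section Tuples

variable {α : Type*} [DecidableEq α] {G : SimpleGraph α}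

/-- The group generated by the transpositions along the edges not containing `p`. -/
def awayGroup (G : SimpleGraph α) (p : α) : Subgroup (Perm α) :=
  Subgroup.closure {τ | ∃ x y, G.Adj x y ∧ p ≠ x ∧ p ≠ y ∧ τ = swap x y}

theorem avoids_of_mem_awayGroup {p : α} {σ : Perm α} (hσ : σ ∈ awayGroup G p) :
    σ p = p ∧ ∀ x, p ≠ x → Avoids G p x (σ x) := by
  induction hσ using Subgroup.closure_induction with
  | mem τ hτ =>
    obtain ⟨a, b, hab, ha, hb, rfl⟩ := hτ
    refine ⟨swap_apply_of_ne_of_ne ha hb, fun x hx => ?_⟩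
    rw [swap_apply_def]
    split_ifs with h1 h2
    · subst h1; exact Avoids.of_adj hab ha hb
    · subst h2; exact Avoids.of_adj hab.symm hb ha
    · exact Avoids.refl hx
  | one => exact ⟨rfl, fun x hx => Avoids.refl hx⟩
  | mul σ τ _ _ h1 h2 =>
    refine ⟨by rw [Perm.mul_apply, h2.1, h1.1], fun x hx => ?_⟩
    exact (h2.2 x hx).trans (h1.2 _ (h2.2 x hx).ne_right)
  | inv σ _ h =>
    have hp : σ⁻¹ p = p := by rw [Perm.inv_eq_iff_eq, h.1]
    refine ⟨hp, fun x hx => ?_⟩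
    have := h.2 (σ⁻¹ x) (fun h' => hx (by rw [← hp] at h'; exact σ⁻¹.injective h'))
    rw [← Perm.mul_apply, mul_inv_cancel, Perm.one_apply] at this
    exact this.symm

variable [Fintype α]

/-- The coefficient families of linear splines: `b` corresponds to
`w ↦ ∑ p, b p w • X (w p)`. -/
def IsTuple (G : SimpleGraph α) (b : α → Perm α → ℂ) : Prop :=
  (∀ p x y, G.Adj x y → p ≠ x → p ≠ y → swap x y ∈ rightStab (b p)) ∧
    ∀ w, ∑ p, b p w = ∑ p, b p 1

/-- The coefficient families of linear splines which fail to be invariant only along the edges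
of `B`. -/
def IsBlockTuple (B : G.Subgraph) (b : α → Perm α → ℂ) : Prop :=
  (∀ p x y, G.Adj x y → ¬ (B.Adj x y ∧ (p = x ∨ p = y)) → swap x y ∈ rightStab (b p)) ∧
    ∀ w, ∑ p, b p w = ∑ p, b p 1

theorem IsBlockTuple.isTuple {B : G.Subgraph} {b : α → Perm α → ℂ} (h : IsBlockTuple B b) :
    IsTuple G b :=
  ⟨fun p x y hxy hx hy => h.1 p x y hxy (by tauto), h.2⟩

/-- Along an edge of B all other summands are invariant, because blocks share no edges; the constant
sum then forces `φ B` to be invariant too. So `φ B` is invariant along all edges. -/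
theorem eq_const_of_sum_eq_const (hG : G.Connected)
    [Fintype {B : G.Subgraph // IsBlock B}] {φ : {B : G.Subgraph // IsBlock B} → Perm α → ℂ}
    (h : ∀ B x y, G.Adj x y → ¬ B.1.Adj x y → swap x y ∈ rightStab (φ B))
    {c : ℂ} (hc : ∀ w, ∑ B, φ B w = c) (B : {B : G.Subgraph // IsBlock B}) (w : Perm α) :
    φ B w = φ B 1 := by
  classical
  refine eq_const_of_connected hG (fun x y hxy => ?_) w
  by_cases hB : B.1.Adj x y
  · intro w
    have h1 : ∀ w, φ B w = c - ∑ B' ∈ Finset.univ.erase B, φ B' w := fun w => by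
      rw [← hc w, ← Finset.add_sum_erase _ _ (Finset.mem_univ B)]; ring
    rw [h1, h1]
    congr 1
    refine Finset.sum_congr rfl fun B' hB' => h B' x y hxy (fun h' => ?_) w
    exact Finset.ne_of_mem_erase hB' (Subtype.ext (B'.2.eq_of_adj hG B.2 h' hB))
  · exact h B x y hxy hB

theorem IsBlockTuple.eq_const_of_sum_eq_const (hG : G.Connected)
    [Fintype {B : G.Subgraph // IsBlock B}]
    {β : {B : G.Subgraph // IsBlock B} → α → Perm α → ℂ} (hβ : ∀ B, IsBlockTuple B.1 (β B))
    {k : α → ℂ} (hk : ∀ p w, ∑ B, β B p w = k p) (B : {B : G.Subgraph // IsBlock B}) (p : α)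
    (w : Perm α) : β B p w = β B p 1 :=
  CayleySpline.eq_const_of_sum_eq_const hG (φ := fun B => β B p)
    (fun B x y hxy hB => (hβ B).1 p x y hxy fun h => hB h.1) (hk p) B w

/-- The average of `f` over right translates by `awayGroup G p`. -/
def awayAverage (G : SimpleGraph α) (p : α) (f : Perm α → ℂ) (w : Perm α) : ℂ :=
  (Nat.card (awayGroup G p) : ℂ)⁻¹ * ∑ᶠ σ : awayGroup G p, f (w * σ)

theorem awayAverage_eq_self {p : α} {f : Perm α → ℂ}
    (h : ∀ x y, G.Adj x y → p ≠ x → p ≠ y → swap x y ∈ rightStab f) (w : Perm α) :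
    awayAverage G p f w = f w := by
  have hle : awayGroup G p ≤ rightStab f := by
    rw [awayGroup, Subgroup.closure_le]
    rintro _ ⟨x, y, hxy, hx, hy, rfl⟩
    exact h x y hxy hx hy
  have := Fintype.ofFinite (awayGroup G p)
  have h1 : ∀ σ : awayGroup G p, f (w * σ) = f w := fun σ => hle σ.2 w
  rw [awayAverage, finsum_eq_sum_of_fintype, Finset.sum_congr rfl fun σ _ => h1 σ]
  simp only [Finset.sum_const, Finset.card_univ, nsmul_eq_mul, Nat.card_eq_fintype_card]
  have : (Fintype.card (awayGroup G p) : ℂ) ≠ 0 := by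
    exact_mod_cast Fintype.card_ne_zero
  field_simp

theorem swap_mem_rightStab_awayAverage {p x y : α} (f : Perm α → ℂ) (hxy : G.Adj x y)
    (hx : p ≠ x) (hy : p ≠ y) : swap x y ∈ rightStab (awayAverage G p f) := by
  intro w
  have := Fintype.ofFinite (awayGroup G p)
  rw [awayAverage, awayAverage, finsum_eq_sum_of_fintype, finsum_eq_sum_of_fintype]
  congr 1
  have hs : swap x y ∈ awayGroup G p := Subgroup.subset_closure ⟨x, y, hxy, hx, hy, rfl⟩
  refine Fintype.sum_equiv (Equiv.mulLeft ⟨_, hs⟩) _ _ fun σ => ?_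
  simp [mul_assoc]

theorem awayAverage_sum {ι : Type*} (s : Finset ι) (p : α) (f : ι → Perm α → ℂ) (w : Perm α) :
    awayAverage G p (fun w => ∑ i ∈ s, f i w) w = ∑ i ∈ s, awayAverage G p (f i) w := by
  have := Fintype.ofFinite (awayGroup G p)
  simp only [awayAverage, finsum_eq_sum_of_fintype]
  rw [Finset.sum_comm, Finset.mul_sum]

variable [Nontrivial α]

/-- The part of `∑ q, b q` coming from the branches at `p` in the direction of `B`. -/
def branchSum (B : G.Subgraph) (b : α → Perm α → ℂ) (p : α) (w : Perm α) : ℂ :=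
  ∑ q with blockProj B q ≠ p, b q w

/-- For `q` in the direction of B, any two points of the branch at `p` are joined by a walk avoiding
`q`, so `b q` does not notice how `w` is arranged on that branch. -/
theorem branchSum_congr (hG : G.Connected) {B : G.Subgraph} (hB : IsBlock B)
    {b : α → Perm α → ℂ} (hb : IsTuple G b) {p : α} {w w' : Perm α}
    (h : ∀ x, blockProj B x ≠ p → w x = w' x) : branchSum B b p w = branchSum B b p w' := by
  refine Finset.sum_congr rfl fun q hq => ?_
  replace hq : blockProj B q ≠ p := by simpa using hq
  have hmem : w⁻¹ * w' ∈ rightStab (b q) := by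
    refine mem_of_forall_swap_mem fun x => ?_
    have hfix : ∀ y, blockProj B y ≠ p → (w⁻¹ * w') y = y := fun y hy => by
      rw [Perm.mul_apply, ← h y hy, ← Perm.mul_apply, inv_mul_cancel, Perm.one_apply]
    by_cases hx : blockProj B x = p
    · have hx' : blockProj B ((w⁻¹ * w') x) = p := by
        by_contra hc
        have := (w⁻¹ * w').injective (hfix _ hc)
        rw [this] at hc
        exact hc hx
      have h1 := avoids_blockProj hG hB (x := x) (q := q) (by rw [hx]; exact hq.symm)
      have h2 := avoids_blockProj hG hB (x := (w⁻¹ * w') x) (q := q)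
        (by rw [hx']; exact hq.symm)
      rw [hx'] at h2
      rw [hx] at h1
      exact swap_mem_of_avoids (hb.1 q) (h1.trans h2.symm)
    · rw [hfix x hx, swap_self]
      exact Subgroup.one_mem _
  have := hmem w
  rw [mul_inv_cancel_left] at this
  exact this.symm

open Classical in
/-- The component of `b` at `p` in the direction of the block `B`. -/
def blockPart (B : G.Subgraph) (b : α → Perm α → ℂ) (p : α) (w : Perm α) : ℂ :=
  if p ∈ B.verts then -awayAverage G p (branchSum B b p) w else 0

theorem swap_mem_rightStab_blockPart (hG : G.Connected) {B : G.Subgraph} (hB : IsBlock B)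
    {b : α → Perm α → ℂ} (hb : IsTuple G b) {p x y : α} (hxy : G.Adj x y)
    (h : ¬ (B.Adj x y ∧ (p = x ∨ p = y))) : swap x y ∈ rightStab (blockPart B b p) := by
  by_cases hp : p ∈ B.verts
  swap
  · intro w; simp [blockPart, hp]
  intro w
  simp only [blockPart, hp, if_true]
  congr 1
  -- The endpoint `y` lies in the branch at `p`. A permutation from `awayGroup G p` never moves a
  -- point outside that branch to `p` or into it, so the extra swap is invisible to every averaged
  -- term.
  have key : ∀ y, G.Adj p y → ¬ B.Adj p y →
      awayAverage G p (branchSum B b p) (w * swap p y) =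
        awayAverage G p (branchSum B b p) w := by
    intro y hpy hBy
    have hy : blockProj B y = p := by
      rw [← blockProj_eq_of_adj hG hB hpy hBy, blockProj_eq_self hG hB hp]
    simp only [awayAverage]
    congr 1
    refine finsum_congr fun σ => branchSum_congr hG hB hb fun z hz => ?_
    have hzp : p ≠ z := by
      rintro rfl; exact hz (blockProj_eq_self hG hB hp)
    have hav := (avoids_of_mem_awayGroup σ.2).2 z hzp
    rw [Perm.mul_apply, Perm.mul_apply, Perm.mul_apply, swap_apply_of_ne_of_ne hav.ne_right.symm]
    intro hc
    rw [hc] at hav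
    exact hz (blockProj_eq_of_avoids hG hB hav.symm hy)
  by_cases hpx : p = x
  · subst hpx
    exact key y hxy fun h' => h ⟨h', .inl rfl⟩
  by_cases hpy : p = y
  · subst hpy
    rw [swap_comm]
    exact key x hxy.symm fun h' => h ⟨h'.symm, .inr rfl⟩
  exact swap_mem_rightStab_awayAverage _ hxy hpx hpy w

/-- Each `q ≠ p` is counted by exactly one block at `p`, so the branch sums add up to `∑ q, b q 1 -
b p w`. This is already invariant along edges away from `p`, so averaging leaves it unchanged; the
minus sign in `blockPart` recovers `b p`. -/
theorem sum_blockPart (hG : G.Connected) [Fintype {B : G.Subgraph // IsBlock B}]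
    {b : α → Perm α → ℂ} (hb : IsTuple G b) (p : α) (w : Perm α) :
    ∑ B : {B : G.Subgraph // IsBlock B}, blockPart B.1 b p w = b p w - ∑ q, b q 1 := by
  classical
  have h1 : ∀ w, ∑ B : {B : G.Subgraph // IsBlock B} with p ∈ B.1.verts,
      branchSum B.1 b p w = ∑ q ∈ Finset.univ.erase p, b q w := by
    intro w
    simp only [branchSum]
    rw [Finset.sum_sigma']
    refine Finset.sum_bij (fun x _ => x.2) ?_ ?_ ?_ ?_
    · rintro ⟨B, q⟩ h
      simp only [Finset.mem_sigma, Finset.mem_filter, Finset.mem_univ, true_and] at h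
      simp only [Finset.mem_erase, Finset.mem_univ, and_true]
      rintro rfl
      exact h.2 (blockProj_eq_self hG B.2 h.1)
    · rintro ⟨B, q⟩ h ⟨B', q'⟩ h' heq
      simp only [Finset.mem_sigma, Finset.mem_filter, Finset.mem_univ, true_and] at h h' heq
      subst heq
      have hpq : p ≠ q := by
        rintro rfl
        exact h.2 (blockProj_eq_self hG B.2 h.1)
      rw [(existsUnique_parentBlock hG hpq).unique h h']
    · intro q hq
      have hpq : p ≠ q := (Finset.ne_of_mem_erase hq).symm
      obtain ⟨B, hB, -⟩ := existsUnique_parentBlock hG hpq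
      exact ⟨⟨B, q⟩, by simpa using hB, rfl⟩
    · rintro ⟨B, q⟩ _
      rfl
  have h2 : ∀ w, ∑ q ∈ Finset.univ.erase p, b q w = ∑ q, b q 1 - b p w := fun w => by
    rw [← hb.2 w, ← Finset.add_sum_erase _ _ (Finset.mem_univ p)]; ring
  have h3 : ∑ B : {B : G.Subgraph // IsBlock B} with p ∈ B.1.verts,
      awayAverage G p (branchSum B.1 b p) w = ∑ q, b q 1 - b p w := by
    rw [← awayAverage_sum]
    simp only [h1, h2]
    refine awayAverage_eq_self (fun x y hxy hx hy w => ?_) w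
    rw [hb.1 p x y hxy hx hy w]
  simp only [blockPart]
  rw [← Finset.sum_filter, Finset.sum_neg_distrib, h3]
  ring

/-- Constancy of `∑ p, blockPart B b p` for one B is not visible directly. Summed over all B it is
constant, and `eq_const_of_sum_eq_const` passes this to each block. -/
theorem isBlockTuple_blockPart (hG : G.Connected) {b : α → Perm α → ℂ} (hb : IsTuple G b)
    (B : {B : G.Subgraph // IsBlock B}) : IsBlockTuple B.1 (blockPart B.1 b) := by
  refine ⟨fun p x y hxy h => swap_mem_rightStab_blockPart hG B.2 hb hxy h, fun w => ?_⟩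
  have := Fintype.ofFinite {B : G.Subgraph // IsBlock B}
  refine eq_const_of_sum_eq_const hG (φ := fun B w => ∑ p, blockPart B.1 b p w)
    (fun B x y hxy hB => mem_rightStab_sum fun p _ =>
      swap_mem_rightStab_blockPart hG B.2 hb hxy fun h => hB h.1)
    (c := ∑ p, (b p 1 - ∑ q, b q 1)) (fun w => ?_) B w
  rw [Finset.sum_comm]
  simp only [sum_blockPart hG hb, Finset.sum_sub_distrib, hb.2 w]

end Tuples

/-! ### Permutations acting on subsets, and permutations with prescribed values -/

section SubsetPerm

variable {α : Type*}

/-- The permutation of the `a`-element subsets induced by a permutation of the points. -/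
def subsetPerm (a : ℕ) (u : Perm α) : Perm {s : Finset α // s.card = a} :=
  u.finsetCongr.subtypeEquiv fun s => by simp

theorem subsetPerm_coe {a : ℕ} (u : Perm α) (s : {s : Finset α // s.card = a}) :
    (subsetPerm a u s).1 = s.1.map u.toEmbedding := rfl

variable [DecidableEq α]

theorem exists_perm_pair {x y k l : α} (hxy : x ≠ y) (hkl : k ≠ l) :
    ∃ w : Perm α, w x = k ∧ w y = l := by
  refine ⟨swap (swap x k y) l * swap x k, ?_, by simp⟩
  rw [Perm.mul_apply, swap_apply_left, swap_apply_of_ne_of_ne _ hkl]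
  intro h
  exact hxy ((swap x k).injective (by rw [swap_apply_left]; exact h))

theorem exists_perm_triple {x y z k l m : α} (hxy : x ≠ y) (hxz : x ≠ z) (hyz : y ≠ z)
    (hkl : k ≠ l) (hkm : k ≠ m) (hlm : l ≠ m) :
    ∃ w : Perm α, w x = k ∧ w y = l ∧ w z = m := by
  obtain ⟨w, hx, hy⟩ := exists_perm_pair hxy hkl
  refine ⟨swap (w z) m * w, ?_, ?_, by simp⟩
  · rw [Perm.mul_apply, swap_apply_of_ne_of_ne _ (hx ▸ hkm), hx]
    exact w.injective.ne hxz
  · rw [Perm.mul_apply, swap_apply_of_ne_of_ne _ (hy ▸ hlm), hy]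
    exact w.injective.ne hyz

theorem exists_perm_map_eq [Fintype α] {s t : Finset α} (h : s.card = t.card) :
    ∃ w : Perm α, s.map w.toEmbedding = t := by
  let e : {x // x ∈ s} ≃ {x // x ∈ t} := Finset.equivOfCardEq h
  refine ⟨e.extendSubtype, Finset.eq_of_subset_of_card_le ?_ (by simp [h])⟩
  intro y hy
  obtain ⟨x, hx, rfl⟩ := Finset.mem_map.1 hy
  exact e.extendSubtype_mem x hx

end SubsetPerm

/-! ### Differences along a transposition -/

section SwapDiff

variable {α : Type*} [DecidableEq α]

/-- The difference of `f` along the transposition of the positions `x` and `y`. -/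
def swapDiff (f : Perm α → ℂ) (w : Perm α) (x y : α) : ℂ := f w - f (w * swap x y)

theorem swapDiff_swap (f : Perm α → ℂ) (w : Perm α) (x y : α) :
    swapDiff f (w * swap x y) x y = -swapDiff f w x y := by
  simp [swapDiff, mul_assoc]

theorem swapDiff_comm (f : Perm α → ℂ) (w : Perm α) (x y : α) :
    swapDiff f w x y = swapDiff f w y x := by
  rw [swapDiff, swapDiff, swap_comm]

theorem swapDiff_mul {f : Perm α → ℂ} (w : Perm α) {σ : Perm α} (hσ : σ ∈ rightStab f) (x y : α) :
    swapDiff f (w * σ) x y = swapDiff f w (σ x) (σ y) := by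
  rw [swapDiff, swapDiff, hσ w, mul_assoc, mul_swap_eq_swap_mul, ← mul_assoc, hσ]

end SwapDiff

/-! ### Explicit description of the families attached to one block -/

section BlockModels

variable {α : Type*} [DecidableEq α] [Fintype α] {G : SimpleGraph α}

/-- `Φ` identifies the functions on `a`-element subsets, up to constants, with the coefficient
families attached to the block `B`, up to constant families. -/
structure BlockModel (B : G.Subgraph) (a : ℕ)
    (Φ : ({s : Finset α // s.card = a} → ℂ) →ₗ[ℂ] (α → Perm α → ℂ)) : Prop where
  isBlockTuple : ∀ F, IsBlockTuple B (Φ F)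
  equivariant : ∀ F u p w, Φ (fun s => F (subsetPerm a u⁻¹ s)) p w = Φ F p (u⁻¹ * w)
  map_const : ∀ c p w, Φ (fun _ => c) p w = Φ (fun _ => c) p 1
  eq_const : ∀ F, (∀ p w, Φ F p w = Φ F p 1) → ∃ c, F = fun _ => c
  exists_eq : ∀ b, IsBlockTuple B b → ∃ (k : α → ℂ) (F : _), ∀ p w, b p w = k p + Φ F p w

variable {B : G.Subgraph}

/-- The model of a block with at least three vertices. -/
def pointModel (B : G.Subgraph) :
    ({s : Finset α // s.card = 1} → ℂ) →ₗ[ℂ] (α → Perm α → ℂ) where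
  toFun F p w := ∑ z with blockProj B z = p, F ⟨{w z}, Finset.card_singleton _⟩
  map_add' F F' := by
    funext p w
    simp [Finset.sum_add_distrib]
  map_smul' c F := by
    funext p w
    simp [Finset.mul_sum]

/-- The vertices attached to `B` through `p`. -/
def branch (B : G.Subgraph) (p : α) : Finset α := {z | blockProj B z = p}

theorem mem_branch {p z : α} : z ∈ branch B p ↔ blockProj B z = p := by simp [branch]

/-- The model of a block with vertices `i` and `j`. -/
def pairModel (B : G.Subgraph) (i j : α) :
    ({s : Finset α // s.card = (branch B i).card} → ℂ) →ₗ[ℂ] (α → Perm α → ℂ) where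
  toFun F p w := (if p = i then 1 else if p = j then -1 else 0) *
    F ⟨(branch B i).map w.toEmbedding, Finset.card_map _⟩
  map_add' F F' := by
    funext p w
    simp [mul_add]
  map_smul' c F := by
    funext p w
    simp [mul_left_comm]

theorem pairModel_apply (i j : α) (F : {s : Finset α // s.card = (branch B i).card} → ℂ)
    (p : α) (w : Perm α) : pairModel B i j F p w = (if p = i then 1 else if p = j then -1 else 0) *
    F ⟨(branch B i).map w.toEmbedding, Finset.card_map _⟩ := rfl

theorem map_branch_swap {i x y : α} (h : blockProj B x = blockProj B y) (w : Perm α) :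
    (branch B i).map (w * swap x y).toEmbedding = (branch B i).map w.toEmbedding := by
  refine Finset.eq_of_subset_of_card_le (fun z hz => ?_) (by simp)
  obtain ⟨v, hv, rfl⟩ := Finset.mem_map.1 hz
  refine Finset.mem_map.2 ⟨swap x y v, ?_, rfl⟩
  rw [mem_branch] at hv ⊢
  rw [swap_apply_def]
  split_ifs with h1 h2
  · subst h1; rw [← h, hv]
  · subst h2; rw [h, hv]
  · exact hv

variable [Nontrivial α] {b : α → Perm α → ℂ}

/-- Two points of the branch at `p` are joined without edges of B, and two points outside it are
joined while avoiding `p`; neither kind of edge changes `b p`. If `p` is not in B, no edge does. -/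
theorem IsBlockTuple.swap_mem (hG : G.Connected) (hB : IsBlock B) (hb : IsBlockTuple B b)
    {p x y : α} (h : blockProj B x = p ↔ blockProj B y = p) :
    swap x y ∈ rightStab (b p) := by
  by_cases hp : p ∈ B.verts
  · by_cases hx : blockProj B x = p
    · refine swap_mem_of_reachable (G := G \ B.spanningCoe) (fun u v huv => ?_)
        ((blockProj_eq_iff hG hB).1 (hx.trans (h.1 hx).symm))
      exact hb.1 p u v huv.1 fun h' => huv.2 h'.1
    · exact swap_mem_of_avoids (hb.isTuple.1 p) (avoids_of_blockProj_ne hG hB hp hx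
        (mt h.2 hx))
  · refine swap_mem_of_reachable (G := G) (fun u v huv => ?_) (hG.preconnected x y)
    refine hb.1 p u v huv ?_
    rintro ⟨h', rfl | rfl⟩
    · exact hp (B.edge_vert h')
    · exact hp (B.edge_vert h'.symm)

/-- Only the components at the two projections can change under `swap x y`, and the total is
constant. -/
theorem IsBlockTuple.swapDiff_eq_neg (hG : G.Connected) (hB : IsBlock B) (hb : IsBlockTuple B b)
    {x y : α} (h : blockProj B x ≠ blockProj B y) (w : Perm α) :
    swapDiff (b (blockProj B x)) w x y = -swapDiff (b (blockProj B y)) w x y := by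
  have h1 : ∑ r, swapDiff (b r) w x y = 0 := by
    simp only [swapDiff, Finset.sum_sub_distrib]
    rw [hb.2 w, hb.2 (w * swap x y), sub_self]
  rw [Fintype.sum_eq_add _ _ h] at h1
  · exact eq_neg_of_add_eq_zero_left h1
  · rintro r ⟨hx, hy⟩
    rw [swapDiff, sub_eq_zero]
    exact (hb.swap_mem hG hB (by simp [hx.symm, hy.symm]) w).symm

/-- The difference `d` can be computed from either projection. It is therefore invariant under swaps
not crossing the boundary of the branch of `x`, and under swaps not crossing that of `y`. A third
block vertex `r` is in neither branch, so every other point can be swapped with `r` by one of the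
two rules, and `d` depends on `w x` and `w y` only. -/
theorem IsBlockTuple.swapDiff_congr_perm (hG : G.Connected) (hB : IsBlock B)
    (hb : IsBlockTuple B b) {x y r : α} (h : blockProj B x ≠ blockProj B y)
    (hr : r ∈ B.verts) (hrx : r ≠ blockProj B x) (hry : r ≠ blockProj B y) {w w' : Perm α}
    (hx : w x = w' x) (hy : w y = w' y) :
    swapDiff (b (blockProj B x)) w x y = swapDiff (b (blockProj B x)) w' x y := by
  set d : Perm α → ℂ := fun w => swapDiff (b (blockProj B x)) w x y with hd
  have hd' : d = fun w => -swapDiff (b (blockProj B y)) w x y := by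
    funext w; exact hb.swapDiff_eq_neg hG hB h w
  have hp : ∀ u v, u ≠ x → u ≠ y → v ≠ x → v ≠ y →
      (blockProj B u = blockProj B x ↔ blockProj B v = blockProj B x) →
      swap u v ∈ rightStab d := by
    intro u v hux huy hvx hvy huv w
    simp only [hd]
    rw [swapDiff_mul w (hb.swap_mem hG hB huv), swap_apply_of_ne_of_ne hux.symm hvx.symm,
      swap_apply_of_ne_of_ne huy.symm hvy.symm]
  have hq : ∀ u v, u ≠ x → u ≠ y → v ≠ x → v ≠ y →
      (blockProj B u = blockProj B y ↔ blockProj B v = blockProj B y) →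
      swap u v ∈ rightStab d := by
    intro u v hux huy hvx hvy huv w
    simp only [hd']
    rw [swapDiff_mul w (hb.swap_mem hG hB huv), swap_apply_of_ne_of_ne hux.symm hvx.symm,
      swap_apply_of_ne_of_ne huy.symm hvy.symm]
  have hr' := blockProj_eq_self hG hB hr
  have hrx' : r ≠ x := by rintro rfl; exact hrx hr'.symm
  have hry' : r ≠ y := by rintro rfl; exact hry hr'.symm
  have hto : ∀ u, u ≠ x → u ≠ y → swap u r ∈ rightStab d := by
    intro u hux huy
    by_cases hu : blockProj B u = blockProj B x
    · exact hq u r hux huy hrx' hry' (by rw [hr', hu]; simp [h, hry])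
    · exact hp u r hux huy hrx' hry' (by rw [hr']; simp [hu, hrx])
  have hmem : w⁻¹ * w' ∈ rightStab d := by
    have hfx : (w⁻¹ * w') x = x := by
      rw [Perm.mul_apply, ← hx, ← Perm.mul_apply, inv_mul_cancel, Perm.one_apply]
    have hfy : (w⁻¹ * w') y = y := by
      rw [Perm.mul_apply, ← hy, ← Perm.mul_apply, inv_mul_cancel, Perm.one_apply]
    refine mem_of_forall_swap_mem fun u => ?_
    by_cases hux : u = x
    · rw [hux, hfx, swap_self]; exact Subgroup.one_mem _
    by_cases huy : u = y
    · rw [huy, hfy, swap_self]; exact Subgroup.one_mem _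
    refine SubmonoidClass.swap_mem_trans _ (hto u hux huy) ?_
    rw [swap_comm]
    refine hto _ ?_ ?_
    · intro h'; exact hux ((w⁻¹ * w').injective (h'.trans hfx.symm))
    · intro h'; exact huy ((w⁻¹ * w').injective (h'.trans hfy.symm))
  have := hmem w
  rw [mul_inv_cancel_left] at this
  exact this.symm

theorem IsBlockTuple.swapDiff_congr (hG : G.Connected) (hB : IsBlock B)
    (h3 : ∀ p q, ∃ r ∈ B.verts, r ≠ p ∧ r ≠ q) (hb : IsBlockTuple B b) {p x y x' y' : α}
    (hx : blockProj B x = p) (hx' : blockProj B x' = p) (hy : blockProj B y ≠ p)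
    (hy' : blockProj B y' ≠ p) {w w' : Perm α} (hwx : w x = w' x') (hwy : w y = w' y') :
    swapDiff (b p) w x y = swapDiff (b p) w' x' y' := by
  have hxy' : x ≠ y' := by rintro rfl; exact hy' hx
  have hx'y : x' ≠ y := by rintro rfl; exact hy hx'
  have hx'y' : x' ≠ y' := by rintro rfl; exact hy' hx'
  have hxy : x ≠ y := by rintro rfl; exact hy hx
  set τ := swap x x' * swap y y' with hτ
  have hτm : τ ∈ rightStab (b p) := by
    refine Subgroup.mul_mem _ ?_ ?_
    · exact hb.swap_mem hG hB (by simp [hx, hx'])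
    · exact hb.swap_mem hG hB (by simp [hy, hy'])
  have hτx : τ x' = x := by
    rw [hτ, Perm.mul_apply, swap_apply_of_ne_of_ne hx'y hx'y', swap_apply_right]
  have hτy : τ y' = y := by
    rw [hτ, Perm.mul_apply, swap_apply_right, swap_apply_of_ne_of_ne hxy.symm hx'y.symm]
  have h1 := swapDiff_mul w hτm x' y'
  rw [hτx, hτy] at h1
  rw [← h1]
  obtain ⟨r, hr, hr1, hr2⟩ := h3 (blockProj B x') (blockProj B y')
  rw [← hx']
  refine hb.swapDiff_congr_perm hG hB (by rw [hx']; exact hy'.symm) hr hr1 hr2 ?_ ?_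
  · rw [Perm.mul_apply, hτx, hwx]
  · rw [Perm.mul_apply, hτy, hwy]

/-- The difference is a function `E (w x) (w y)` of two values, the same for all vertices of B. It
is antisymmetric and additive, hence the coboundary of a function `c`. -/
theorem IsBlockTuple.exists_potential (hG : G.Connected) (hB : IsBlock B)
    (h3 : ∀ p q, ∃ r ∈ B.verts, r ≠ p ∧ r ≠ q) (hb : IsBlockTuple B b) :
    ∃ c : α → ℂ, ∀ w x y, blockProj B x ≠ blockProj B y →
      swapDiff (b (blockProj B x)) w x y = c (w x) - c (w y) := by
  classical
  obtain ⟨p, hp⟩ := hB.nonempty_verts hG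
  obtain ⟨q, hq, hqp, -⟩ := h3 p p
  obtain ⟨r, hr, hrp, hrq⟩ := h3 p q
  have hp' := blockProj_eq_self hG hB hp
  have hq' := blockProj_eq_self hG hB hq
  have hr' := blockProj_eq_self hG hB hr
  have hex : ∀ k l, ∃ W : Perm α, k ≠ l → W p = k ∧ W q = l := fun k l => by
    by_cases hkl : k = l
    · exact ⟨1, fun h => absurd hkl h⟩
    · obtain ⟨W, hW⟩ := exists_perm_pair hqp.symm hkl
      exact ⟨W, fun _ => hW⟩
  choose W hW using hex
  set E : α → α → ℂ := fun k l => swapDiff (b p) (W k l) p q with hE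
  have hEp : ∀ w x y, blockProj B x = p → blockProj B y ≠ p →
      swapDiff (b p) w x y = E (w x) (w y) := by
    intro w x y hx hy
    have hne : w x ≠ w y := w.injective.ne (by rintro rfl; exact hy hx)
    obtain ⟨h1, h2⟩ := hW _ _ hne
    exact hb.swapDiff_congr hG hB h3 hx hp' hy (by rw [hq']; exact hqp) h1.symm h2.symm
  have hEall : ∀ w x y, blockProj B x ≠ blockProj B y →
      swapDiff (b (blockProj B x)) w x y = E (w x) (w y) := by
    intro w x y hxy
    by_cases hx : blockProj B x = p
    · rw [hx]
      exact hEp w x y hx (by rw [← hx]; exact hxy.symm)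
    · have hxm := blockProj_mem hG hB x
      have hxx := blockProj_eq_self hG hB hxm
      obtain ⟨w', h1, h2⟩ := exists_perm_pair hx
        (w.injective.ne (show x ≠ y by rintro rfl; exact hxy rfl))
      rw [hb.swapDiff_congr hG hB h3 (p := blockProj B x) rfl hxx hxy.symm
        (by rw [hp']; exact Ne.symm hx) h1.symm h2.symm]
      -- Transfers from `b (blockProj B x)` to `b p`: one sign comes from changing the component,
      -- the other from exchanging the two positions.
      have h4 := hb.swapDiff_eq_neg hG hB (x := blockProj B x) (y := p) (by rwa [hxx, hp']) w'
      rw [hxx, hp', swapDiff_comm (b p), ← swapDiff_swap,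
        hEp _ _ _ hp' (by rw [hxx]; exact hx)] at h4
      rw [h4, Perm.mul_apply, Perm.mul_apply, swap_apply_left, swap_apply_right, h1, h2]
  have hanti : ∀ k l, k ≠ l → E l k = -E k l := by
    intro k l hkl
    obtain ⟨w, h1, h2⟩ := exists_perm_pair hqp.symm hkl
    have hqp' : blockProj B q ≠ p := by rwa [hq']
    have h4 := swapDiff_swap (b p) w p q
    rw [hEp _ _ _ hp' hqp', hEp _ _ _ hp' hqp'] at h4
    simpa [h1, h2] using h4
  have hcoc : ∀ k l m, k ≠ l → k ≠ m → l ≠ m → E k m = E k l + E l m := by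
    intro k l m hkl hkm hlm
    obtain ⟨w, h1, h2, h4⟩ := exists_perm_triple hqp.symm hrp.symm hrq.symm hkl hkm hlm
    have hqp' : blockProj B q ≠ p := by rwa [hq']
    have hrp' : blockProj B r ≠ p := by rwa [hr']
    have e1 := hEp w p q hp' hqp'
    have e2 := hEp w p r hp' hrp'
    have e3 := hEp (w * swap p q) p r hp' hrp'
    -- `(p q)(p r) = (p r)(r q)`, and `b p` ignores the last swap because `q` and `r` are both
    -- outside the branch at `p`. The three differences then telescope.
    have hs : b p (w * swap p q * swap p r) = b p (w * swap p r) := by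
      have hst : swap r q ∈ rightStab (b p) := hb.swap_mem hG hB (by simp [hqp', hrp'])
      rw [← hst (w * swap p r), mul_assoc, mul_assoc]
      congr 2
      rw [mul_swap_eq_swap_mul (swap p r), swap_apply_right,
        swap_apply_of_ne_of_ne hqp hrq.symm]
    rw [Perm.mul_apply, Perm.mul_apply, swap_apply_left, swap_apply_of_ne_of_ne hrp hrq,
      h2, h4, swapDiff, hs] at e3
    rw [h1, h2, swapDiff] at e1
    rw [h1, h4, swapDiff] at e2
    rw [← e1, ← e2, ← e3]
    ring
  -- Here `p` is just a base value for the potential. It needs its own case because `E` carries no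
  -- information on the diagonal.
  refine ⟨fun k => if k = p then 0 else E k p, fun w x y hxy => ?_⟩
  rw [hEall w x y hxy]
  have hne : w x ≠ w y := w.injective.ne (by rintro rfl; exact hxy rfl)
  beta_reduce
  split_ifs with h1 h2 h2
  · exact absurd (h1.trans h2.symm) hne
  · rw [h1, hanti _ _ h2]; ring
  · rw [h2]; ring
  · rw [hcoc (w x) (w y) p hne h1 h2]; ring

/-- Subtracting the sum of the potential over the branch at `p` removes every difference of `b p`,
so what remains is constant. -/
theorem IsBlockTuple.eq_add_sum (hG : G.Connected) (hB : IsBlock B)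
    (hb : IsBlockTuple B b) {c : α → ℂ} (hc : ∀ w x y, blockProj B x ≠ blockProj B y →
      swapDiff (b (blockProj B x)) w x y = c (w x) - c (w y)) (p : α) (w : Perm α) :
    b p w = (b p 1 - ∑ z with blockProj B z = p, c z) + ∑ z with blockProj B z = p, c (w z) := by
  set g : Perm α → ℂ := fun w => b p w - ∑ z with blockProj B z = p, c (w z) with hg
  have key : ∀ x y, blockProj B x = p → blockProj B y ≠ p → swap x y ∈ rightStab g := by
    intro x y hx hy w
    have h1 := hc w x y (by rw [hx]; exact hy.symm)
    have hxm : x ∈ ({z | blockProj B z = p} : Finset α) := by simpa using hx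
    have h2 : ∑ z with blockProj B z = p, c (w z) - ∑ z with blockProj B z = p,
        c ((w * swap x y) z) = c (w x) - c (w y) := by
      rw [← Finset.add_sum_erase _ _ hxm, ← Finset.add_sum_erase _ (fun z => c ((w * swap x y) z)) hxm,
        Perm.mul_apply, swap_apply_left]
      have : ∀ z ∈ Finset.erase ({z | blockProj B z = p} : Finset α) x,
          c ((w * swap x y) z) = c (w z) := by
        intro z hz
        rw [Finset.mem_erase, Finset.mem_filter] at hz
        rw [Perm.mul_apply, swap_apply_of_ne_of_ne hz.1]
        rintro rfl
        exact hy hz.2.2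
      rw [Finset.sum_congr rfl this]
      ring
    rw [hx, swapDiff] at h1
    simp only [hg]
    linear_combination h2 - h1
  have hconst : g w = g 1 := by
    refine eq_const_of_connected hG (fun x y _ => ?_) w
    by_cases hx : blockProj B x = p
    · by_cases hy : blockProj B y = p
      · intro w
        simp only [hg]
        rw [hb.swap_mem hG hB (by simp [hx, hy]) w]
        congr 1
        refine Finset.sum_equiv (swap x y) (fun z => ?_) (fun z _ => rfl)
        simp only [Finset.mem_filter, Finset.mem_univ, true_and]
        rw [swap_apply_def]
        split_ifs with h1 h2
        · subst h1; simp [hx, hy]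
        · subst h2; simp [hx, hy]
        · rfl
      · exact key x y hx hy
    · by_cases hy : blockProj B y = p
      · rw [swap_comm]; exact key y x hy hx
      · intro w
        simp only [hg]
        rw [hb.swap_mem hG hB (by simp [hx, hy]) w]
        congr 1
        refine Finset.sum_congr rfl fun z hz => ?_
        rw [Finset.mem_filter] at hz
        rw [Perm.mul_apply, swap_apply_of_ne_of_ne]
        · rintro rfl; exact hx hz.2
        · rintro rfl; exact hy hz.2
  simp only [hg, Perm.one_apply] at hconst
  linear_combination hconst

theorem blockModel_pointModel (hG : G.Connected) (hB : IsBlock B)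
    (h3 : ∀ p q, ∃ r ∈ B.verts, r ≠ p ∧ r ≠ q) : BlockModel B 1 (pointModel B) where
  isBlockTuple F := by
    refine ⟨fun p x y hxy h w => ?_, fun w => ?_⟩
    · have hiff : blockProj B x = p ↔ blockProj B y = p := by
        by_cases hBxy : B.Adj x y
        · rw [blockProj_eq_self hG hB (B.edge_vert hBxy),
            blockProj_eq_self hG hB (B.edge_vert hBxy.symm)]
          exact ⟨fun h' => absurd ⟨hBxy, .inl h'.symm⟩ h, fun h' => absurd ⟨hBxy, .inr h'.symm⟩ h⟩
        · rw [blockProj_eq_of_adj hG hB hxy hBxy]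
      refine Finset.sum_equiv (swap x y) (fun z => ?_) (fun z _ => rfl)
      simp only [Finset.mem_filter, Finset.mem_univ, true_and]
      rw [swap_apply_def]
      split_ifs with h1 h2
      · subst h1; exact hiff
      · subst h2; exact hiff.symm
      · rfl
    · have h1 : ∀ w : Perm α, ∑ p, pointModel B F p w = ∑ z, F ⟨{z}, Finset.card_singleton _⟩ := by
        intro w
        refine (Finset.sum_fiberwise Finset.univ (blockProj B)
          (fun z => F ⟨{w z}, Finset.card_singleton _⟩)).trans ?_
        exact Fintype.sum_equiv w _ _ fun z => rfl
      rw [h1, h1]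
  equivariant F u p w := by
    refine Finset.sum_congr rfl fun z _ => ?_
    congr 1
  map_const c p w := rfl
  eq_const F hF := by
    have key : ∀ k l : α, F ⟨{k}, Finset.card_singleton _⟩ = F ⟨{l}, Finset.card_singleton _⟩ := by
      intro k l
      by_cases hkl : k = l
      · rw [hkl]
      obtain ⟨p, hp⟩ := hB.nonempty_verts hG
      obtain ⟨q, hq, hqp, -⟩ := h3 p p
      obtain ⟨w, h1, h2⟩ := exists_perm_pair hqp.symm hkl
      have h4 : pointModel B F p w = pointModel B F p (w * swap p q) :=
        (hF p w).trans (hF p _).symm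
      have hpm : p ∈ ({z | blockProj B z = p} : Finset α) := by
        simpa using blockProj_eq_self hG hB hp
      simp only [pointModel, LinearMap.coe_mk, AddHom.coe_mk] at h4
      rw [← Finset.add_sum_erase _ _ hpm, ← Finset.add_sum_erase _
        (fun z => F ⟨{(w * swap p q) z}, Finset.card_singleton _⟩) hpm] at h4
      have h5 : ∀ z ∈ Finset.erase ({z | blockProj B z = p} : Finset α) p,
          F ⟨{(w * swap p q) z}, Finset.card_singleton _⟩ =
            F ⟨{w z}, Finset.card_singleton _⟩ := by
        intro z hz
        rw [Finset.mem_erase, Finset.mem_filter] at hz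
        have : (w * swap p q) z = w z := by
          rw [Perm.mul_apply, swap_apply_of_ne_of_ne hz.1]
          rintro rfl
          exact hqp ((blockProj_eq_self hG hB hq).symm.trans hz.2.2)
        simp only [this]
      rw [Finset.sum_congr rfl h5] at h4
      simpa [h1, h2] using h4
    obtain ⟨k⟩ : Nonempty α := inferInstance
    refine ⟨F ⟨{k}, Finset.card_singleton _⟩, ?_⟩
    funext ⟨s, hs⟩
    obtain ⟨l, rfl⟩ := Finset.card_eq_one.1 hs
    exact key l k
  exists_eq b hb := by
    obtain ⟨c, hc⟩ := hb.exists_potential hG hB h3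
    refine ⟨fun p => b p 1 - ∑ z with blockProj B z = p, c z,
      fun s => c (Finset.card_eq_one.1 s.2).choose, fun p w => ?_⟩
    rw [hb.eq_add_sum hG hB hc p w]
    congr 1
    refine Finset.sum_congr rfl fun z _ => ?_
    congr 1
    have := (Finset.card_eq_one.1 (Finset.card_singleton (w z))).choose_spec
    exact Finset.singleton_injective this

/-- If `w` and `w'` send the branch to the same set, then `w⁻¹ * w'` preserves the branch, so it is
generated by swaps that leave `b i` invariant. -/
theorem IsBlockTuple.congr_branch (hG : G.Connected) (hB : IsBlock B) (hb : IsBlockTuple B b)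
    {i : α} {w w' : Perm α} (h : (branch B i).map w.toEmbedding = (branch B i).map w'.toEmbedding) :
    b i w = b i w' := by
  have hiff : ∀ z, z ∈ branch B i ↔ (w⁻¹ * w') z ∈ branch B i := by
    intro z
    rw [← Finset.mem_map' w'.toEmbedding, ← h, ← Finset.mem_map' w.toEmbedding
      (a := (w⁻¹ * w') z)]
    simp
  have hmem : w⁻¹ * w' ∈ rightStab (b i) := mem_of_forall_swap_mem fun z => by
    have := hiff z
    rw [mem_branch, mem_branch] at this
    exact hb.swap_mem hG hB this
  have := hmem w
  rw [mul_inv_cancel_left] at this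
  exact this.symm

theorem blockModel_pairModel (hG : G.Connected) (hB : IsBlock B) {i j : α} (hij : i ≠ j)
    (hverts : B.verts = {i, j}) : BlockModel B (branch B i).card (pairModel B i j) where
  isBlockTuple F := by
    refine ⟨fun p x y hxy h w => ?_, fun w => ?_⟩
    · rw [pairModel_apply, pairModel_apply]
      by_cases hp : p = i ∨ p = j
      · have hnB : ¬ B.Adj x y := by
          intro hBxy
          have hx := B.edge_vert hBxy
          have hy := B.edge_vert hBxy.symm
          have hne := hxy.ne
          rw [hverts] at hx hy
          simp only [Set.mem_insert_iff, Set.mem_singleton_iff] at hx hy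
          refine h ⟨hBxy, ?_⟩
          rcases hp with rfl | rfl <;> rcases hx with rfl | rfl <;> rcases hy with rfl | rfl <;>
            simp_all
        simp only [map_branch_swap (blockProj_eq_of_adj hG hB hxy hnB)]
      · push Not at hp
        simp [hp.1, hp.2]
    · have h0 : ∀ w, ∑ p, pairModel B i j F p w = 0 := by
        intro w
        simp only [pairModel_apply]
        rw [← Finset.sum_mul, Fintype.sum_eq_add i j hij]
        · simp [hij.symm]
        · rintro p ⟨h1, h2⟩
          simp [h1, h2]
      rw [h0, h0]
  equivariant F u p w := by
    rw [pairModel_apply, pairModel_apply]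
    congr 2
    apply Subtype.ext
    rw [subsetPerm_coe, Finset.map_map]
    rfl
  map_const c p w := rfl
  eq_const F hF := by
    refine ⟨F ⟨(branch B i), rfl⟩, ?_⟩
    funext ⟨s, hs⟩
    obtain ⟨w, rfl⟩ := exists_perm_map_eq hs.symm
    have := hF i w
    rw [pairModel_apply, pairModel_apply] at this
    simp only [if_true, one_mul] at this
    rw [this]
    congr 1
    exact Subtype.ext Finset.map_refl
  exists_eq b hb := by
    have hother : ∀ p, p ≠ i → p ≠ j → ∀ w, b p w = b p 1 := by
      intro p hi hj
      refine eq_const_of_connected hG fun x y hxy => hb.1 p x y hxy ?_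
      rintro ⟨h, rfl | rfl⟩
      · have := B.edge_vert h
        rw [hverts] at this
        simp [hi, hj] at this
      · have := B.edge_vert h.symm
        rw [hverts] at this
        simp [hi, hj] at this
    have hsum : ∀ w, b j w = (b i 1 + b j 1) - b i w := by
      intro w
      have h1 : ∑ p, (b p w - b p 1) = 0 := by
        rw [Finset.sum_sub_distrib, hb.2 w, sub_self]
      rw [Fintype.sum_eq_add i j hij] at h1
      · linear_combination h1
      · rintro p ⟨hi, hj⟩
        rw [hother p hi hj w, sub_self]
    -- `F` at a set is `b i` at any permutation carrying the branch of `i` to that set. As the model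
    -- puts `-F` at `j`, the constant there has to be the total `b i 1 + b j 1`.
    refine ⟨fun p => if p = i then 0 else if p = j then b i 1 + b j 1 else b p 1,
      fun s => b i (exists_perm_map_eq s.2.symm).choose, fun p w => ?_⟩
    have h1 : b i (exists_perm_map_eq (s := branch B i) (t := (branch B i).map w.toEmbedding)
        (Finset.card_map _).symm).choose = b i w :=
      hb.congr_branch hG hB (exists_perm_map_eq (s := branch B i)
        (t := (branch B i).map w.toEmbedding) (Finset.card_map _).symm).choose_spec
    rw [pairModel_apply, h1]
    by_cases hi : p = i
    · subst hi; simp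
    · by_cases hj : p = j
      · subst hj
        simp only [hi, if_false, if_true]
        rw [hsum w]; ring
      · simp [hi, hj, hother p hi hj w]

end BlockModels

/-! ### Traces in exact sequences and on permutation representations -/

section Trace

theorem trace_eq_add_of_exact {A M N : Type*} [AddCommMonoid A] [Module ℂ A] [Module.Finite ℂ A]
    [AddCommMonoid M] [Module ℂ M] [Module.Finite ℂ M] [AddCommMonoid N] [Module ℂ N]
    [Module.Finite ℂ N] {i : A →ₗ[ℂ] M} {π : M →ₗ[ℂ] N} (hi : Function.Injective i)
    (hπ : Function.Surjective π) (hiπ : Function.Exact i π) {f : A →ₗ[ℂ] A} {g : M →ₗ[ℂ] M}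
    {h : N →ₗ[ℂ] N} (hf : ∀ x, g (i x) = i (f x)) (hh : ∀ x, π (g x) = h (π x)) :
    LinearMap.trace ℂ M g = LinearMap.trace ℂ A f + LinearMap.trace ℂ N h := by
  let := Module.addCommMonoidToAddCommGroup ℂ (M := A)
  let := Module.addCommMonoidToAddCommGroup ℂ (M := M)
  let := Module.addCommMonoidToAddCommGroup ℂ (M := N)
  obtain ⟨r, hr⟩ := i.exists_leftInverse_of_injective (LinearMap.ker_eq_bot.2 hi)
  obtain ⟨s, hs⟩ := π.exists_rightInverse_of_surjective (LinearMap.range_eq_top.2 hπ)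
  have hr' : ∀ x, r (i x) = x := fun x => LinearMap.congr_fun hr x
  have hs' : ∀ x, π (s x) = x := fun x => LinearMap.congr_fun hs x
  have hπi : ∀ x, π (i x) = 0 := fun x => (hiπ _).2 ⟨x, rfl⟩
  set t := s - i ∘ₗ r ∘ₗ s with ht
  have hdec : g = (i ∘ₗ f) ∘ₗ r + (g ∘ₗ t) ∘ₗ π := by
    ext x
    obtain ⟨a, ha⟩ := (hiπ (x - s (π x))).1 (by rw [map_sub, hs', sub_self])
    have hx : x = i a + s (π x) := by rw [ha]; abel
    have : i (r x) + t (π x) = x := by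
      have h1 : r x = a + r (s (π x)) := by
        conv_lhs => rw [hx, map_add, hr']
      rw [h1, ht]
      simp only [LinearMap.sub_apply, LinearMap.comp_apply, map_add]
      conv_rhs => rw [hx]
      abel
    simp only [LinearMap.add_apply, LinearMap.comp_apply, ← hf]
    rw [← map_add, this]
  conv_lhs => rw [hdec]
  rw [map_add, LinearMap.trace_comp_comm' r (i ∘ₗ f), LinearMap.trace_comp_comm' π (g ∘ₗ t)]
  congr 2
  · ext x; simp [hr']
  · ext x; simp [hh, ht, hπi, hs']

theorem trace_eq_of_bijective {M N : Type*} [AddCommMonoid M] [Module ℂ M] [AddCommMonoid N]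
    [Module ℂ N] {e : M →ₗ[ℂ] N} (he : Function.Bijective e) {f : M →ₗ[ℂ] M} {g : N →ₗ[ℂ] N}
    (h : ∀ x, e (f x) = g (e x)) : LinearMap.trace ℂ M f = LinearMap.trace ℂ N g := by
  let := Module.addCommMonoidToAddCommGroup ℂ (M := M)
  let := Module.addCommMonoidToAddCommGroup ℂ (M := N)
  rw [← LinearMap.trace_conj' f (LinearEquiv.ofBijective e he)]
  congr 1
  ext x
  obtain ⟨y, rfl⟩ := he.2 x
  have : (LinearEquiv.ofBijective e he).symm (e y) = y :=
    (LinearEquiv.ofBijective e he).symm_apply_apply y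
  rw [LinearEquiv.conj_apply_apply, this, ← h]
  rfl

theorem trace_funLeft {X : Type*} [Fintype X] [DecidableEq X] (σ : X → X) :
    LinearMap.trace ℂ (X → ℂ) (LinearMap.funLeft ℂ ℂ σ) = ∑ x, if σ x = x then 1 else 0 := by
  rw [LinearMap.trace_eq_matrix_trace ℂ (Pi.basisFun ℂ X), Matrix.trace]
  refine Finset.sum_congr rfl fun x _ => ?_
  simp [LinearMap.funLeft_apply, Pi.single_apply]

/-- The number of `a`-element subsets fixed by a permutation. -/
def fixCount {n : ℕ} (a : ℕ) (u : Perm (Fin n)) : ℂ :=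
  ∑ s : {s : Finset (Fin n) // s.card = a}, if subsetPerm a u⁻¹ s = s then 1 else 0

theorem fixCount_one {n : ℕ} (u : Perm (Fin n)) :
    fixCount 1 u = ∑ i, if u⁻¹ i = i then 1 else 0 := by
  symm
  refine Fintype.sum_bijective (fun i : Fin n => (⟨{i}, Finset.card_singleton _⟩ :
    {s : Finset (Fin n) // s.card = 1})) ⟨fun i j h => ?_, fun s => ?_⟩ _ _ fun i => ?_
  · exact Finset.singleton_injective (congrArg Subtype.val h)
  · obtain ⟨i, hi⟩ := Finset.card_eq_one.1 s.2
    exact ⟨i, Subtype.ext hi.symm⟩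
  · simp only [Subtype.ext_iff, subsetPerm_coe, Finset.map_singleton, Equiv.coe_toEmbedding,
      Finset.singleton_inj]

end Trace

/-! ### The trace of left translation on coefficient families -/

section TupleTrace

variable {n : ℕ} {Γ : SimpleGraph (Fin n)}

/-- The space of coefficient families of linear splines. -/
def tuples (Γ : SimpleGraph (Fin n)) : Submodule ℂ (Fin n → Perm (Fin n) → ℂ) where
  carrier := {b | IsTuple Γ b}
  add_mem' {a b} ha hb := by
    refine ⟨fun p x y hxy hx hy w => ?_, fun w => ?_⟩
    · simp only [Pi.add_apply, ha.1 p x y hxy hx hy w, hb.1 p x y hxy hx hy w]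
    · simp only [Pi.add_apply, Finset.sum_add_distrib, ha.2 w, hb.2 w]
  zero_mem' := ⟨fun _ _ _ _ _ _ _ => rfl, fun _ => rfl⟩
  smul_mem' c a ha := by
    refine ⟨fun p x y hxy hx hy w => ?_, fun w => ?_⟩
    · simp only [Pi.smul_apply, ha.1 p x y hxy hx hy w]
    · simp only [Pi.smul_apply, ← Finset.smul_sum, ha.2 w]

theorem const_mem_tuples (k : Fin n → ℂ) : (fun p _ => k p) ∈ tuples Γ :=
  ⟨fun _ _ _ _ _ _ _ => rfl, fun _ => rfl⟩

/-- Left translation of coefficient families. -/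
def translate (Γ : SimpleGraph (Fin n)) (u : Perm (Fin n)) : tuples Γ →ₗ[ℂ] tuples Γ where
  toFun b := ⟨fun p w => b.1 p (u⁻¹ * w), fun p x y hxy hx hy w => by
    change b.1 p (u⁻¹ * (w * swap x y)) = b.1 p (u⁻¹ * w)
    rw [← mul_assoc]; exact b.2.1 p x y hxy hx hy (u⁻¹ * w), fun w => by
    rw [b.2.2, b.2.2 (u⁻¹ * 1)]⟩
  map_add' _ _ := rfl
  map_smul' _ _ := rfl

theorem trace_translate [Nontrivial (Fin n)] (hΓ : Γ.Connected)
    [Fintype {B : Γ.Subgraph // IsBlock B}] {a : {B : Γ.Subgraph // IsBlock B} → ℕ}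
    (ha : ∀ B, a B ≤ n)
    {Φ : ∀ B, ({s : Finset (Fin n) // s.card = a B} → ℂ) →ₗ[ℂ] (Fin n → Perm (Fin n) → ℂ)}
    (hΦ : ∀ B, BlockModel B.1 (a B) (Φ B)) (u : Perm (Fin n)) :
    LinearMap.trace ℂ (tuples Γ) (translate Γ u) =
      n + ∑ B, fixCount (a B) u - Fintype.card {B : Γ.Subgraph // IsBlock B} := by
  classical
  -- The coordinates are a constant for each vertex and a function on `a B`-element subsets for each
  -- block. `u` acts by permuting `X`, so its trace there counts fixed points.
  let X := Fin n ⊕ (Σ B : {B : Γ.Subgraph // IsBlock B}, {s : Finset (Fin n) // s.card = a B})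
  let σ : X → X := Sum.map id (Sigma.map id fun B => subsetPerm (a B) u⁻¹)
  have hsum : ∀ f : {B : Γ.Subgraph // IsBlock B} → Fin n → Perm (Fin n) → ℂ,
      (∀ B, f B ∈ tuples Γ) → (fun p w => ∑ B, f B p w) ∈ tuples Γ := fun f hf => by
    have := Submodule.sum_mem (tuples Γ) (t := Finset.univ) fun B _ => hf B
    convert this using 1
    funext p w
    simp
  let Ψ : (X → ℂ) →ₗ[ℂ] tuples Γ :=
    { toFun := fun F => ⟨fun p w => F (.inl p) + ∑ B, Φ B (fun s => F (.inr ⟨B, s⟩)) p w,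
        (tuples Γ).add_mem (const_mem_tuples _)
          (hsum (fun B => Φ B fun s => F (.inr ⟨B, s⟩)) fun B => ((hΦ B).isBlockTuple _).isTuple)⟩
      map_add' := fun F F' => by
        apply Subtype.ext
        funext p w
        have : ∀ B, Φ B (fun s => (F + F') (.inr ⟨B, s⟩)) p w =
            Φ B (fun s => F (.inr ⟨B, s⟩)) p w + Φ B (fun s => F' (.inr ⟨B, s⟩)) p w := fun B =>
          congrFun (congrFun ((Φ B).map_add (fun s => F (.inr ⟨B, s⟩)) _) p) w
        change F (.inl p) + F' (.inl p) + ∑ B, Φ B (fun s => (F + F') (.inr ⟨B, s⟩)) p w =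
          F (.inl p) + ∑ B, Φ B (fun s => F (.inr ⟨B, s⟩)) p w +
            (F' (.inl p) + ∑ B, Φ B (fun s => F' (.inr ⟨B, s⟩)) p w)
        rw [Finset.sum_congr rfl fun B _ => this B, Finset.sum_add_distrib]
        ring
      map_smul' := fun c F => by
        apply Subtype.ext
        funext p w
        have : ∀ B, Φ B (fun s => (c • F) (.inr ⟨B, s⟩)) p w =
            c * Φ B (fun s => F (.inr ⟨B, s⟩)) p w := fun B =>
          congrFun (congrFun ((Φ B).map_smul c (fun s => F (.inr ⟨B, s⟩))) p) w
        change c * F (.inl p) + ∑ B, Φ B (fun s => (c • F) (.inr ⟨B, s⟩)) p w =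
          c * (F (.inl p) + ∑ B, Φ B (fun s => F (.inr ⟨B, s⟩)) p w)
        rw [Finset.sum_congr rfl fun B _ => this B, ← Finset.mul_sum, mul_add] }
  -- The redundancy of the presentation: a constant function for the block B yields a constant
  -- family, which the vertex coordinates cancel. There is one relation for each block, and `u` acts
  -- on these trivially.
  let ι : ({B : Γ.Subgraph // IsBlock B} → ℂ) →ₗ[ℂ] (X → ℂ) :=
    { toFun := fun c => Sum.elim (fun p => -∑ B, Φ B (fun _ => c B) p 1) fun x => c x.1
      map_add' := fun c c' => by
        funext x
        rcases x with p | x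
        · have : ∀ B, Φ B (fun _ => (c + c') B) p 1 =
              Φ B (fun _ => c B) p 1 + Φ B (fun _ => c' B) p 1 := fun B =>
            congrFun (congrFun ((Φ B).map_add (fun _ => c B) _) p) 1
          change -∑ B, Φ B (fun _ => (c + c') B) p 1 =
            -∑ B, Φ B (fun _ => c B) p 1 + -∑ B, Φ B (fun _ => c' B) p 1
          rw [Finset.sum_congr rfl fun B _ => this B, Finset.sum_add_distrib]
          ring
        · rfl
      map_smul' := fun r c => by
        funext x
        rcases x with p | x
        · have : ∀ B, Φ B (fun _ => (r • c) B) p 1 = r * Φ B (fun _ => c B) p 1 := fun B =>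
            congrFun (congrFun ((Φ B).map_smul r (fun _ => c B)) p) 1
          change -∑ B, Φ B (fun _ => (r • c) B) p 1 = r * -∑ B, Φ B (fun _ => c B) p 1
          rw [Finset.sum_congr rfl fun B _ => this B, ← Finset.mul_sum, mul_neg]
        · rfl }
  -- This is where `a B ≤ n` matters: with no subsets of that size, the constant of B would be lost
  -- and `ι` would not be injective.
  have hne : ∀ B, Nonempty {s : Finset (Fin n) // s.card = a B} := fun B => by
    obtain ⟨s, -, hs⟩ := Finset.exists_subset_card_eq (s := (Finset.univ : Finset (Fin n)))
      (n := a B) (by simpa using ha B)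
    exact ⟨⟨s, hs⟩⟩
  have hι : Function.Injective ι := by
    intro c c' h
    funext B
    obtain ⟨s⟩ := hne B
    exact congrFun h (.inr ⟨B, s⟩)
  have hΨ : Function.Surjective Ψ := by
    rintro ⟨b, hb⟩
    choose k F hkF using fun B => (hΦ B).exists_eq _ (isBlockTuple_blockPart hΓ hb B)
    refine ⟨Sum.elim (fun p => ∑ q, b q 1 + ∑ B, k B p) fun x => F x.1 x.2, ?_⟩
    apply Subtype.ext
    funext p w
    have h1 := sum_blockPart hΓ hb p w
    simp only [hkF, Finset.sum_add_distrib] at h1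
    change ∑ q, b q 1 + ∑ B, k B p + ∑ B, Φ B (F B) p w = b p w
    linear_combination h1
  have hex : Function.Exact ι Ψ := by
    intro F
    constructor
    · intro hF
      have hF' : ∀ p w, F (.inl p) + ∑ B, Φ B (fun s => F (.inr ⟨B, s⟩)) p w = 0 := fun p w =>
        congrFun (congrFun (congrArg Subtype.val hF) p) w
      have hc := IsBlockTuple.eq_const_of_sum_eq_const hΓ
        (β := fun B => Φ B fun s => F (.inr ⟨B, s⟩)) (fun B => (hΦ B).isBlockTuple _)
        (k := fun p => -F (.inl p)) (fun p w => eq_neg_of_add_eq_zero_right (hF' p w))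
      choose c hcF using fun B => (hΦ B).eq_const _ (hc B)
      refine ⟨c, ?_⟩
      funext x
      rcases x with p | ⟨B, s⟩
      · have := hF' p 1
        simp only [hcF] at this
        exact (eq_neg_of_add_eq_zero_left this).symm
      · exact (congrFun (hcF B) s).symm
    · rintro ⟨c, rfl⟩
      apply Subtype.ext
      funext p w
      change -∑ B, Φ B (fun _ => c B) p 1 + ∑ B, Φ B (fun _ => c B) p w = 0
      rw [Finset.sum_congr rfl fun B _ => (hΦ B).map_const (c B) p w]
      ring
  have htr := trace_eq_add_of_exact hι hΨ hex (f := LinearMap.id)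
    (g := LinearMap.funLeft ℂ ℂ σ) (h := translate Γ u) ?_ ?_
  · rw [trace_funLeft, LinearMap.trace_id, Module.finrank_fintype_fun_eq_card] at htr
    rw [eq_comm, sub_eq_iff_eq_add', ← htr, Fintype.sum_sum_type, Fintype.sum_sigma]
    congr 1
    · simp [σ]
    · refine Finset.sum_congr rfl fun B _ => Finset.sum_congr rfl fun s _ => ?_
      have : σ (.inr ⟨B, s⟩) = .inr ⟨B, s⟩ ↔ subsetPerm (a B) u⁻¹ s = s := by
        change (Sum.inr ⟨B, subsetPerm (a B) u⁻¹ s⟩ : X) = .inr ⟨B, s⟩ ↔ _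
        rw [Sum.inr.injEq]
        exact sigma_mk_injective.eq_iff
      simp only [this]
  · intro c
    funext x
    rcases x with p | x <;> rfl
  · intro F
    apply Subtype.ext
    funext p w
    change F (.inl p) + ∑ B, Φ B (fun s => F (.inr ⟨B, subsetPerm (a B) u⁻¹ s⟩)) p w =
      F (.inl p) + ∑ B, Φ B (fun s => F (.inr ⟨B, s⟩)) p (u⁻¹ * w)
    congr 1
    exact Finset.sum_congr rfl fun B _ => (hΦ B).equivariant (fun s => F (.inr ⟨B, s⟩)) u p w

end TupleTrace

/-! ### Linear splines as coefficient families, and the two quotients -/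

section LinearSplines

variable {n : ℕ} {Γ : SimpleGraph (Fin n)}

theorem coeff_single_mul_X (k i : Fin n) (g : MvPolynomial (Fin n) ℂ) :
    coeff (Finsupp.single k 1) (g * X i) = if k = i then coeff 0 g else 0 := by
  rw [coeff_mul_X']
  by_cases h : k = i
  · subst h
    simp
  · rw [if_neg h, if_neg]
    simpa using Ne.symm h

theorem coeff_single_of_mem_span {f : MvPolynomial (Fin n) ℂ} {a b : Fin n}
    (hf : f ∈ Ideal.span ({X a - X b} : Set (MvPolynomial (Fin n) ℂ))) :
    ∃ g : ℂ, ∀ k, coeff (Finsupp.single k 1) f =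
      (if k = a then g else 0) - if k = b then g else 0 := by
  obtain ⟨g, rfl⟩ := Ideal.mem_span_singleton'.1 hf
  refine ⟨coeff 0 g, fun k => ?_⟩
  rw [mul_sub, coeff_sub, coeff_single_mul_X, coeff_single_mul_X]

theorem IsHomogeneous.eq_sum_coeff {f : MvPolynomial (Fin n) ℂ} (hf : f.IsHomogeneous 1) :
    f = ∑ k, coeff (Finsupp.single k 1) f • X k := by
  ext m
  simp only [coeff_sum, coeff_smul, coeff_X, smul_eq_mul, mul_ite, mul_one, mul_zero]
  by_cases hm : m.degree = 1
  · obtain ⟨i, rfl⟩ := (Finsupp.sum_eq_one_iff m).1 hm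
    simp [Finsupp.single_left_inj]
  · rw [hf.coeff_eq_zero hm]
    symm
    refine Finset.sum_eq_zero fun k _ => ?_
    rw [if_neg]
    rintro rfl
    simp at hm

/-- The spline with coefficient family `b`. -/
def ofTuple (b : Fin n → Perm (Fin n) → ℂ) (w : Perm (Fin n)) : MvPolynomial (Fin n) ℂ :=
  ∑ p, b p w • X (w p)

/-- Only the terms at `i` and `j` differ, and the constant coefficient sum makes their difference a
scalar times `X (w i) - X (w j)`. -/
theorem ofTuple_mem {b : Fin n → Perm (Fin n) → ℂ} (hb : IsTuple Γ b) :
    ofTuple b ∈ splines Γ := by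
  intro w i j hij
  have hsum : ∑ p, (b p w - b p (w * swap i j)) = 0 := by
    rw [Finset.sum_sub_distrib, hb.2 w, hb.2 (w * swap i j), sub_self]
  have hz : ∀ p, p ≠ i ∧ p ≠ j → b p w - b p (w * swap i j) = 0 := fun p hp => by
    rw [hb.1 p i j hij hp.1 hp.2 w, sub_self]
  rw [Fintype.sum_eq_add i j hij.ne hz] at hsum
  rw [ofTuple, ofTuple, ← Finset.sum_sub_distrib, Fintype.sum_eq_add i j hij.ne]
  · rw [Perm.mul_apply, Perm.mul_apply, swap_apply_left, swap_apply_right]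
    refine Ideal.mem_span_singleton'.2 ⟨C (b i w - b j (w * swap i j)), ?_⟩
    have : b j w = b i (w * swap i j) + b j (w * swap i j) - b i w := by linear_combination hsum
    rw [this]
    simp only [smul_eq_C_mul, C_sub, C_add]
    ring
  · rintro p hp
    have := hz p hp
    rw [Perm.mul_apply, swap_apply_of_ne_of_ne hp.1 hp.2, ← sub_smul, this, zero_smul]

/-- The coefficient family of a linear spline. -/
def toTuple (hΓ : Γ.Connected) : homogeneousSplines Γ 1 →ₗ[ℂ] tuples Γ where
  toFun a := ⟨fun p w => coeff (Finsupp.single (w p) 1) (a.1.1 w), by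
    refine ⟨fun p x y hxy hx hy w => ?_, ?_⟩
    · obtain ⟨g, hg⟩ := coeff_single_of_mem_span (a.1.2 w x y hxy)
      have := hg (w p)
      rw [if_neg (w.injective.ne hx), if_neg (w.injective.ne hy), coeff_sub, sub_self] at this
      beta_reduce
      rw [Perm.mul_apply, swap_apply_of_ne_of_ne hx hy]
      exact (sub_eq_zero.1 this).symm
    · refine eq_const_of_connected hΓ fun x y hxy w => ?_
      obtain ⟨g, hg⟩ := coeff_single_of_mem_span (a.1.2 w x y hxy)
      beta_reduce
      rw [Equiv.sum_comp (w * swap x y) fun k =>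
          coeff (Finsupp.single k 1) (a.1.1 (w * swap x y)),
        Equiv.sum_comp w fun k => coeff (Finsupp.single k 1) (a.1.1 w), eq_comm, ← sub_eq_zero,
        ← Finset.sum_sub_distrib]
      simp only [← coeff_sub, hg, Finset.sum_sub_distrib]
      simp⟩
  map_add' _ _ := by
    apply Subtype.ext
    funext p w
    simp
  map_smul' _ _ := by
    apply Subtype.ext
    funext p w
    simp

theorem toTuple_apply (hΓ : Γ.Connected) (a : homogeneousSplines Γ 1) (p : Fin n)
    (w : Perm (Fin n)) :
    (toTuple hΓ a).1 p w = coeff (Finsupp.single (w p) 1) (a.1.1 w) := rfl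

theorem toTuple_bijective (hΓ : Γ.Connected) : Function.Bijective (toTuple hΓ) := by
  constructor
  · intro a a' h
    apply Subtype.ext
    apply Subtype.ext
    funext w
    rw [IsHomogeneous.eq_sum_coeff (a.2 w), IsHomogeneous.eq_sum_coeff (a'.2 w)]
    refine Finset.sum_congr rfl fun k _ => ?_
    have := congrFun (congrFun (congrArg Subtype.val h) (w⁻¹ k)) w
    rw [toTuple_apply, toTuple_apply, ← Perm.mul_apply, mul_inv_cancel, Perm.one_apply] at this
    rw [this]
  · rintro ⟨b, hb⟩
    refine ⟨⟨⟨ofTuple b, ofTuple_mem hb⟩, fun w => ?_⟩, ?_⟩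
    · refine IsHomogeneous.sum _ _ _ fun p _ => ?_
      rw [smul_eq_C_mul]
      simpa using (isHomogeneous_C (Fin n) (b p w)).mul (isHomogeneous_X ℂ (w p))
    · apply Subtype.ext
      funext p w
      rw [toTuple_apply]
      simp only [ofTuple, coeff_sum, coeff_smul, coeff_X, smul_eq_mul]
      simp [Finsupp.single_left_inj]

/-- The dot action on linear splines. -/
def linearDot (Γ : SimpleGraph (Fin n)) (u : Perm (Fin n)) :
    homogeneousSplines Γ 1 →ₗ[ℂ] homogeneousSplines Γ 1 :=
  (dotAction Γ u).restrict (homogeneous_stable Γ 1 u)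

theorem linearDot_apply (u : Perm (Fin n)) (a : homogeneousSplines Γ 1) (w : Perm (Fin n)) :
    (linearDot Γ u a).1.1 w = rename u (a.1.1 (u⁻¹ * w)) := rfl

theorem trace_linearDot (hΓ : Γ.Connected) (u : Perm (Fin n)) :
    LinearMap.trace ℂ _ (linearDot Γ u) = LinearMap.trace ℂ _ (translate Γ u) := by
  refine trace_eq_of_bijective (toTuple_bijective hΓ) fun a => ?_
  apply Subtype.ext
  funext p w
  change coeff (Finsupp.single (w p) 1) (rename u (a.1.1 (u⁻¹ * w))) =
    coeff (Finsupp.single ((u⁻¹ * w) p) 1) (a.1.1 (u⁻¹ * w))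
  have h := coeff_rename_mapDomain u u.injective (a.1.1 (u⁻¹ * w))
    (Finsupp.single ((u⁻¹ * w) p) 1)
  rw [Finsupp.mapDomain_single, ← Perm.mul_apply, mul_inv_cancel_left] at h
  exact h

/-- Elements of the edge ideals have no constant term, so constant terms agree along every edge. -/
theorem exists_coeff_zero_eq (hΓ : Γ.Connected) (r : splines Γ) :
    ∃ c : ℂ, ∀ w, coeff 0 (r.1 w) = c := by
  refine ⟨coeff 0 (r.1 1), eq_const_of_connected hΓ fun x y hxy w => ?_⟩
  obtain ⟨g, hg⟩ := Ideal.mem_span_singleton'.1 (r.2 w x y hxy)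
  have := congrArg (coeff 0) hg
  rw [mul_sub, coeff_sub, coeff_sub, coeff_mul_X', coeff_mul_X'] at this
  simp only [Finsupp.support_zero, Finset.notMem_empty, if_false, sub_self] at this
  exact (sub_eq_zero.1 this.symm).symm

/-- The linear splines spanned by a family of linear splines `w ↦ X (τ w i)`. -/
theorem exists_eq_sum_of_mem_span (hΓ : Γ.Connected) {y : Fin n → splines Γ}
    {τ : Perm (Fin n) → Perm (Fin n)} (hy : ∀ i w, (y i).1 w = X (τ w i))
    {a : homogeneousSplines Γ 1} (ha : a.1 ∈ Ideal.span (Set.range y)) :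
    ∃ c : Fin n → ℂ, a.1 = ∑ i, c i • y i := by
  obtain ⟨r, hr⟩ := (Submodule.mem_span_range_iff_exists_fun _).1 ha
  -- In degree one only the constant terms of the multipliers `r i` survive, and these do not depend
  -- on `w`. So the ideal meets degree one in the span of its generators.
  choose c hc using fun i => exists_coeff_zero_eq hΓ (r i)
  refine ⟨c, ?_⟩
  apply Subtype.ext
  funext w
  have hval : ∀ s : Fin n → splines Γ, (∑ i, s i).1 w = ∑ i, (s i).1 w := fun s => by
    rw [AddSubmonoidClass.coe_finsetSum, Finset.sum_apply]
  have hr' : a.1.1 w = ∑ i, (r i).1 w * X (τ w i) := by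
    rw [← hr, hval]
    refine Finset.sum_congr rfl fun i _ => ?_
    rw [smul_eq_mul, ← hy]
    rfl
  rw [hval, IsHomogeneous.eq_sum_coeff (a.2 w), ← Equiv.sum_comp (τ w)]
  refine Finset.sum_congr rfl fun i _ => ?_
  have h2 : ((c i • y i : splines Γ)).1 w = c i • X (τ w i) := by rw [← hy]; rfl
  rw [h2]
  congr 1
  rw [hr', coeff_sum]
  simp [coeff_single_mul_X, hc]

/-- The linear spline `∑ i, c i • y i`. -/
def linearCombination (y : Fin n → splines Γ) (hy : ∀ i, y i ∈ homogeneousSplines Γ 1) :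
    (Fin n → ℂ) →ₗ[ℂ] homogeneousSplines Γ 1 :=
  ∑ i, (LinearMap.proj i).smulRight (⟨y i, hy i⟩ : homogeneousSplines Γ 1)

theorem linearCombination_coe (y : Fin n → splines Γ) (hy : ∀ i, y i ∈ homogeneousSplines Γ 1)
    (c : Fin n → ℂ) : (linearCombination y hy c).1 = ∑ i, c i • y i := by
  simp [linearCombination]

theorem linearCombination_apply {y : Fin n → splines Γ} {hy : ∀ i, y i ∈ homogeneousSplines Γ 1}
    {τ : Perm (Fin n) → Perm (Fin n)} (hτ : ∀ i w, (y i).1 w = X (τ w i)) (c : Fin n → ℂ)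
    (w : Perm (Fin n)) : (linearCombination y hy c).1.1 w = ∑ i, c i • X (τ w i) := by
  rw [linearCombination_coe, AddSubmonoidClass.coe_finsetSum, Finset.sum_apply]
  refine Finset.sum_congr rfl fun i _ => ?_
  rw [← hτ]
  rfl

theorem linearCombination_injective {y : Fin n → splines Γ}
    {hy : ∀ i, y i ∈ homogeneousSplines Γ 1} {τ : Perm (Fin n) → Perm (Fin n)}
    (hτ : ∀ i w, (y i).1 w = X (τ w i)) : Function.Injective (linearCombination y hy) := by
  intro c c' h
  funext i
  have h1 := congrArg (fun a : homogeneousSplines Γ 1 =>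
    coeff (Finsupp.single (τ 1 i) 1) (a.1.1 1)) h
  simpa only [linearCombination_apply hτ, coeff_sum, coeff_smul, coeff_X, smul_eq_mul,
    Finsupp.single_left_inj one_ne_zero, (τ 1).injective.eq_iff, mul_ite, mul_one, mul_zero,
    Finset.sum_ite_eq', Finset.mem_univ, if_true] using h1

/-- The trace on the degree one piece of the quotient by linear splines `w ↦ X (τ w i)`. -/
theorem trace_quotient (hΓ : Γ.Connected) {y : Fin n → splines Γ}
    (hy : ∀ i, y i ∈ homogeneousSplines Γ 1)
    {τ : Perm (Fin n) → Perm (Fin n)} (hτ : ∀ i w, (y i).1 w = X (τ w i))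
    (I : Submodule ℂ (splines Γ)) (hI : I = (Ideal.span (Set.range y)).restrictScalars ℂ)
    (u : Perm (Fin n)) (h : (homogeneousSplines Γ 1).map I.mkQ →ₗ[ℂ]
      (homogeneousSplines Γ 1).map I.mkQ)
    (hh : ∀ a : homogeneousSplines Γ 1, h ⟨I.mkQ a.1, a.1, a.2, rfl⟩ =
      ⟨I.mkQ (linearDot Γ u a).1, _, (linearDot Γ u a).2, rfl⟩)
    (σ : Fin n → Fin n) (hσ : ∀ c : Fin n → ℂ, linearDot Γ u (linearCombination y hy c) =
      linearCombination y hy (LinearMap.funLeft ℂ ℂ σ c)) :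
    LinearMap.trace ℂ _ (linearDot Γ u) =
      (∑ i, if σ i = i then 1 else 0) + LinearMap.trace ℂ _ h := by
  classical
  let π : homogeneousSplines Γ 1 →ₗ[ℂ] (homogeneousSplines Γ 1).map I.mkQ :=
    I.mkQ.restrict fun a ha => ⟨a, ha, rfl⟩
  have hfin : Module.Finite ℂ ((homogeneousSplines Γ 1).map I.mkQ) := inferInstance
  rw [← trace_funLeft]
  refine trace_eq_add_of_exact (A := Fin n → ℂ) (M := homogeneousSplines Γ 1)
    (i := linearCombination y hy) (π := π)
    (linearCombination_injective hτ) ?_ ?_ hσ fun x => (hh x).symm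
  · rintro ⟨_, a, ha, rfl⟩
    exact ⟨⟨a, ha⟩, rfl⟩
  · intro a
    constructor
    · intro h0
      have h1 : a.1 ∈ I := by
        have : I.mkQ a.1 = 0 := congrArg Subtype.val h0
        rwa [Submodule.mkQ_apply, Submodule.Quotient.mk_eq_zero] at this
      rw [hI] at h1
      obtain ⟨c, hc⟩ := exists_eq_sum_of_mem_span hΓ hτ h1
      exact ⟨c, Subtype.ext (by rw [linearCombination_coe, hc])⟩
    · rintro ⟨c, rfl⟩
      apply Subtype.ext
      change I.mkQ (linearCombination y hy c).1 = 0
      rw [Submodule.mkQ_apply, Submodule.Quotient.mk_eq_zero, hI, linearCombination_coe]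
      change _ ∈ Ideal.span (Set.range y)
      refine Ideal.sum_mem _ fun i _ => ?_
      exact Submodule.smul_of_tower_mem (Ideal.span (Set.range y)) (c i)
        (Ideal.subset_span ⟨i, rfl⟩)

theorem tSpline_mem (i : Fin n) : tSpline Γ i ∈ homogeneousSplines Γ 1 :=
  fun _ => isHomogeneous_X ℂ i

theorem xSpline_mem (i : Fin n) : xSpline Γ i ∈ homogeneousSplines Γ 1 :=
  fun w => isHomogeneous_X ℂ (w i)

/-- The dot action sends `t̄_i` to `t̄_{u(i)}`, so the generators span the permutation
representation. -/
theorem leftRep_character (hΓ : Γ.Connected) (u : Perm (Fin n)) :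
    (leftRep Γ 1).character u = LinearMap.trace ℂ _ (translate Γ u) - fixCount 1 u := by
  rw [← trace_linearDot hΓ, fixCount_one, eq_comm, sub_eq_iff_eq_add']
  refine trace_quotient hΓ (y := tSpline Γ) tSpline_mem (τ := fun _ => 1) (fun _ _ => rfl) _ rfl u
    (leftRep Γ 1 u) (fun _ => rfl) _ fun c => ?_
  apply Subtype.ext
  apply Subtype.ext
  funext w
  rw [linearDot_apply, linearCombination_apply (τ := fun _ => 1) (fun _ _ => rfl),
    linearCombination_apply (τ := fun _ => 1) (fun _ _ => rfl), map_sum]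
  refine Fintype.sum_equiv u _ _ fun i => ?_
  simp [LinearMap.funLeft_apply]

/-- Every `x̄_i` is fixed by the dot action, so the generators span `n` trivial representations. -/
theorem rightRep_character (hΓ : Γ.Connected) (u : Perm (Fin n)) :
    (rightRep Γ 1).character u = LinearMap.trace ℂ _ (translate Γ u) - n := by
  rw [← trace_linearDot hΓ, eq_comm, sub_eq_iff_eq_add']
  have := trace_quotient hΓ (y := xSpline Γ) xSpline_mem (τ := id) (fun _ _ => rfl) _ rfl u
    (rightRep Γ 1 u) (fun _ => rfl) id fun c => ?_
  · simp only [id, if_true, Finset.sum_const, Finset.card_univ, Fintype.card_fin, nsmul_eq_mul,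
      mul_one] at this
    exact this
  apply Subtype.ext
  apply Subtype.ext
  funext w
  rw [linearDot_apply, linearCombination_apply (τ := id) (fun _ _ => rfl),
    linearCombination_apply (τ := id) (fun _ _ => rfl), map_sum]
  refine Finset.sum_congr rfl fun i _ => ?_
  simp [LinearMap.funLeft_apply]

end LinearSplines

/-! ### Coefficients of power sums as numbers of invariant words -/

section PowerSums

variable {α : Type*} [Fintype α]

open Classical in
/-- The size of a cycle of `w`, fixed points included. -/
def cycleSize (w : Perm α) (q : Quotient (Perm.SameCycle.setoid w)) : ℕ :=
  Finset.card {x : α | Quotient.mk (Perm.SameCycle.setoid w) x = q}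

theorem cycleSize_pos (w : Perm α) (q : Quotient (Perm.SameCycle.setoid w)) :
    0 < cycleSize w q := by
  classical
  induction q using Quotient.inductionOn with | _ x =>
  exact Finset.card_pos.2 ⟨x, by simp⟩

variable [DecidableEq α]

theorem cycleSize_mk_of_mem_support {w : Perm α} {x : α} (hx : x ∈ w.support) :
    cycleSize w (Quotient.mk _ x) = (w.cycleOf x).support.card := by
  classical
  rw [cycleSize]
  congr 1
  ext y
  rw [Finset.mem_filter, Perm.mem_support_cycleOf_iff' (Perm.mem_support.1 hx)]
  simp only [Finset.mem_univ, true_and]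
  rw [Quotient.eq]
  exact Perm.sameCycle_comm

theorem mk_eq_mk_iff_of_notMem_support {w : Perm α} {x y : α} (hx : x ∉ w.support) :
    Quotient.mk (Perm.SameCycle.setoid w) x = Quotient.mk _ y ↔ x = y := by
  rw [Quotient.eq]
  constructor
  · rintro ⟨i, hi⟩
    rw [← hi, Perm.zpow_apply_eq_self_of_apply_eq_self (Perm.notMem_support.1 hx)]
  · rintro rfl
    exact Perm.SameCycle.refl _ _

/-- Orbits in the support correspond to the cycle factors, the others to the parts equal to `1`.
Indexing by orbits treats both alike. -/
theorem prod_map_parts_partition {M : Type*} [CommMonoid M] (w : Perm α) (f : ℕ → M)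
    [Fintype (Quotient (Perm.SameCycle.setoid w))] :
    (w.partition.parts.map f).prod = ∏ q, f (cycleSize w q) := by
  classical
  let S : Finset (Quotient (Perm.SameCycle.setoid w)) :=
    {q | ∃ x ∈ w.support, Quotient.mk _ x = q}
  rw [← Finset.prod_filter_mul_prod_filter_not Finset.univ (· ∈ S), Perm.parts_partition,
    Multiset.map_add, Multiset.prod_add]
  congr 1
  · rw [Perm.cycleType_def, Multiset.map_map]
    change ∏ c ∈ w.cycleFactorsFinset, _ = _
    symm
    have hsp : ∀ q, q ∈ S → ∃ x ∈ w.support, Quotient.mk (Perm.SameCycle.setoid w) x = q :=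
      fun q hq => by simpa [S] using hq
    refine Finset.prod_bij (fun q hq => w.cycleOf (hsp q (Finset.mem_filter.1 hq).2).choose)
      ?_ ?_ ?_ ?_
    · intro q hq
      rw [Perm.cycleOf_mem_cycleFactorsFinset_iff]
      exact (hsp q (Finset.mem_filter.1 hq).2).choose_spec.1
    · intro q hq q' hq' h
      have h1 := (hsp q (Finset.mem_filter.1 hq).2).choose_spec
      have h2 := (hsp q' (Finset.mem_filter.1 hq').2).choose_spec
      rw [← Perm.sameCycle_iff_cycleOf_eq_of_mem_support h1.1 h2.1] at h
      rw [← h1.2, ← h2.2]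
      exact Quotient.sound h
    · intro c hc
      obtain ⟨x, hx⟩ := (Perm.mem_cycleFactorsFinset_iff.1 hc).1.nonempty_support
      have hxw := Perm.mem_cycleFactorsFinset_support_le hc hx
      have hq : Quotient.mk (Perm.SameCycle.setoid w) x ∈ S := by
        simp only [S, Finset.mem_filter, Finset.mem_univ, true_and]
        exact ⟨x, hxw, rfl⟩
      refine ⟨Quotient.mk _ x, by simpa using hq, ?_⟩
      have h1 := (hsp _ hq).choose_spec
      rw [(Perm.eq_cycleOf_of_mem_cycleFactorsFinset_iff w c hc x).2 hx,
        ← Perm.sameCycle_iff_cycleOf_eq_of_mem_support h1.1 hxw]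
      exact Quotient.exact h1.2
    · intro q hq
      have h1 := (hsp q (Finset.mem_filter.1 hq).2).choose_spec
      conv_lhs => rw [← h1.2, cycleSize_mk_of_mem_support h1.1]
      rfl
  · rw [Multiset.map_replicate, Multiset.prod_replicate]
    have hcard : Fintype.card α - w.support.card = (w.supportᶜ).card := by
      rw [Finset.card_compl]
    rw [hcard, ← Finset.prod_const]
    refine Finset.prod_bij (fun x _ => Quotient.mk _ x) ?_ ?_ ?_ ?_
    · intro x hx
      rw [Finset.mem_compl] at hx
      simp only [S, Finset.mem_filter, Finset.mem_univ, true_and]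
      rintro ⟨y, hy, hyx⟩
      rw [eq_comm, mk_eq_mk_iff_of_notMem_support hx] at hyx
      exact hx (hyx ▸ hy)
    · intro x hx y _ h
      exact (mk_eq_mk_iff_of_notMem_support (Finset.mem_compl.1 hx)).1 h
    · intro q hq
      induction q using Quotient.inductionOn with | _ x =>
      refine ⟨x, ?_, rfl⟩
      rw [Finset.mem_compl]
      intro hx
      simp only [S, Finset.mem_filter, Finset.mem_univ, true_and] at hq
      exact hq ⟨x, hx, rfl⟩
    · intro x hx
      congr 1
      rw [cycleSize, eq_comm, Finset.card_eq_one]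
      refine ⟨x, ?_⟩
      ext y
      simp only [Finset.mem_filter, Finset.mem_univ, true_and, Finset.mem_singleton]
      rw [eq_comm, mk_eq_mk_iff_of_notMem_support (Finset.mem_compl.1 hx), eq_comm]

/-- Expanding the product chooses a letter `ψ q` for each factor; positivity of `k q` lets the
letter be read off from the monomial. -/
theorem coeff_prod_powerSum {Q : Type*} [Fintype Q] {k : Q → ℕ} (hk : ∀ q, 0 < k q)
    (m : ℕ →₀ ℕ) : MvPowerSeries.coeff m (∏ q, powerSum (k q)) =
      (Nat.card {ψ : Q → ℕ // ∑ q, Finsupp.single (ψ q) (k q) = m} : ℂ) := by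
  classical
  rw [MvPowerSeries.coeff_prod]
  have h1 : ∀ l : Q →₀ (ℕ →₀ ℕ), ∏ q, MvPowerSeries.coeff (l q) (powerSum (k q)) =
      if ∀ q, ∃ i, l q = Finsupp.single i (k q) then 1 else 0 := by
    intro l
    change ∏ q, (if ∃ i, l q = Finsupp.single i (k q) then (1 : ℂ) else 0) = _
    rw [Finset.prod_ite_zero]
    simp
  simp only [h1]
  rw [Finset.sum_boole]
  congr 1
  rw [← Fintype.card_coe, ← Nat.card_eq_fintype_card]
  symm
  let F : {ψ : Q → ℕ // ∑ q, Finsupp.single (ψ q) (k q) = m} →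
      {l // l ∈ Finset.filter (fun l : Q →₀ (ℕ →₀ ℕ) => ∀ q, ∃ i, l q = Finsupp.single i (k q))
        (Finset.univ.finsuppAntidiag m)} := fun ψ =>
    ⟨Finsupp.equivFunOnFinite.symm fun q => Finsupp.single (ψ.1 q) (k q), by
      rw [Finset.mem_filter, Finset.mem_finsuppAntidiag]
      exact ⟨⟨by simpa using ψ.2, Finset.subset_univ _⟩, fun q => ⟨ψ.1 q, rfl⟩⟩⟩
  refine Nat.card_eq_of_bijective F ⟨fun ψ ψ' h => ?_, fun l => ?_⟩
  · apply Subtype.ext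
    funext q
    have := DFunLike.congr_fun (congrArg Subtype.val h) q
    exact Finsupp.single_left_injective (hk q).ne' this
  · obtain ⟨l, hl⟩ := l
    rw [Finset.mem_filter, Finset.mem_finsuppAntidiag] at hl
    choose ψ hψ using hl.2
    refine ⟨⟨ψ, ?_⟩, ?_⟩
    · rw [← hl.1.1]
      exact Finset.sum_congr rfl fun q _ => (hψ q).symm
    · apply Subtype.ext
      ext1 q
      exact (hψ q).symm

/-- The content of a word `φ`. -/
def content (φ : α → ℕ) : ℕ →₀ ℕ := ∑ x, Finsupp.single (φ x) 1

/-- A word invariant under `w` is a choice of one letter for each cycle. -/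
theorem coeff_prod_parts_partition (w : Perm α) (m : ℕ →₀ ℕ) :
    MvPowerSeries.coeff m (w.partition.parts.map powerSum).prod =
      (Nat.card {φ : α → ℕ // (∀ x, φ (w x) = φ x) ∧ content φ = m} : ℂ) := by
  classical
  have := Fintype.ofFinite (Quotient (Perm.SameCycle.setoid w))
  rw [prod_map_parts_partition, coeff_prod_powerSum (cycleSize_pos w)]
  congr 1
  have hcont : ∀ ψ : Quotient (Perm.SameCycle.setoid w) → ℕ,
      content (fun x => ψ (Quotient.mk _ x)) = ∑ q, Finsupp.single (ψ q) (cycleSize w q) := by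
    intro ψ
    rw [content, ← Finset.sum_fiberwise Finset.univ
      (fun x => Quotient.mk (Perm.SameCycle.setoid w) x)]
    refine Finset.sum_congr rfl fun q _ => ?_
    have : ∀ x ∈ Finset.filter (fun x => Quotient.mk (Perm.SameCycle.setoid w) x = q) Finset.univ,
        Finsupp.single (ψ (Quotient.mk (Perm.SameCycle.setoid w) x)) 1 =
          Finsupp.single (ψ q) 1 := fun x hx => by rw [(Finset.mem_filter.1 hx).2]
    rw [Finset.sum_congr rfl this, Finset.sum_const, Finsupp.smul_single, smul_eq_mul, mul_one]
    rfl
  let F : {ψ : Quotient (Perm.SameCycle.setoid w) → ℕ //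
      ∑ q, Finsupp.single (ψ q) (cycleSize w q) = m} →
      {φ : α → ℕ // (∀ x, φ (w x) = φ x) ∧ content φ = m} := fun ψ =>
    ⟨fun x => ψ.1 (Quotient.mk _ x), fun x => congrArg ψ.1 (Quotient.sound
      (Perm.sameCycle_apply_left.2 (Perm.SameCycle.refl w x))), by rw [hcont, ψ.2]⟩
  refine Nat.card_eq_of_bijective F ⟨fun ψ ψ' h => ?_, fun φ => ?_⟩
  · apply Subtype.ext
    funext q
    induction q using Quotient.inductionOn with | _ x =>
    exact congrFun (congrArg Subtype.val h) x
  · obtain ⟨φ, hφ, hm⟩ := φ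
    have hpow : ∀ x y, w.SameCycle x y → φ x = φ y := by
      rintro x _ ⟨i, rfl⟩
      induction i using Int.induction_on with
      | zero => simp
      | succ i ih => rw [add_comm, zpow_add, zpow_one, Perm.mul_apply, hφ, ih]
      | pred i ih =>
        rw [ih, ← hφ ((w ^ (-(i : ℤ) - 1)) x), ← Perm.mul_apply, ← zpow_one_add]
        congr 3
        ring
    refine ⟨⟨fun q => Quotient.lift φ hpow q, ?_⟩, rfl⟩
    rw [← hcont]
    exact hm

end PowerSums

/-! ### Frobenius characteristic of the action on subsets, by Burnside's lemma -/

section Burnside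

theorem exists_perm_of_card_fiber_eq {α β : Type*} [Fintype α] [DecidableEq β] {f g : α → β}
    (h : ∀ b, Finset.card {x | f x = b} = Finset.card {x | g x = b}) :
    ∃ u : Perm α, ∀ x, g (u x) = f x := by
  have h' : ∀ b, Nonempty ({x // f x = b} ≃ {x // g x = b}) := fun b => by
    rw [← Fintype.card_eq, Fintype.card_subtype, Fintype.card_subtype]
    exact h b
  let e : ∀ b, {x // f x = b} ≃ {x // g x = b} := fun b => (h' b).some
  refine ⟨(Equiv.sigmaFiberEquiv f).symm.trans
    ((Equiv.sigmaCongrRight e).trans (Equiv.sigmaFiberEquiv g)), fun x => ?_⟩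
  exact (e (f x) ⟨x, rfl⟩).2

theorem content_apply {α : Type*} [Fintype α] (φ : α → ℕ) (i : ℕ) :
    content φ i = Finset.card {x | φ x = i} := by
  classical
  rw [content, Finsupp.finsetSum_apply]
  simp [Finsupp.single_apply]

variable {n : ℕ}

/-- Pairs of an `a`-element subset and a word of content `m`. -/
def MarkedWord (n a : ℕ) (m : ℕ →₀ ℕ) : Type :=
  {s : Finset (Fin n) // s.card = a} × {φ : Fin n → ℕ // content φ = m}

theorem content_comp (φ : Fin n → ℕ) (u : Perm (Fin n)) : content (fun x => φ (u x)) = content φ :=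
  Equiv.sum_comp u fun x => Finsupp.single (φ x) 1

instance (a : ℕ) (m : ℕ →₀ ℕ) : MulAction (Perm (Fin n)) (MarkedWord n a m) where
  smul u y := ⟨subsetPerm a u y.1, fun x => y.2.1 (u⁻¹ x), (content_comp _ _).trans y.2.2⟩
  one_smul y := Prod.ext (Subtype.ext Finset.map_refl) rfl
  mul_smul u v y := Prod.ext (Subtype.ext
      (Finset.map_map v.toEmbedding u.toEmbedding y.1.1).symm)
    (Subtype.ext (by funext x; change y.2.1 ((u * v)⁻¹ x) = _; rw [mul_inv_rev]; rfl))

theorem MarkedWord.smul_def {a : ℕ} {m : ℕ →₀ ℕ} (u : Perm (Fin n)) (y : MarkedWord n a m) :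
    u • y = ⟨subsetPerm a u y.1, fun x => y.2.1 (u⁻¹ x), (content_comp _ _).trans y.2.2⟩ := rfl

instance (m : ℕ →₀ ℕ) : Finite {φ : Fin n → ℕ // content φ = m} := by
  refine Set.Finite.to_subtype (s := {φ : Fin n → ℕ | content φ = m})
    ((Fintype.piFinset fun _ : Fin n => m.support).finite_toSet.subset fun φ hφ => ?_)
  rw [Finset.mem_coe, Fintype.mem_piFinset]
  intro x
  rw [Finsupp.mem_support_iff, ← show content φ = m from hφ, content_apply]
  exact (Finset.card_pos.2 ⟨x, by simp⟩).ne'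

instance (a : ℕ) (m : ℕ →₀ ℕ) : Finite (MarkedWord n a m) :=
  inferInstanceAs (Finite (_ × _))

/-- The contents of a word on a subset and on its complement. -/
def splitContent {a : ℕ} {m : ℕ →₀ ℕ} (y : MarkedWord n a m) : (ℕ →₀ ℕ) × (ℕ →₀ ℕ) :=
  (∑ x ∈ y.1.1, Finsupp.single (y.2.1 x) 1, ∑ x ∈ y.1.1ᶜ, Finsupp.single (y.2.1 x) 1)

theorem sum_single_apply {α : Type*} [DecidableEq α] (s : Finset α) (φ : α → ℕ) (i : ℕ) :
    (∑ x ∈ s, Finsupp.single (φ x) 1 : ℕ →₀ ℕ) i = Finset.card {x ∈ s | φ x = i} := by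
  rw [Finsupp.finsetSum_apply]
  simp [Finsupp.single_apply]

theorem degree_sum_single {α : Type*} (s : Finset α) (φ : α → ℕ) :
    (∑ x ∈ s, Finsupp.single (φ x) 1 : ℕ →₀ ℕ).degree = s.card := by
  simp

theorem splitContent_smul {a : ℕ} {m : ℕ →₀ ℕ} (u : Perm (Fin n)) (y : MarkedWord n a m) :
    splitContent (u • y) = splitContent y := by
  have h1 : ∀ s : Finset (Fin n), ∑ x ∈ s.map u.toEmbedding,
      Finsupp.single (y.2.1 (u⁻¹ x)) 1 = ∑ x ∈ s, Finsupp.single (y.2.1 x) 1 := by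
    intro s
    rw [Finset.sum_map]
    refine Finset.sum_congr rfl fun x _ => ?_
    simp
  rw [splitContent, splitContent, MarkedWord.smul_def]
  simp only [subsetPerm_coe]
  rw [h1, ← h1 y.1.1ᶜ]
  congr 2
  ext x
  simp

theorem exists_smul_eq_of_splitContent_eq {a : ℕ} {m : ℕ →₀ ℕ} {y z : MarkedWord n a m}
    (h : splitContent y = splitContent z) : ∃ u : Perm (Fin n), u • y = z := by
  classical
  have hf : ∀ (v : MarkedWord n a m) (b : Prop × ℕ),
      Finset.card {x | ((x ∈ v.1.1 : Prop), v.2.1 x) = b} =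
        if b.1 then (splitContent v).1 b.2 else (splitContent v).2 b.2 := by
    rintro v ⟨b, i⟩
    rw [splitContent, sum_single_apply, sum_single_apply]
    split_ifs with hb
    · congr 1
      ext x
      simp only [Finset.mem_filter, Finset.mem_univ, true_and, Prod.mk.injEq, eq_iff_iff]
      simp only at hb
      simp [hb]
    · congr 1
      ext x
      simp only [Finset.mem_filter, Finset.mem_univ, true_and, Prod.mk.injEq, eq_iff_iff,
        Finset.mem_compl]
      simp only at hb
      simp [hb]
  -- Colour `x` by membership in the subset together with its letter. Equal split contents mean
  -- equally large colour classes, so some permutation matches the colours.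
  obtain ⟨u, hu⟩ := exists_perm_of_card_fiber_eq (f := fun x => ((x ∈ y.1.1 : Prop), y.2.1 x))
    (g := fun x => ((x ∈ z.1.1 : Prop), z.2.1 x)) fun b => by rw [hf, hf, h]
  refine ⟨u, ?_⟩
  rw [MarkedWord.smul_def]
  refine Prod.ext (Subtype.ext ?_) (Subtype.ext ?_)
  · rw [subsetPerm_coe]
    ext x
    have := congrArg Prod.fst (hu (u⁻¹ x))
    simp only [eq_iff_iff] at this
    rw [← Perm.mul_apply, mul_inv_cancel, Perm.one_apply] at this
    rw [this, Finset.mem_map_equiv]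
    rfl
  · funext x
    have := congrArg Prod.snd (hu (u⁻¹ x))
    simp only at this
    rw [← Perm.mul_apply, mul_inv_cancel, Perm.one_apply] at this
    exact this.symm

theorem exists_word (k : ℕ) (m : ℕ →₀ ℕ) (hm : m.degree = k) :
    ∃ φ : Fin k → ℕ, content φ = m := by
  induction k generalizing m with
  | zero =>
    rw [Finsupp.degree_eq_zero_iff] at hm
    exact ⟨Fin.elim0, by simp [content, hm]⟩
  | succ k ih =>
    have hne : m ≠ 0 := by
      rintro rfl
      simp at hm
    obtain ⟨i, hi⟩ := Finsupp.ne_iff.1 hne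
    have hle : Finsupp.single i 1 ≤ m := by
      rw [Finsupp.single_le_iff]
      exact Nat.one_le_iff_ne_zero.2 hi
    obtain ⟨m', rfl⟩ := exists_add_of_le hle
    obtain ⟨φ, hφ⟩ := ih m' (by simp at hm; omega)
    refine ⟨Fin.cons i φ, ?_⟩
    rw [content, Fin.sum_univ_succ, ← hφ]
    simp [content]

theorem exists_splitContent_eq {a : ℕ} (ha : a ≤ n) {m m₁ m₂ : ℕ →₀ ℕ} (hm : m₁ + m₂ = m)
    (h₁ : m₁.degree = a) (h₂ : m₂.degree = n - a) :
    ∃ y : MarkedWord n a m, splitContent y = (m₁, m₂) := by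
  obtain ⟨φ₁, hφ₁⟩ := exists_word a m₁ h₁
  obtain ⟨φ₂, hφ₂⟩ := exists_word (n - a) m₂ h₂
  let e : Fin a ⊕ Fin (n - a) ≃ Fin n :=
    finSumFinEquiv.trans (finCongr (Nat.add_sub_cancel' ha))
  let φ : Fin n → ℕ := fun x => Sum.elim φ₁ φ₂ (e.symm x)
  let s : Finset (Fin n) := Finset.univ.map (Function.Embedding.inl.trans e.toEmbedding)
  have hsc : sᶜ = Finset.univ.map (Function.Embedding.inr.trans e.toEmbedding) := by
    ext x
    obtain ⟨x, rfl⟩ := e.surjective x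
    rcases x with x | x <;> simp [s]
  have hs₁ : ∑ x ∈ s, Finsupp.single (φ x) 1 = m₁ := by
    rw [Finset.sum_map, ← hφ₁, content]
    refine Finset.sum_congr rfl fun x _ => ?_
    simp [φ]
  have hs₂ : ∑ x ∈ sᶜ, Finsupp.single (φ x) 1 = m₂ := by
    rw [hsc, Finset.sum_map, ← hφ₂, content]
    refine Finset.sum_congr rfl fun x _ => ?_
    simp [φ]
  refine ⟨⟨⟨s, by simp [s]⟩, ⟨φ, ?_⟩⟩, ?_⟩
  · rw [content, ← Finset.sum_add_sum_compl s, hs₁, hs₂, hm]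
  · exact Prod.ext hs₁ hs₂

/-- An orbit is determined by the contents on the subset and on its complement. These are exactly
the pairs of monomials of degrees `a` and `n - a` with product `x^m`. -/
theorem card_orbits_markedWord {a : ℕ} (ha : a ≤ n) (m : ℕ →₀ ℕ) :
    (Nat.card (Quotient (MulAction.orbitRel (Perm (Fin n)) (MarkedWord n a m))) : ℂ) =
      MvPowerSeries.coeff m (completeHomogeneous a * completeHomogeneous (n - a)) := by
  classical
  rw [MvPowerSeries.coeff_mul]
  have h1 : ∀ x : (ℕ →₀ ℕ) × (ℕ →₀ ℕ), MvPowerSeries.coeff x.1 (completeHomogeneous a) *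
      MvPowerSeries.coeff x.2 (completeHomogeneous (n - a)) =
      if x.1.degree = a ∧ x.2.degree = n - a then 1 else 0 := by
    intro x
    change (if x.1.degree = a then (1 : ℂ) else 0) * (if x.2.degree = n - a then 1 else 0) = _
    rw [ite_and]
    split_ifs <;> simp
  simp only [h1]
  rw [Finset.sum_boole]
  congr 1
  rw [← Fintype.card_coe, ← Nat.card_eq_fintype_card]
  have hmem : ∀ y : MarkedWord n a m, splitContent y ∈ Finset.filter
      (fun x => x.1.degree = a ∧ x.2.degree = n - a) (Finset.HasAntidiagonal.antidiagonal m) := by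
    intro y
    rw [Finset.mem_filter, Finset.HasAntidiagonal.mem_antidiagonal]
    refine ⟨?_, ?_, ?_⟩
    · rw [splitContent, Finset.sum_add_sum_compl]
      exact y.2.2
    · rw [splitContent, degree_sum_single, y.1.2]
    · rw [splitContent, degree_sum_single, Finset.card_compl, y.1.2, Fintype.card_fin]
  refine card_eq_of_ker_eq (α := MarkedWord n a m) (f := Quotient.mk _)
    (g := fun y => ⟨splitContent y, hmem y⟩) Quotient.mk_surjective ?_ ?_
  · rintro ⟨⟨m₁, m₂⟩, hx⟩
    rw [Finset.mem_filter, Finset.HasAntidiagonal.mem_antidiagonal] at hx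
    obtain ⟨y, hy⟩ := exists_splitContent_eq ha hx.1 hx.2.1 hx.2.2
    exact ⟨y, Subtype.ext hy⟩
  · intro y z
    rw [Quotient.eq, Subtype.mk.injEq]
    constructor
    · rintro ⟨u, rfl⟩
      exact splitContent_smul u z
    · intro h
      obtain ⟨u, hu⟩ := exists_smul_eq_of_splitContent_eq h.symm
      exact ⟨u, hu⟩

theorem subsetPerm_inv_eq_iff {a : ℕ} (u : Perm (Fin n)) (s : {s : Finset (Fin n) // s.card = a}) :
    subsetPerm a u⁻¹ s = s ↔ subsetPerm a u s = s := by
  have h : ∀ v : Perm (Fin n), subsetPerm a v⁻¹ (subsetPerm a v s) = s := fun v => by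
    apply Subtype.ext
    rw [subsetPerm_coe, subsetPerm_coe, Finset.map_map]
    ext x
    simp
  constructor
  · intro h'
    have := h u⁻¹
    rw [h', inv_inv] at this
    exact this
  · intro h'
    have := h u
    rwa [h'] at this

/-- A marked word is fixed by `u` exactly when its subset and its word are, so the two counts
multiply. This prepares Burnside's lemma. -/
theorem fixCount_mul_coeff (a : ℕ) (m : ℕ →₀ ℕ) (u : Perm (Fin n)) :
    fixCount a u * MvPowerSeries.coeff m (u.partition.parts.map powerSum).prod =
      (Nat.card (MulAction.fixedBy (MarkedWord n a m) u) : ℂ) := by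
  classical
  rw [coeff_prod_parts_partition, fixCount, Finset.sum_boole, ← Nat.cast_mul]
  congr 1
  rw [← Fintype.card_subtype, ← Nat.card_eq_fintype_card, ← Nat.card_prod]
  have hφ : ∀ φ : Fin n → ℕ, (∀ x, φ (u x) = φ x) ↔ (fun x => φ (u⁻¹ x)) = φ := by
    intro φ
    constructor
    · intro h
      funext x
      rw [← h, ← Perm.mul_apply, mul_inv_cancel, Perm.one_apply]
    · intro h x
      rw [← congrFun h (u x), ← Perm.mul_apply, inv_mul_cancel, Perm.one_apply]
  refine Nat.card_congr
    { toFun := fun x => ⟨⟨x.1.1, ⟨x.2.1, x.2.2.2⟩⟩, Prod.ext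
        ((subsetPerm_inv_eq_iff u _).1 x.1.2) (Subtype.ext ((hφ _).1 x.2.2.1))⟩
      invFun := fun y => ⟨⟨y.1.1, (subsetPerm_inv_eq_iff u _).2 (congrArg Prod.fst y.2)⟩,
        ⟨y.1.2.1, (hφ _).2 (congrArg (fun z => z.2.1) y.2), y.1.2.2⟩⟩
      left_inv := fun _ => rfl
      right_inv := fun _ => rfl }

/-- The Frobenius characteristic of the permutation representation on `a`-element subsets. -/
theorem sum_fixCount_smul {a : ℕ} (ha : a ≤ n) :
    ((n.factorial : ℂ)⁻¹) • ∑ u : Perm (Fin n),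
      fixCount a u • (u.partition.parts.map powerSum).prod =
        completeHomogeneous a * completeHomogeneous (n - a) := by
  classical
  ext m
  have := Fintype.ofFinite (Quotient (MulAction.orbitRel (Perm (Fin n)) (MarkedWord n a m)))
  have : ∀ u : Perm (Fin n), Fintype (MulAction.fixedBy (MarkedWord n a m) u) :=
    fun u => Fintype.ofFinite _
  have hb := MulAction.sum_card_fixedBy_eq_card_orbits_mul_card_group (Perm (Fin n))
    (MarkedWord n a m)
  rw [map_smul, map_sum, ← card_orbits_markedWord ha m]
  simp only [map_smul, smul_eq_mul, fixCount_mul_coeff]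
  have hb' : ∑ u : Perm (Fin n), (Nat.card (MulAction.fixedBy (MarkedWord n a m) u) : ℂ) =
      (Nat.card (Quotient (MulAction.orbitRel (Perm (Fin n)) (MarkedWord n a m))) : ℂ) *
        n.factorial := by
    rw [Fintype.card_perm, Fintype.card_fin] at hb
    simp only [Nat.card_eq_fintype_card]
    exact_mod_cast hb
  rw [hb']
  have : (n.factorial : ℂ) ≠ 0 := by exact_mod_cast n.factorial_ne_zero
  field_simp

end Burnside

/-! ### The weakly increasing word of given content -/

section SortedWords

/-- The word with content `m` whose letters increase weakly. -/
def sortedEntry (m : ℕ →₀ ℕ) (j : ℕ) : ℕ :=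
  ((Finsupp.toMultiset m).sort (· ≤ ·)).getD j 0

theorem toMultiset_sum_single (k : ℕ) (f : ℕ → ℕ) :
    Finsupp.toMultiset (∑ j ∈ Finset.range k, Finsupp.single (f j) 1) =
      ((List.range k).map f : List ℕ) := by
  rw [map_sum]
  simp only [Finsupp.toMultiset_single, one_smul]
  have : (((List.range k).map f : List ℕ) : Multiset ℕ) = (Multiset.range k).map f := rfl
  rw [this, ← Multiset.sum_map_singleton ((Multiset.range k).map f), Multiset.map_map]
  rfl

theorem length_sort_toMultiset (m : ℕ →₀ ℕ) :
    ((Finsupp.toMultiset m).sort (· ≤ ·)).length = m.degree := by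
  rw [Multiset.length_sort, Finsupp.card_toMultiset]
  rfl

theorem eq_sortedEntry {k : ℕ} {f : ℕ → ℕ} (hf : ∀ i j, i < j → j < k → f i ≤ f j)
    {m : ℕ →₀ ℕ} (hm : ∑ j ∈ Finset.range k, Finsupp.single (f j) 1 = m) {j : ℕ} (hj : j < k) :
    f j = sortedEntry m j := by
  have h1 : (List.range k).map f = (Finsupp.toMultiset m).sort (· ≤ ·) := by
    refine List.Perm.eq_of_pairwise' (r := (· ≤ ·)) ?_ (Multiset.pairwise_sort _ _) ?_
    · rw [List.pairwise_map]
      refine List.Pairwise.imp_of_mem ?_ List.pairwise_lt_range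
      intro a b _ hb hab
      exact hf a b hab (List.mem_range.1 hb)
    · rw [← Multiset.coe_eq_coe, Multiset.sort_eq, ← hm, toMultiset_sum_single]
  rw [sortedEntry, ← h1, List.getD_eq_getElem _ _ (by simpa using hj)]
  simp

theorem sortedEntry_mono {m : ℕ →₀ ℕ} {i j : ℕ} (hij : i < j) (hj : j < m.degree) :
    sortedEntry m i ≤ sortedEntry m j := by
  rw [← length_sort_toMultiset] at hj
  rw [sortedEntry, sortedEntry, List.getD_eq_getElem _ _ (hij.trans hj),
    List.getD_eq_getElem _ _ hj]
  exact List.pairwise_iff_getElem.1 (Multiset.pairwise_sort (Finsupp.toMultiset m) (· ≤ ·)) i j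
    (hij.trans hj) hj hij

theorem sum_single_sortedEntry (m : ℕ →₀ ℕ) :
    ∑ j ∈ Finset.range m.degree, Finsupp.single (sortedEntry m j) 1 = m := by
  apply Multiset.toFinsupp.symm.injective
  change Finsupp.toMultiset _ = Finsupp.toMultiset m
  rw [toMultiset_sum_single]
  conv_rhs => rw [← Multiset.sort_eq (Finsupp.toMultiset m) (· ≤ ·)]
  congr 1
  refine List.ext_getElem (by rw [List.length_map, List.length_range, length_sort_toMultiset]) ?_
  intro j h1 h2
  rw [List.getElem_map, List.getElem_range, sortedEntry, List.getD_eq_getElem _ _ h2]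

theorem exists_sortedEntry_eq {m : ℕ →₀ ℕ} {l : ℕ} (hl : m l ≠ 0) :
    ∃ j < m.degree, sortedEntry m j = l := by
  have h := sum_single_sortedEntry m
  rw [← h, sum_single_apply] at hl
  obtain ⟨j, hj⟩ := Finset.card_pos.1 (Nat.pos_of_ne_zero hl)
  rw [Finset.mem_filter, Finset.mem_range] at hj
  exact ⟨j, hj⟩

end SortedWords

/-! ### The Schur functions of shapes (n) and (n-1,1) -/

section Schur

variable {n : ℕ}

theorem mem_diagram_of_sort_eq_singleton {μ : n.Partition} {k : ℕ}
    (h : μ.parts.sort (· ≥ ·) = [k]) (c : ℕ × ℕ) : c ∈ diagram μ ↔ c.1 = 0 ∧ c.2 < k := by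
  rw [diagram, YoungDiagram.mem_ofRowLens]
  simp only [h]
  obtain ⟨i, j⟩ := c
  constructor
  · rintro ⟨h1, h2⟩
    simp only [List.length_singleton, Nat.lt_one_iff] at h1
    subst h1
    exact ⟨rfl, h2⟩
  · rintro ⟨h1, h2⟩
    simp only at h1
    subst h1
    exact ⟨by simp, h2⟩

theorem mem_diagram_of_sort_eq_pair {μ : n.Partition} {k : ℕ}
    (h : μ.parts.sort (· ≥ ·) = [k, 1]) (c : ℕ × ℕ) :
    c ∈ diagram μ ↔ (c.1 = 0 ∧ c.2 < k) ∨ (c.1 = 1 ∧ c.2 = 0) := by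
  rw [diagram, YoungDiagram.mem_ofRowLens]
  simp only [h]
  obtain ⟨i, j⟩ := c
  constructor
  · rintro ⟨h1, h2⟩
    simp only [List.length_cons, List.length_nil] at h1
    interval_cases i
    · exact .inl ⟨rfl, h2⟩
    · exact .inr ⟨rfl, by simpa using h2⟩
  · rintro (⟨h1, h2⟩ | ⟨h1, h2⟩)
    · simp only at h1 h2
      subst h1
      exact ⟨by simp, h2⟩
    · simp only at h1 h2
      subst h1 h2
      exact ⟨by simp, by simp⟩

theorem sort_parts_indiscrete (hn : n ≠ 0) :
    (Nat.Partition.indiscrete n).parts.sort (· ≥ ·) = [n] := by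
  rw [Nat.Partition.indiscrete_parts hn, Multiset.sort_singleton]

theorem parts_twoPart {a : ℕ} (ha : a ≤ n) :
    (twoPart n a ha).parts = ({n - a, a} : Multiset ℕ).filter (· ≠ 0) := rfl

theorem sort_parts_twoPart_one (hn : 2 ≤ n) :
    (twoPart n 1 (one_le_two.trans hn)).parts.sort (· ≥ ·) = [n - 1, 1] := by
  have : ({n - 1, 1} : Multiset ℕ).filter (· ≠ 0) = (n - 1) ::ₘ {1} := by
    rw [Multiset.filter_eq_self.2]
    · rfl
    · intro a ha
      simp only [Multiset.insert_eq_cons, Multiset.mem_cons, Multiset.mem_singleton] at ha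
      omega
  rw [parts_twoPart, this, Multiset.sort_cons, Multiset.sort_singleton]
  intro b hb
  rw [Multiset.mem_singleton] at hb
  change b ≤ n - 1
  omega

theorem completeHomogeneous_zero : completeHomogeneous 0 = 1 := by
  classical
  ext m
  rw [MvPowerSeries.coeff_one]
  change (if m.degree = 0 then (1 : ℂ) else 0) = _
  simp only [Finsupp.degree_eq_zero_iff]

theorem hSym_twoPart {a : ℕ} (ha : a ≤ n) :
    hSym (twoPart n a ha) = completeHomogeneous a * completeHomogeneous (n - a) := by
  have key : ∀ s : Multiset ℕ, ((s.filter (fun a => a ≠ 0)).map completeHomogeneous).prod =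
      (s.map completeHomogeneous).prod := by
    intro s
    induction s using Multiset.induction_on with
    | empty => rfl
    | cons a s ih =>
      by_cases h : a = 0
      · subst h
        rw [Multiset.filter_cons_of_neg (p := fun a => a ≠ 0) _ (by simp), Multiset.map_cons, Multiset.prod_cons,
          completeHomogeneous_zero,
          one_mul, ih]
      · rw [Multiset.filter_cons_of_pos (p := fun a => a ≠ 0) _ h, Multiset.map_cons, Multiset.map_cons,
          Multiset.prod_cons, Multiset.prod_cons, ih]
  rw [hSym, parts_twoPart, key]
  simp [mul_comm]

theorem hSym_indiscrete (hn : n ≠ 0) :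
    hSym (Nat.Partition.indiscrete n) = completeHomogeneous n := by
  rw [hSym, Nat.Partition.indiscrete_parts hn]
  simp

theorem forall_card_eq_iff {μ : n.Partition} (T : SemistandardYoungTableau (diagram μ))
    (m : ℕ →₀ ℕ) : (∀ i : ℕ, ((diagram μ).cells.filter fun c => T c.1 c.2 = i).card = m i) ↔
      ∑ c ∈ (diagram μ).cells, Finsupp.single (T c.1 c.2) 1 = m := by
  rw [DFunLike.ext_iff]
  refine forall_congr' fun i => ?_
  rw [sum_single_apply (diagram μ).cells (fun c => T c.1 c.2)]

theorem sum_cells_of_sort_eq_singleton {M : Type*} [AddCommMonoid M] {μ : n.Partition} {k : ℕ}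
    (h : μ.parts.sort (· ≥ ·) = [k]) (f : ℕ × ℕ → M) :
    ∑ c ∈ (diagram μ).cells, f c = ∑ j ∈ Finset.range k, f (0, j) := by
  symm
  refine Finset.sum_bij (fun j _ => (0, j)) ?_ (by simp) ?_ (fun _ _ => rfl)
  · intro j hj
    rw [YoungDiagram.mem_cells, mem_diagram_of_sort_eq_singleton h]
    exact ⟨rfl, Finset.mem_range.1 hj⟩
  · rintro ⟨i, j⟩ hc
    rw [YoungDiagram.mem_cells, mem_diagram_of_sort_eq_singleton h] at hc
    obtain ⟨h1, h2⟩ := hc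
    simp only at h1 h2
    exact ⟨j, Finset.mem_range.2 h2, by rw [h1]⟩

theorem sum_cells_of_sort_eq_pair {M : Type*} [AddCommMonoid M] {μ : n.Partition} {k : ℕ}
    (h : μ.parts.sort (· ≥ ·) = [k, 1]) (f : ℕ × ℕ → M) :
    ∑ c ∈ (diagram μ).cells, f c = f (1, 0) + ∑ j ∈ Finset.range k, f (0, j) := by
  have hmem : (1, 0) ∈ (diagram μ).cells := by
    rw [YoungDiagram.mem_cells, mem_diagram_of_sort_eq_pair h]
    exact .inr ⟨rfl, rfl⟩
  rw [← Finset.add_sum_erase _ _ hmem]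
  congr 1
  symm
  refine Finset.sum_bij (fun j _ => (0, j)) ?_ (by simp) ?_ (fun _ _ => rfl)
  · intro j hj
    rw [Finset.mem_erase, YoungDiagram.mem_cells, mem_diagram_of_sort_eq_pair h]
    exact ⟨by simp, .inl ⟨rfl, Finset.mem_range.1 hj⟩⟩
  · rintro ⟨i, j⟩ hc
    rw [Finset.mem_erase, YoungDiagram.mem_cells, mem_diagram_of_sort_eq_pair h] at hc
    obtain ⟨h0, ⟨h1, h2⟩ | ⟨h1, h2⟩⟩ := hc
    · simp only at h1 h2
      exact ⟨j, Finset.mem_range.2 h2, by rw [h1]⟩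
    · simp only at h1 h2
      exact absurd (by rw [h1, h2]) h0

theorem schur_indiscrete (hn : n ≠ 0) :
    schur (Nat.Partition.indiscrete n) = completeHomogeneous n := by
  have hs := sort_parts_indiscrete hn
  have hmem := mem_diagram_of_sort_eq_singleton hs
  funext m
  change (Nat.card _ : ℂ) = if m.degree = n then 1 else 0
  simp only [forall_card_eq_iff, sum_cells_of_sort_eq_singleton hs]
  split_ifs with hm
  · norm_cast
    rw [Nat.card_eq_one_iff_unique]
    constructor
    · constructor
      rintro ⟨T, hT⟩ ⟨T', hT'⟩
      apply Subtype.ext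
      apply SemistandardYoungTableau.ext
      intro i j
      by_cases hc : (i, j) ∈ diagram (Nat.Partition.indiscrete n)
      · have hij := (hmem _).1 hc
        simp only at hij
        obtain ⟨rfl, hj⟩ := hij
        rw [eq_sortedEntry (f := T 0) (fun a b hab hb => T.row_weak hab ((hmem _).2 ⟨rfl, hb⟩)) hT hj,
          eq_sortedEntry (f := T' 0) (fun a b hab hb => T'.row_weak hab ((hmem _).2 ⟨rfl, hb⟩)) hT' hj]
      · rw [T.zeros hc, T'.zeros hc]
    · refine ⟨⟨⟨fun i j => if i = 0 ∧ j < n then sortedEntry m j else 0, ?_, ?_, ?_⟩, ?_⟩⟩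
      · intro i j1 j2 h h'
        obtain ⟨h1, h2⟩ := (hmem _).1 h'
        simp only at h1 h2
        rw [if_pos ⟨h1, h.trans h2⟩, if_pos ⟨h1, h2⟩]
        exact sortedEntry_mono h (hm ▸ h2)
      · intro i1 i2 j h h'
        have := ((hmem _).1 h').1
        simp only at this
        omega
      · intro i j h
        rw [if_neg]
        exact fun h' => h ((hmem _).2 h')
      · conv_rhs => rw [← sum_single_sortedEntry m, hm]
        refine Finset.sum_congr rfl fun j hj => ?_
        change Finsupp.single (if 0 = 0 ∧ j < n then sortedEntry m j else 0) 1 = _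
        rw [if_pos ⟨rfl, Finset.mem_range.1 hj⟩]
  · norm_cast
    rw [Nat.card_eq_zero]
    left
    constructor
    rintro ⟨T, hT⟩
    apply hm
    rw [← hT, degree_sum_single, Finset.card_range]

/-- The entry of the second row determines the tableau, since the first row is the sorted remainder
of the content. Column strictness requires exactly that this entry is a letter of `m` other than the
smallest. -/
theorem card_tableaux_hook {μ : n.Partition} {k : ℕ} (hs : μ.parts.sort (· ≥ ·) = [k, 1])
    (hk : 1 ≤ k) (m : ℕ →₀ ℕ) (hm : m.degree = k + 1) :
    Nat.card {T : SemistandardYoungTableau (diagram μ) //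
      Finsupp.single (T 1 0) 1 + ∑ j ∈ Finset.range k, Finsupp.single (T 0 j) 1 = m} =
        Finset.card {i ∈ m.support | ∃ l ∈ m.support, l < i} := by
  have hmem := mem_diagram_of_sort_eq_pair hs
  have hmem0 : ∀ j, j < k → (0, j) ∈ diagram μ := fun j hj => (hmem _).2 (.inl ⟨rfl, hj⟩)
  have hmem1 : (1, 0) ∈ diagram μ := (hmem _).2 (.inr ⟨rfl, rfl⟩)
  rw [← Fintype.card_coe, ← Nat.card_eq_fintype_card]
  have hval : ∀ T : {T : SemistandardYoungTableau (diagram μ) //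
      Finsupp.single (T 1 0) 1 + ∑ j ∈ Finset.range k, Finsupp.single (T 0 j) 1 = m},
      T.1 1 0 ∈ Finset.filter (fun i => ∃ l ∈ m.support, l < i) m.support := by
    rintro ⟨T, hT⟩
    change T 1 0 ∈ _
    rw [Finset.mem_filter]
    have h00 : T 0 0 < T 1 0 := T.col_strict zero_lt_one hmem1
    refine ⟨?_, T 0 0, ?_, h00⟩
    · rw [Finsupp.mem_support_iff, ← hT]
      simp
    · rw [Finsupp.mem_support_iff, ← hT, Finsupp.add_apply, sum_single_apply]
      have : 0 < Finset.card {x ∈ Finset.range k | T 0 x = T 0 0} :=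
        Finset.card_pos.2 ⟨0, by simp; omega⟩
      omega
  refine Nat.card_eq_of_bijective (fun T => ⟨T.1 1 0, hval T⟩) ⟨?_, ?_⟩
  · rintro ⟨T, hT⟩ ⟨T', hT'⟩ h
    have h10 : T 1 0 = T' 1 0 := congrArg Subtype.val h
    apply Subtype.ext
    apply SemistandardYoungTableau.ext
    intro i j
    have hrow : ∑ j ∈ Finset.range k, Finsupp.single (T 0 j) 1 =
        ∑ j ∈ Finset.range k, Finsupp.single (T' 0 j) 1 := by
      rw [← hT', h10] at hT
      exact add_left_cancel hT
    by_cases hc : (i, j) ∈ diagram μ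
    · rcases (hmem _).1 hc with ⟨h1, hj⟩ | ⟨h1, h2⟩
      · simp only at h1 hj
        subst h1
        rw [eq_sortedEntry (f := T 0) (fun a b hab hb => T.row_weak hab (hmem0 b hb)) hrow hj,
          eq_sortedEntry (f := T' 0) (fun a b hab hb => T'.row_weak hab (hmem0 b hb)) rfl hj]
      · simp only at h1 h2
        rw [h1, h2, h10]
    · rw [T.zeros hc, T'.zeros hc]
  · rintro ⟨i, hi⟩
    rw [Finset.mem_filter] at hi
    obtain ⟨him, l, hl, hli⟩ := hi
    have hle : Finsupp.single i 1 ≤ m := by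
      rw [Finsupp.single_le_iff]
      exact Nat.one_le_iff_ne_zero.2 (Finsupp.mem_support_iff.1 him)
    obtain ⟨m', rfl⟩ := exists_add_of_le hle
    have hm' : m'.degree = k := by
      simp at hm; omega
    have hl' : m' l ≠ 0 := by
      have := Finsupp.mem_support_iff.1 hl
      rwa [Finsupp.add_apply, Finsupp.single_eq_of_ne hli.ne, zero_add] at this
    have h0 : sortedEntry m' 0 < i := by
      obtain ⟨j, hj, hjl⟩ := exists_sortedEntry_eq hl'
      rcases Nat.eq_zero_or_pos j with rfl | hj0
      · omega
      · have := sortedEntry_mono hj0 hj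
        omega
    refine ⟨⟨⟨fun a b => if a = 0 ∧ b < k then sortedEntry m' b else
      if a = 1 ∧ b = 0 then i else 0, ?_, ?_, ?_⟩, ?_⟩, ?_⟩
    · intro a j1 j2 h h'
      rcases (hmem _).1 h' with ⟨h1, h2⟩ | ⟨h1, h2⟩
      · simp only at h1 h2
        rw [if_pos ⟨h1, h.trans h2⟩, if_pos ⟨h1, h2⟩]
        exact sortedEntry_mono h (hm' ▸ h2)
      · simp only at h2
        omega
    · intro a1 a2 j h h'
      rcases (hmem _).1 h' with ⟨h1, h2⟩ | ⟨h1, h2⟩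
      · simp only at h1
        omega
      · simp only at h1 h2
        subst h1 h2
        have : a1 = 0 := by omega
        subst this
        rw [if_pos ⟨rfl, hk⟩, if_neg (by simp), if_pos ⟨rfl, rfl⟩]
        exact h0
    · intro a b h
      rw [if_neg, if_neg]
      · exact fun h' => h ((hmem _).2 (.inr h'))
      · exact fun h' => h ((hmem _).2 (.inl h'))
    · congr 1
      conv_rhs => rw [← sum_single_sortedEntry m', hm']
      refine Finset.sum_congr rfl fun j hj => ?_
      change Finsupp.single (if 0 = 0 ∧ j < k then sortedEntry m' j else _) 1 = _
      rw [if_pos ⟨rfl, Finset.mem_range.1 hj⟩]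
    · rfl

theorem card_filter_exists_lt {s : Finset ℕ} (hs : s.Nonempty) :
    Finset.card {i ∈ s | ∃ l ∈ s, l < i} + 1 = s.card := by
  have : Finset.filter (fun i => ∃ l ∈ s, l < i) s = s.erase (s.min' hs) := by
    ext i
    rw [Finset.mem_filter, Finset.mem_erase]
    constructor
    · rintro ⟨hi, l, hl, hli⟩
      refine ⟨?_, hi⟩
      rintro rfl
      exact absurd (s.min'_le l hl) (by omega)
    · rintro ⟨hne, hi⟩
      exact ⟨hi, s.min' hs, s.min'_mem hs, lt_of_le_of_ne (s.min'_le i hi) hne.symm⟩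
  rw [this, Finset.card_erase_add_one (s.min'_mem hs)]

theorem coeff_completeHomogeneous_one_mul (k : ℕ) (m : ℕ →₀ ℕ) :
    MvPowerSeries.coeff m (completeHomogeneous 1 * completeHomogeneous k) =
      if m.degree = k + 1 then (m.support.card : ℂ) else 0 := by
  classical
  rw [MvPowerSeries.coeff_mul]
  have h1 : ∀ x : (ℕ →₀ ℕ) × (ℕ →₀ ℕ), MvPowerSeries.coeff x.1 (completeHomogeneous 1) *
      MvPowerSeries.coeff x.2 (completeHomogeneous k) =
      if x.1.degree = 1 ∧ x.2.degree = k then 1 else 0 := by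
    intro x
    change (if x.1.degree = 1 then (1 : ℂ) else 0) * (if x.2.degree = k then 1 else 0) = _
    rw [ite_and]
    split_ifs <;> simp
  simp only [h1]
  rw [Finset.sum_boole]
  split_ifs with hm
  · congr 1
    symm
    refine Finset.card_bij (fun i _ => (Finsupp.single i 1, m - Finsupp.single i 1)) ?_ ?_ ?_
    · intro i hi
      have hle : Finsupp.single i 1 ≤ m := by
        rw [Finsupp.single_le_iff]
        exact Nat.one_le_iff_ne_zero.2 (Finsupp.mem_support_iff.1 hi)
      obtain ⟨m', rfl⟩ := exists_add_of_le hle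
      rw [Finset.mem_filter, Finset.HasAntidiagonal.mem_antidiagonal]
      simp only [map_add, Finsupp.degree_single] at hm
      simp only [add_tsub_cancel_left, Finsupp.degree_single, true_and]
      omega
    · intro i _ j _ h
      exact Finsupp.single_left_injective one_ne_zero (congrArg Prod.fst h)
    · rintro ⟨m₁, m₂⟩ hx
      rw [Finset.mem_filter, Finset.HasAntidiagonal.mem_antidiagonal] at hx
      obtain ⟨rfl, h2, h3⟩ := hx
      obtain ⟨i, hi⟩ := (Finsupp.sum_eq_one_iff m₁).1 h2
      subst hi
      refine ⟨i, ?_, ?_⟩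
      · simp
      · simp
  · rw [Finset.card_eq_zero.2, Nat.cast_zero]
    rw [Finset.filter_eq_empty_iff]
    rintro ⟨m₁, m₂⟩ hx ⟨h2, h3⟩
    rw [Finset.HasAntidiagonal.mem_antidiagonal] at hx
    apply hm
    simp only at h2 h3 hx
    rw [← hx, map_add, h2, h3, add_comm]

/-- In degree `n`, `h_1 h_{n-1}` counts the letters of `m`, while the tableaux correspond to the
letters except the least one; subtracting `h_n` accounts for it. -/
theorem schur_twoPart_one (hn : 2 ≤ n) :
    schur (twoPart n 1 (one_le_two.trans hn)) =
      completeHomogeneous 1 * completeHomogeneous (n - 1) - completeHomogeneous n := by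
  have hs := sort_parts_twoPart_one hn
  ext m
  rw [map_sub, coeff_completeHomogeneous_one_mul]
  change (Nat.card _ : ℂ) = _ - if m.degree = n then 1 else 0
  simp only [forall_card_eq_iff, sum_cells_of_sort_eq_pair hs]
  have hn1 : n - 1 + 1 = n := by omega
  rw [hn1]
  split_ifs with hm
  · rw [card_tableaux_hook hs (by omega) m (by omega), eq_sub_iff_add_eq]
    have hne : m.support.Nonempty := by
      rw [Finsupp.support_nonempty_iff]
      rintro rfl
      simp at hm
      omega
    exact_mod_cast card_filter_exists_lt hne
  · rw [sub_zero]
    norm_cast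
    rw [Nat.card_eq_zero]
    left
    constructor
    rintro ⟨T, hT⟩
    apply hm
    rw [← hT, map_add, degree_sum_single, Finset.card_range, Finsupp.degree_single]
    omega

end Schur

/-! ### Sizes of branches for the different kinds of blocks -/

section BlockShapes

variable {n : ℕ} {Γ : SimpleGraph (Fin n)} {B : Γ.Subgraph}

/-- The neighbours of a block in the block-cut tree are its cut vertices, and a leaf block has just
one. So a two-vertex leaf block has a branch of size one. -/
theorem exists_not_isCutVertex_of_mem_leafBlocks (hB : B ∈ leafBlocks Γ) {i j : Fin n}
    (hij : i ≠ j) (hi : i ∈ B.verts) (hj : j ∈ B.verts) :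
    ¬ IsCutVertex Γ i ∨ ¬ IsCutVertex Γ j := by
  obtain ⟨hb, hc⟩ := hB
  by_contra! hcon
  obtain ⟨x, hx⟩ := Set.encard_eq_one.1 hc
  have h1 : (Sum.inl ⟨i, hcon.1⟩ : {v // IsCutVertex Γ v} ⊕ {B : Γ.Subgraph // IsBlock B}) ∈
      (blockCutTree Γ).neighborSet (.inr ⟨B, hb⟩) := hi
  have h2 : (Sum.inl ⟨j, hcon.2⟩ : {v // IsCutVertex Γ v} ⊕ {B : Γ.Subgraph // IsBlock B}) ∈
      (blockCutTree Γ).neighborSet (.inr ⟨B, hb⟩) := hj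
  rw [hx, Set.mem_singleton_iff] at h1 h2
  have := h1.trans h2.symm
  rw [Sum.inl.injEq, Subtype.mk.injEq] at this
  exact hij this

variable [Nontrivial (Fin n)]

theorem IsBlock.pair_or_large (hΓ : Γ.Connected) (hB : IsBlock B) :
    (∃ i j, Γ.Adj i j ∧ B.verts = {i, j}) ∨
      (2 < B.verts.ncard ∧ ∀ p q, ∃ r ∈ B.verts, r ≠ p ∧ r ≠ q) := by
  obtain ⟨i, j, hij, hi, hj⟩ := hB.exists_adj hΓ
  by_cases h : B.verts = {i, j}
  · exact .inl ⟨i, j, hij, h⟩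
  right
  obtain ⟨k, hk, hki, hkj⟩ : ∃ k ∈ B.verts, k ≠ i ∧ k ≠ j := by
    by_contra! hcon
    refine h (Set.Subset.antisymm (fun k hk => ?_) ?_)
    · by_cases hki : k = i
      · exact .inl hki
      · exact .inr (hcon k hk hki)
    · rintro k (rfl | rfl)
      · exact hi
      · exact hj
  refine ⟨(Set.two_lt_ncard_iff).2 ⟨i, j, k, hi, hj, hk, hij.ne, hki.symm, hkj.symm⟩, ?_⟩
  intro p q
  have hne := hij.ne
  by_cases h1 : i ≠ p ∧ i ≠ q
  · exact ⟨i, hi, h1⟩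
  by_cases h2 : j ≠ p ∧ j ≠ q
  · exact ⟨j, hj, h2⟩
  refine ⟨k, hk, ?_⟩
  constructor <;> rintro rfl <;> grind

theorem IsBlock.eq_of_verts_eq (hΓ : Γ.Connected) {B' : Γ.Subgraph} (hB : IsBlock B)
    (hB' : IsBlock B') (h : B.verts = B'.verts) : B = B' := by
  obtain ⟨i, j, hij, hi, hj⟩ := hB.exists_adj hΓ
  rw [hB.eq_edgeBlock hΓ hij hi hj, hB'.eq_edgeBlock hΓ hij (h ▸ hi) (h ▸ hj)]

theorem card_branch_add_card_branch (hΓ : Γ.Connected) (hB : IsBlock B) {i j : Fin n}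
    (hij : i ≠ j) (hv : B.verts = {i, j}) : (branch B i).card + (branch B j).card = n := by
  rw [← Finset.card_union_of_disjoint]
  · have : branch B i ∪ branch B j = Finset.univ := by
      rw [Finset.eq_univ_iff_forall]
      intro z
      have := blockProj_mem hΓ hB z
      rw [hv] at this
      rw [Finset.mem_union, mem_branch, mem_branch]
      exact this
    rw [this, Finset.card_univ, Fintype.card_fin]
  · rw [Finset.disjoint_left]
    intro z hi hj
    rw [mem_branch] at hi hj
    exact hij (hi.symm.trans hj)

theorem card_branch_eq_one (hΓ : Γ.Connected) (hB : IsBlock B) {i : Fin n} (hi : i ∈ B.verts)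
    (hcut : ¬ IsCutVertex Γ i) : (branch B i).card = 1 := by
  rw [isCutVertex_iff hΓ hB hi] at hcut
  push Not at hcut
  rw [Finset.card_eq_one]
  refine ⟨i, ?_⟩
  ext z
  rw [mem_branch, Finset.mem_singleton]
  constructor
  · intro h
    by_contra hz
    exact hcut z hz h
  · rintro rfl
    exact blockProj_eq_self hΓ hB hi

/-- Some vertex of some block has no other vertex attached to the block through it. -/
theorem exists_card_branch_eq_one (hΓ : Γ.Connected) :
    ∃ B : {B : Γ.Subgraph // IsBlock B}, ∃ i ∈ B.1.verts, (branch B.1 i).card = 1 := by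
  have hex : ∃ k, ∃ B : {B : Γ.Subgraph // IsBlock B}, ∃ i ∈ B.1.verts,
      (branch B.1 i).card = k := by
    obtain ⟨v⟩ := hΓ.nonempty
    obtain ⟨y, hy⟩ := hΓ.preconnected.exists_adj_of_nontrivial v
    exact ⟨_, ⟨edgeBlock Γ v y, isBlock_edgeBlock hΓ hy⟩, v, left_mem_blockVerts hy, rfl⟩
  classical
  -- Take a smallest branch. If `i` were a cut vertex, it would have a neighbour `y` in its own
  -- branch, and the branch of `y` at the block of `i y` lies in the old one but misses `i`.
  obtain ⟨⟨B, hB⟩, i, hi, hk⟩ := Nat.find_spec hex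
  refine ⟨⟨B, hB⟩, i, hi, ?_⟩
  refine card_branch_eq_one hΓ hB hi fun hcut => ?_
  obtain ⟨x, hxi, hx⟩ := (isCutVertex_iff hΓ hB hi).1 hcut
  have hr := (blockProj_spec hΓ hB x).2
  rw [hx] at hr
  obtain ⟨w⟩ := hr.symm
  cases w with
  | nil => exact hxi rfl
  | @cons _ y _ hiy w =>
    have hy : blockProj B y = i := by
      rw [← blockProj_eq_of_adj hΓ hB hiy.1 hiy.2, blockProj_eq_self hΓ hB hi]
    have hB' := isBlock_edgeBlock hΓ hiy.1
    have hlt : (branch (edgeBlock Γ i y) y).card < Nat.find hex := by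
      rw [← hk]
      refine Finset.card_lt_card (Finset.ssubset_iff_of_subset ?_ |>.2 ⟨i, ?_, ?_⟩)
      · intro z hz
        rw [mem_branch] at hz ⊢
        have hyy := blockProj_eq_self hΓ hB' (right_mem_blockVerts hiy.1)
        have hav : Avoids Γ i y z := avoids_of_blockProj_ne hΓ hB' (left_mem_blockVerts hiy.1)
          (by rw [hyy]; exact hiy.1.ne') (by rw [hz]; exact hiy.1.ne')
        exact blockProj_eq_of_avoids hΓ hB hav hy
      · rw [mem_branch, blockProj_eq_self hΓ hB hi]
      · rw [mem_branch, blockProj_eq_self hΓ hB' (left_mem_blockVerts hiy.1)]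
        exact hiy.1.ne
    exact Nat.find_min hex hlt ⟨⟨_, hB'⟩, y, right_mem_blockVerts hiy.1, rfl⟩

/-- The subset size of a two-vertex block depends on which end is called `i`, hence the disjunction.
It is harmless because the two branches have sizes adding up to `n`. -/
theorem exists_blockModel (hΓ : Γ.Connected) (hB : IsBlock B) :
    ∃ a, ∃ Φ : ({s : Finset (Fin n) // s.card = a} → ℂ) →ₗ[ℂ] (Fin n → Perm (Fin n) → ℂ),
      BlockModel B a Φ ∧ a ≤ n ∧ (2 < B.verts.ncard → a = 1) ∧
        ∀ i j, i ≠ j → B.verts = {i, j} → a = (branch B i).card ∨ a = (branch B j).card := by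
  rcases hB.pair_or_large hΓ with ⟨i, j, hij, hv⟩ | ⟨hlt, h3⟩
  · refine ⟨_, _, blockModel_pairModel hΓ hB hij.ne hv, ?_, ?_, ?_⟩
    · have := card_branch_add_card_branch hΓ hB hij.ne hv
      omega
    · intro h
      rw [hv, Set.ncard_pair hij.ne] at h
      omega
    · intro k l _ hv'
      have hi : i ∈ ({k, l} : Set (Fin n)) := by rw [← hv', hv]; simp
      rcases hi with rfl | hi
      · exact .inl rfl
      · rw [Set.mem_singleton_iff] at hi
        subst hi
        exact .inr rfl
  · refine ⟨1, _, blockModel_pointModel hΓ hB h3, ?_, fun _ => rfl, ?_⟩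
    · have := Fin.nontrivial_iff_two_le.1 (inferInstance : Nontrivial (Fin n))
      omega
    · intro k l hkl hv'
      rw [hv', Set.ncard_pair hkl] at hlt
      omega

/-- The block has `i j` as its only edge, so deleting this edge is the same as deleting all edges of
B, and the components are the two branches. -/
theorem deleteEdges_reachable_iff (hΓ : Γ.Connected) (hB : IsBlock B) {i j : Fin n}
    (hij : Γ.Adj i j) (hv : B.verts = {i, j}) {x y : Fin n} :
    (Γ.deleteEdges {s(i, j)}).Reachable x y ↔ blockProj B x = blockProj B y := by
  have hgr : Γ.deleteEdges {s(i, j)} = Γ \ B.spanningCoe := by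
    ext x y
    rw [SimpleGraph.deleteEdges_adj, SimpleGraph.sdiff_adj, SimpleGraph.Subgraph.spanningCoe_adj,
      hB.adj_iff hΓ, hv]
    refine and_congr_right fun hxy => not_congr ?_
    have := hxy.ne
    simp only [Set.mem_singleton_iff, Sym2.eq_iff, Set.mem_insert_iff]
    have := hij.ne
    constructor
    · rintro (⟨rfl, rfl⟩ | ⟨rfl, rfl⟩) <;> simp [hxy]
    · rintro ⟨rfl | rfl, rfl | rfl, -⟩ <;> simp_all
  rw [hgr, blockProj_eq_iff hΓ hB]

theorem ncard_supp_eq (hΓ : Γ.Connected) (hB : IsBlock B) {i j : Fin n}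
    (hij : Γ.Adj i j) (hv : B.verts = {i, j})
    (c : (Γ.deleteEdges {s(i, j)}).ConnectedComponent) :
    c.supp.ncard = (branch B i).card ∨ c.supp.ncard = (branch B j).card := by
  induction c using SimpleGraph.ConnectedComponent.ind with | _ v =>
  have hs : ((Γ.deleteEdges {s(i, j)}).connectedComponentMk v).supp =
      ↑(branch B (blockProj B v)) := by
    ext x
    rw [SimpleGraph.ConnectedComponent.mem_supp_iff, SimpleGraph.ConnectedComponent.eq,
      deleteEdges_reachable_iff hΓ hB hij hv, Finset.mem_coe, mem_branch]
  rw [hs, Set.ncard_coe_finset]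
  have := blockProj_mem hΓ hB v
  rw [hv] at this
  rcases this with h | h
  · rw [h]; exact .inl rfl
  · rw [Set.mem_singleton_iff.1 h]; exact .inr rfl

end BlockShapes

/-! ### The Frobenius characteristic as a linear map -/

section FrobeniusMap

variable {n : ℕ}

/-- The Frobenius characteristic as a linear map on functions on the symmetric group. -/
def frobeniusMap (n : ℕ) : (Perm (Fin n) → ℂ) →ₗ[ℂ] MvPowerSeries ℕ ℂ where
  toFun χ := ((n.factorial : ℂ)⁻¹) • ∑ w : Perm (Fin n),
    χ w • (w.partition.parts.map powerSum).prod
  map_add' χ ψ := by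
    simp only [Pi.add_apply, add_smul, Finset.sum_add_distrib, smul_add]
  map_smul' c χ := by
    simp only [Pi.smul_apply, smul_eq_mul, mul_smul, ← Finset.smul_sum, RingHom.id_apply]
    rw [smul_comm]

theorem frobenius_eq_frobeniusMap {V : Type*} [AddCommGroup V] [Module ℂ V]
    (ρ : Representation ℂ (Perm (Fin n)) V) : frobenius ρ = frobeniusMap n ρ.character :=
  rfl

theorem frobeniusMap_fixCount {a : ℕ} (ha : a ≤ n) :
    frobeniusMap n (fixCount a) = hSym (twoPart n a ha) := by
  rw [hSym_twoPart, ← sum_fixCount_smul ha]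
  rfl

theorem fixCount_zero (u : Perm (Fin n)) : fixCount 0 u = 1 := by
  have hs : ∀ s t : {s : Finset (Fin n) // s.card = 0}, s = t := fun s t =>
    Subtype.ext ((Finset.card_eq_zero.1 s.2).trans (Finset.card_eq_zero.1 t.2).symm)
  let : Unique {s : Finset (Fin n) // s.card = 0} := ⟨⟨⟨∅, rfl⟩⟩, fun s => hs _ _⟩
  rw [fixCount, Fintype.sum_unique, if_pos (hs _ _)]

theorem frobeniusMap_one (hn : n ≠ 0) :
    frobeniusMap n 1 = hSym (Nat.Partition.indiscrete n) := by
  have : (1 : Perm (Fin n) → ℂ) = fixCount 0 := funext fun u => (fixCount_zero u).symm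
  rw [this, frobeniusMap_fixCount (Nat.zero_le n), hSym_twoPart, hSym_indiscrete hn,
    completeHomogeneous_zero, one_mul, Nat.sub_zero]

theorem hSym_twoPart_eq_of_add_eq {a b : ℕ} (h : a + b = n) (ha : a ≤ n) (hb : b ≤ n) :
    hSym (twoPart n a ha) = hSym (twoPart n b hb) := by
  rw [hSym_twoPart, hSym_twoPart, mul_comm]
  congr <;> omega

end FrobeniusMap

/-! ### Assembling the contributions of the blocks -/

section Assembly

variable {n : ℕ} {Γ : SimpleGraph (Fin n)}

theorem mem_internalCutEdges {e : Sym2 (Fin n)} : e ∈ internalCutEdges Γ ↔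
    e ∈ Γ.edgeSet ∧ ∃ B ∈ internalBlocks Γ, B.verts = (e : Set (Fin n)) := by
  simp only [internalCutEdges, Finset.mem_filter_univ]

/-- A sum over all blocks, split into the internal cut edges and the remaining blocks. -/
theorem sum_blocks_eq (hΓ : Γ.Connected) [Nontrivial (Fin n)]
    [Fintype {B : Γ.Subgraph // IsBlock B}] {M : Type*} [AddCommMonoid M]
    (f : {B : Γ.Subgraph // IsBlock B} → M) (g : Sym2 (Fin n) → M) (c : M)
    (hc : ∀ B, B.1 ∈ leafBlocks Γ ∨ 2 < B.1.verts.ncard → f B = c)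
    (hg : ∀ B i j, Γ.Adj i j → B.1.verts = {i, j} → f B = g s(i, j)) :
    ∑ B, f B = blockCount Γ • c + ∑ e ∈ internalCutEdges Γ, g e := by
  classical
  rw [← Finset.sum_filter_add_sum_filter_not _ fun B => B.1 ∈ leafBlocks Γ ∨ 2 < B.1.verts.ncard]
  congr 1
  · rw [Finset.sum_congr rfl (g := fun _ => c) (by simpa using hc), Finset.sum_const]
    congr 1
    have h1 : (leafBlocks Γ).Finite := (Set.toFinite {B : Γ.Subgraph | IsBlock B}).subset
      fun B hB => hB.1
    have h2 : {B ∈ internalBlocks Γ | 2 < B.verts.ncard}.Finite :=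
      (Set.toFinite {B : Γ.Subgraph | IsBlock B}).subset fun B hB => hB.1.1
    rw [blockCount, ← Set.ncard_union_eq (Set.disjoint_left.2 fun B hB hB' => hB'.1.2 hB) h1 h2,
      ← Set.ncard_coe_finset, ← Set.ncard_image_of_injective _ Subtype.val_injective]
    congr 1
    ext B
    simp only [Finset.coe_filter, Finset.mem_univ, true_and, Set.mem_image, Set.mem_ofPred_eq,
      Subtype.exists, exists_and_right, exists_eq_right, Set.mem_union, internalBlocks]
    constructor
    · rintro ⟨hB, h⟩
      tauto
    · rintro (h | ⟨⟨hB, -⟩, h⟩)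
      · exact ⟨h.1, .inl h⟩
      · exact ⟨hB, .inr h⟩
  -- The remaining blocks are internal with exactly two vertices; a block is determined by its
  -- vertices, so they correspond to the internal cut edges.
  · have hex : ∀ e ∈ internalCutEdges Γ, ∃ B : {B : Γ.Subgraph // IsBlock B},
        B.1 ∈ internalBlocks Γ ∧ B.1.verts = (e : Set (Fin n)) := fun e he => by
      obtain ⟨B, hB, hv⟩ := (mem_internalCutEdges.1 he).2
      exact ⟨⟨B, hB.1⟩, hB, hv⟩
    have hadj : ∀ e ∈ internalCutEdges Γ, e ∈ Γ.edgeSet := fun e he =>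
      (mem_internalCutEdges.1 he).1
    choose β hβ hv using hex
    symm
    refine Finset.sum_bij β (fun e he => ?_) (fun e he e' he' h => ?_) (fun B hB => ?_)
      fun e he => ?_
    · rw [Finset.mem_filter]
      refine ⟨Finset.mem_univ _, ?_⟩
      rintro (h | h)
      · exact (hβ e he).2 h
      · have he' := hadj e he
        rw [hv e he] at h
        induction e with | _ i j =>
        rw [Sym2.coe_mk, Set.ncard_pair (SimpleGraph.Adj.ne he')] at h
        omega
    · refine SetLike.coe_injective ?_
      rw [← hv e he, ← hv e' he', h]
    · rw [Finset.mem_filter] at hB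
      have hB' := not_or.1 hB.2
      rcases B.2.pair_or_large hΓ with ⟨i, j, hij, hvB⟩ | ⟨h, -⟩
      · have he : s(i, j) ∈ internalCutEdges Γ :=
          mem_internalCutEdges.2 ⟨hij, B.1, ⟨B.2, hB'.1⟩, by rw [hvB, Sym2.coe_mk]⟩
        refine ⟨_, he, Subtype.ext (IsBlock.eq_of_verts_eq hΓ (β _ he).2 B.2 ?_)⟩
        rw [hv _ he, hvB, Sym2.coe_mk]
      · exact absurd h hB'.2
    · have he' := hadj e he
      have hve := hv e he
      generalize β e he = B at hve
      induction e with | _ i j =>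
      rw [Sym2.coe_mk] at hve
      exact (hg B i j he' hve).symm

theorem not_connected_of_mem_internalCutEdges [Nontrivial (Fin n)] (hΓ : Γ.Connected)
    {e : Sym2 (Fin n)} (he : e ∈ internalCutEdges Γ) : ¬ (Γ.deleteEdges {e}).Connected := by
  obtain ⟨he, B, hB, hv⟩ := mem_internalCutEdges.1 he
  induction e with | _ i j =>
  rw [Sym2.coe_mk] at hv
  intro hc
  have := (deleteEdges_reachable_iff hΓ hB.1 he hv).1 (hc.preconnected i j)
  rw [blockProj_eq_self hΓ hB.1 (hv ▸ .inl rfl), blockProj_eq_self hΓ hB.1 (hv ▸ .inr rfl)] at this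
  exact SimpleGraph.Adj.ne he this

/-- Both characters in terms of blocks alone, before blocks are sorted into leaf, large and cut-edge
blocks. The last two clauses identify the contribution of each kind. -/
theorem exists_block_partitions (hΓ : Γ.Connected) (hn : 2 ≤ n)
    [Fintype {B : Γ.Subgraph // IsBlock B}] :
    ∃ μ : {B : Γ.Subgraph // IsBlock B} → n.Partition,
      (leftChar Γ 1 = n • hSym (Nat.Partition.indiscrete n) + ∑ B, hSym (μ B) -
        Fintype.card {B : Γ.Subgraph // IsBlock B} • hSym (Nat.Partition.indiscrete n) -
        hSym (twoPart n 1 (one_le_two.trans hn))) ∧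
      (rightChar Γ 1 = ∑ B, hSym (μ B) -
        Fintype.card {B : Γ.Subgraph // IsBlock B} • hSym (Nat.Partition.indiscrete n)) ∧
      (∀ B i, i ∈ B.1.verts → 2 < B.1.verts.ncard ∨ (branch B.1 i).card = 1 →
        hSym (μ B) = hSym (twoPart n 1 (one_le_two.trans hn))) ∧
      ∀ (B : {B : Γ.Subgraph // IsBlock B}) i j, Γ.Adj i j → B.1.verts = {i, j} →
        ∀ c : (Γ.deleteEdges {s(i, j)}).ConnectedComponent,
          hSym (μ B) = hSym (componentPartition c) := by
  have := Fin.nontrivial_iff_two_le.2 hn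
  choose a Φ hΦ ha h3 h2 using fun B : {B : Γ.Subgraph // IsBlock B} => exists_blockModel hΓ B.2
  have hsum (c : ℂ) : (fun u => c + ∑ B, fixCount (a B) u -
      Fintype.card {B : Γ.Subgraph // IsBlock B} : Perm (Fin n) → ℂ) =
      c • 1 + ∑ B, fixCount (a B) - (Fintype.card {B : Γ.Subgraph // IsBlock B} : ℂ) • 1 := by
    funext u
    simp [Finset.sum_apply]
  have hmap (c : ℂ) : frobeniusMap n (c • 1 + ∑ B, fixCount (a B) -
      (Fintype.card {B : Γ.Subgraph // IsBlock B} : ℂ) • 1) =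
      c • hSym (Nat.Partition.indiscrete n) + ∑ B, hSym (twoPart n (a B) (ha B)) -
        Fintype.card {B : Γ.Subgraph // IsBlock B} • hSym (Nat.Partition.indiscrete n) := by
    rw [map_sub, map_add, map_sum, map_smul, map_smul, frobeniusMap_one (by omega),
      Nat.cast_smul_eq_nsmul]
    simp only [frobeniusMap_fixCount, ha]
  refine ⟨fun B => twoPart n (a B) (ha B), ?_, ?_, fun B i hi h => ?_,
    fun B i j hij hv c => ?_⟩
  · have hχ : (leftRep Γ 1).character = ((n : ℂ) • 1 + ∑ B, fixCount (a B) -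
        (Fintype.card {B : Γ.Subgraph // IsBlock B} : ℂ) • 1) - fixCount 1 := by
      rw [← hsum]
      funext u
      rw [leftRep_character hΓ, trace_translate hΓ ha hΦ]
      rfl
    rw [leftChar, frobenius_eq_frobeniusMap, hχ, map_sub, hmap, Nat.cast_smul_eq_nsmul,
      frobeniusMap_fixCount]
  · have hχ : (rightRep Γ 1).character = ((0 : ℂ) • 1 + ∑ B, fixCount (a B) -
        (Fintype.card {B : Γ.Subgraph // IsBlock B} : ℂ) • 1) := by
      rw [← hsum]
      funext u
      rw [rightRep_character hΓ, trace_translate hΓ ha hΦ]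
      ring
    rw [rightChar, frobenius_eq_frobeniusMap, hχ, hmap, zero_smul, zero_add]
  · dsimp only
    -- With a branch of size one, `a B` is `1` or `n - 1` according to the end used by the model;
    -- both give `h_{n-1,1}`.
    have key : a B = 1 ∨ a B + 1 = n := by
      rcases B.2.pair_or_large hΓ with ⟨k, l, hkl, hv⟩ | ⟨hl, -⟩
      · rcases h with h | h
        · exact .inl (h3 B h)
        · have hs := card_branch_add_card_branch hΓ B.2 hkl.ne hv
          have hm := h2 B k l hkl.ne hv
          rw [hv] at hi
          rcases hi with rfl | hi
          · omega
          · rw [Set.mem_singleton_iff] at hi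
            subst hi
            omega
      · exact .inl (h3 B hl)
    rcases key with h | h
    · simp only [h]
    · exact hSym_twoPart_eq_of_add_eq h _ _
  · have hs := card_branch_add_card_branch hΓ B.2 hij.ne hv
    have hm := h2 B i j hij.ne hv
    have hc := ncard_supp_eq hΓ B.2 hij hv c
    have key : a B = c.supp.ncard ∨ a B + c.supp.ncard = n := by omega
    rw [componentPartition]
    rcases key with h | h
    · simp only [h]
    · exact hSym_twoPart_eq_of_add_eq h _ _

end Assembly

end CayleySpline

end

/-! ### The formulas and h-positivity -/

open CayleySpline in
theorem theoremD (n : ℕ) (hn : 2 ≤ n) (Γ : SimpleGraph (Fin n)) (hΓ : Γ.Connected)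
    (C : ∀ e : Sym2 (Fin n), (Γ.deleteEdges {e}).ConnectedComponent) :
    (∀ e ∈ internalCutEdges Γ, ¬ (Γ.deleteEdges {e}).Connected) ∧
      leftChar Γ 1 =
        (∑ e ∈ internalCutEdges Γ, hSym (componentPartition (C e)))
          + ((blockCount Γ : ℤ) - 1) • hSym (twoPart n 1 (one_le_two.trans hn))
          + ((n : ℤ) - 1 - ∑ j ∈ cutVertices Γ, (cutNumber Γ j : ℤ)) •
              hSym (Nat.Partition.indiscrete n) ∧
      rightChar Γ 1 =
        (∑ e ∈ internalCutEdges Γ,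
            (hSym (componentPartition (C e)) - schur (Nat.Partition.indiscrete n)))
          + blockCount Γ • schur (twoPart n 1 (one_le_two.trans hn)) ∧
      0 ≤ (n : ℤ) - 1 - ∑ j ∈ cutVertices Γ, (cutNumber Γ j : ℤ) ∧
      ∃ a : n.Partition → ℕ, leftChar Γ 1 = ∑ μ, a μ • hSym μ := by
  classical
  have := Fin.nontrivial_iff_two_le.2 hn
  have := Fintype.ofFinite {B : Γ.Subgraph // IsBlock B}
  obtain ⟨μ, hL, hR, h1, h2⟩ := exists_block_partitions hΓ hn
  have hcut := sum_cutNumber_add_one hΓ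
  have hlt := card_blocks_lt hΓ
  rw [Nat.card_eq_fintype_card] at hcut hlt
  rw [Fintype.card_fin] at hlt
  have hleaf : ∀ B : {B : Γ.Subgraph // IsBlock B},
      B.1 ∈ leafBlocks Γ ∨ 2 < B.1.verts.ncard →
        hSym (μ B) = hSym (twoPart n 1 (one_le_two.trans hn)) := by
    intro B h
    rcases B.2.pair_or_large hΓ with ⟨i, j, hij, hv⟩ | ⟨hl, -⟩
    · have hi : i ∈ B.1.verts := hv ▸ .inl rfl
      have hj : j ∈ B.1.verts := hv ▸ .inr rfl
      rcases h with h | h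
      · rcases exists_not_isCutVertex_of_mem_leafBlocks h hij.ne hi hj with hc | hc
        · exact h1 B i hi (.inr (card_branch_eq_one hΓ B.2 hi hc))
        · exact h1 B j hj (.inr (card_branch_eq_one hΓ B.2 hj hc))
      · exact h1 B i hi (.inl h)
    · obtain ⟨i, _, _, hi, _⟩ := B.2.exists_adj hΓ
      exact h1 B i hi (.inl hl)
  have hsum := sum_blocks_eq hΓ (fun B => hSym (μ B)) (fun e => hSym (componentPartition (C e)))
    _ hleaf fun B i j hij hv => h2 B i j hij hv _
  have hcard : Fintype.card {B : Γ.Subgraph // IsBlock B} =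
      blockCount Γ + (internalCutEdges Γ).card := by
    simpa using sum_blocks_eq (M := ℕ) hΓ (fun _ => 1) (fun _ => 1) 1 (fun _ _ => rfl)
      fun _ _ _ _ _ => rfl
  have hcoef : (n : ℤ) - 1 - ∑ j ∈ cutVertices Γ, (cutNumber Γ j : ℤ) =
      n - Fintype.card {B : Γ.Subgraph // IsBlock B} := by
    rw [← hcut]
    push_cast
    ring
  refine ⟨fun e he => not_connected_of_mem_internalCutEdges hΓ he, ?_, ?_, ?_, ?_⟩
  · rw [hL, hsum, hcoef]
    module
  · rw [hR, hsum, hcard, Finset.sum_sub_distrib, Finset.sum_const, schur_indiscrete (by omega),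
      schur_twoPart_one hn, hSym_indiscrete (by omega), hSym_twoPart]
    module
  · omega
  · obtain ⟨B, i, hi, hB⟩ := exists_card_branch_eq_one hΓ
    -- The block `B` contributes an `h_{n-1,1}` that cancels the one subtracted in L. Every other
    -- block contributes one `h_μ`, and `h_n` occurs `n - #blocks` further times. The cancellation
    -- is needed for n = 2, where `blockCount Γ - 1` is `-1`.
    refine ⟨fun ν => (∑ A ∈ Finset.univ.erase B, if μ A = ν then 1 else 0) +
      if Nat.Partition.indiscrete n = ν then
        n - Fintype.card {B : Γ.Subgraph // IsBlock B} else 0, ?_⟩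
    simp only [add_smul, Finset.sum_smul, Finset.sum_add_distrib]
    rw [Finset.sum_comm]
    simp only [ite_smul, zero_smul, one_smul, Finset.sum_ite_eq, Finset.mem_univ, if_true]
    rw [hL, ← Finset.add_sum_erase _ _ (Finset.mem_univ B), h1 B i hi (.inr hB),
      ← Nat.cast_smul_eq_nsmul ℤ (n - _), Nat.cast_sub (by omega)]
    module
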